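/- **Proposition (Statistical preconditioning: non-isotropic results).** *Setting.* Let $d,n,N\ge 1$ be integers and let $\Sigma\in\mathbb R^{d\times d}$ be symmetric positive definite with eigenvalues $\sigma_1^2\ge\dots\ge\sigma_d^2>0$. For an integer $r\ge1$ put $d_{\rm eff}(r)=\sum_{i=1}^d(\sigma_i/\sigma_1)^{2/r}$. A random vector $a$ in $\mathbb R^d$ is $\Sigma$-subgaussian if $\mathbb P(|a^\top x|>t)\le 2\exp\!\big(-\tfrac{t^2}{2x^\top\Sigma x}\big)$ for all $t>0$ and all $\|x\|\le1$. Let $\ell:\mathbb R\to\mathbb R$ be convex and twice differentiable, with $\ell''$ Lipschitz with constant $\|\ell''\|_{\rm Lip}$. Let $\ell_1,\dots,\ell_n$ and $\tilde\ell_1,\dots,\tilde\ell_N$ be convex, twice differentiable functions on $\mathbb R$ with $\ell_j''=\tilde\ell_i''=\ell''$ for all $i,j$. Let $a_1,\dots,a_n$ be i.i.d. $\Sigma$-subgaussian random vectors and let $\tilde a_1,\dots,\tilde a_N$ be i.i.d. with the same law as the $a_j$ (on the same probability space; the two samples need not be independent of each other). For $\lambda>0$ let $$F(x)=\frac1n\sum_{j=1}^n\ell_j(a_j^\top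 x)+\frac\lambda2\|x\|^2,\qquad \tilde f(x)=\frac1N\sum_{i=1}^N\tilde\ell_i(\tilde a_i^\top x)+\frac\lambda2\|x\|^2,$$ and for $\mu\ge0$ let $\phi(x)=\tilde f(x)+\frac\mu2\|x\|^2$. Let $\psi$ be a convex function with convex domain ${\rm Dom}_\psi\subset\mathbb R^d$ such that $\|x\|\le R$ for all $x\in{\rm Dom}_\psi$, where $R\ge0$. With the Bregman divergence $D_g(x,y)=g(x)-g(y)-\langle\nabla g(y),x-y\rangle$, let $L_{F/\phi}$ be the smallest and $\sigma_{F/\phi}$ the largest constant such that $\sigma_{F/\phi}D_\phi(x,y)\le D_F(x,y)\le L_{F/\phi}D_\phi(x,y)$ for all $x,y\in{\rm Dom}_\psi$, and let $\kappa_{F/\phi}=L_{F/\phi}/\sigma_{F/\phi}$. Finally let $0<\delta<1$, assume $d\ge2$ or $\delta\le\frac12$, and put $$m=\min(n,N),\qquad A=R\,\sigma_1^3\|\ell''\|_{\rm Lip}+\sigma_1^2\,\ell''(0).$$ *Claim.* There are universal constants $C,C'>0$ and $k\in\mathbb N$ such that, with $$\mu=C\,A\left(\frac{(d_{\rm eff}(3)\ln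 d+\ln(1/\delta))\sqrt{d_{\rm eff}(1)+\ln(m/\delta)}}{m}+\frac{\sqrt{\ln(1/\delta)}+\sqrt{d_{\rm eff}(1)\ln d}}{\sqrt m}\right),$$ the following two statements hold simultaneously with probability at least $1-\delta$: 1. $\displaystyle\sup_{\|x\|\le R}\big\|\nabla^2\tilde f(x)-\nabla^2F(x)\big\|_{\rm op}\le\mu$; 2. if ${\rm Dom}_\psi$ has at least two points, then, for $\phi$ built with this $\mu$, $$1\le\kappa_{F/\phi}\le1+C'\big(1+\ln d+\ln m+\ln(1/\delta)\big)^k\,\frac A\lambda\,\max\left(\sqrt{\frac{d_{\rm eff}(1)}m},\ \frac{\sqrt{d_{\rm eff}(1)}\,d_{\rm eff}(3)}m\right),$$ that is, $\kappa_{F/\phi}=1+\tilde O\Big(\frac A\lambda\max\big(\sqrt{d_{\rm eff}(1)/m},\,\sqrt{d_{\rm eff}(1)}\,d_{\rm eff}(3)/m\big)\Big)$ with logarithmic factors in $d,m,\delta^{-1}$ hidden. When $\ell''(0)=0$ and $N\ge n$, one has $m=n$ and $A=R\sigma_1^3\|\ell''\|_{\rm Lip}$. -/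

import Mathlib

open MeasureTheory ProbabilityTheory
open scoped NNReal Matrix

noncomputable section

namespace StatPrecond

/-- The Euclidean space `ℝ^d`. -/
abbrev Vec (d : ℕ) := EuclideanSpace ℝ (Fin d)

/-- A random vector `a` is `S`-subgaussian: for all `t > 0` and all `x` in the unit ball,
`P(|aᵀx| > t) ≤ 2 exp(- t² / (2 xᵀ S x))`. -/
def IsSubgaussianVec {Ω : Type*} [MeasurableSpace Ω] (P : Measure Ω) {d : ℕ}
    (S : Matrix (Fin d) (Fin d) ℝ) (a : Ω → Vec d) : Prop :=
  ∀ t : ℝ, 0 < t → ∀ x : Vec d, ‖x‖ ≤ 1 →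
    P.real {ω | t < |inner ℝ (a ω) x|} ≤
      2 * Real.exp (-(1 / 2) * (t ^ 2 / (x.ofLp ⬝ᵥ (S *ᵥ x.ofLp))))

/-- `σ₁`, the square root of the largest eigenvalue of `S`. -/
def sigmaOne {d : ℕ} {S : Matrix (Fin d) (Fin d) ℝ} (hS : S.IsHermitian) : ℝ :=
  √(⨆ i, hS.eigenvalues i)

/-- The effective dimension `d_eff(r) = ∑ i, (σ_i / σ₁) ^ (2 / r)`, where the `σ_i ^ 2` are the
eigenvalues of `S`, counted with multiplicity. -/
def effDim {d : ℕ} {S : Matrix (Fin d) (Fin d) ℝ} (hS : S.IsHermitian) (r : ℕ) : ℝ :=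
  ∑ i, (√(hS.eigenvalues i) / sigmaOne hS) ^ ((2 : ℝ) / r)

/-- The empirical risk structure: `ℓ` is convex and twice differentiable with `L`-Lipschitz second
derivative, the `ℓs j` are convex, twice differentiable, with the same second derivative as `ℓ`,
and the `a j` are i.i.d. `S`-subgaussian random vectors. -/
structure IsEmpiricalRiskModel {Ω : Type*} [MeasurableSpace Ω] (P : Measure Ω) {d n : ℕ}
    (S : Matrix (Fin d) (Fin d) ℝ) (ℓ : ℝ → ℝ) (L : ℝ≥0)
    (ℓs : Fin n → ℝ → ℝ) (a : Fin n → Ω → Vec d) : Prop where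
  convex_loss : ConvexOn ℝ Set.univ ℓ
  differentiable_loss : Differentiable ℝ ℓ
  differentiable_deriv_loss : Differentiable ℝ (deriv ℓ)
  lipschitz_deriv2_loss : LipschitzWith L (deriv (deriv ℓ))
  convex_losses : ∀ j, ConvexOn ℝ Set.univ (ℓs j)
  differentiable_losses : ∀ j, Differentiable ℝ (ℓs j)
  differentiable_deriv_losses : ∀ j, Differentiable ℝ (deriv (ℓs j))
  deriv2_losses : ∀ j t, deriv (deriv (ℓs j)) t = deriv (deriv ℓ) t
  measurable_sample : ∀ j, Measurable (a j)
  indep_sample : iIndepFun a P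
  identDistrib_sample : ∀ i j, IdentDistrib (a i) (a j) P P
  subgaussian_sample : ∀ j, IsSubgaussianVec P S (a j)

/-- The `lam`-regularized empirical risk of the data points `v j` with losses `ℓs j`:
`x ↦ (1/n) ∑ j, ℓs j (v jᵀ x) + (lam/2) ‖x‖²`. -/
def regRisk {d n : ℕ} (ℓs : Fin n → ℝ → ℝ) (v : Fin n → Vec d) (lam : ℝ) (x : Vec d) : ℝ :=
  (1 / (n : ℝ)) * ∑ j, ℓs j (inner ℝ (v j) x) + lam / 2 * ‖x‖ ^ 2

/-- The Hessian of `g` at `x`, as a linear operator: the derivative of the gradient. The norm on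
`Vec d →L[ℝ] Vec d` is the operator norm. -/
def hess {d : ℕ} (g : Vec d → ℝ) (x : Vec d) : Vec d →L[ℝ] Vec d :=
  fderiv ℝ (fun y => gradient g y) x

/-- The Bregman divergence `D_g(x, y) = g x - g y - ⟨∇g(y), x - y⟩`. -/
def bregman {d : ℕ} (g : Vec d → ℝ) (x y : Vec d) : ℝ :=
  g x - g y - inner ℝ (gradient g y) (x - y)

/-- `L_{F/φ}` on `D`: the least `M` such that `D_F ≤ M D_φ` on `D × D`. -/
def relSmoothConst {d : ℕ} (D : Set (Vec d)) (F φ : Vec d → ℝ) : ℝ :=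
  sInf {M : ℝ | ∀ x ∈ D, ∀ y ∈ D, bregman F x y ≤ M * bregman φ x y}

/-- `σ_{F/φ}` on `D`: the largest `s` such that `s D_φ ≤ D_F` on `D × D`. -/
def relStrongConvConst {d : ℕ} (D : Set (Vec d)) (F φ : Vec d → ℝ) : ℝ :=
  sSup {s : ℝ | ∀ x ∈ D, ∀ y ∈ D, s * bregman φ x y ≤ bregman F x y}

/-- The relative condition number `κ_{F/φ} = L_{F/φ} / σ_{F/φ}` on `D`. -/
def relCondNumber {d : ℕ} (D : Set (Vec d)) (F φ : Vec d → ℝ) : ℝ :=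
  relSmoothConst D F φ / relStrongConvConst D F φ

/-- The scale `R σ₁³ L + σ₁² c` of the Hessian deviation, where `L` is the Lipschitz constant of
`ℓ''` and `c = ℓ''(0)`. -/
def devScale (R s L c : ℝ) : ℝ := R * s ^ 3 * L + s ^ 2 * c

/-- The rate of the Hessian deviation in ambient dimension `d` with `m` samples at confidence
`1 - δ`, where `d₁ = d_eff(1)` and `d₃ = d_eff(3)`. -/
def devRate (d : ℕ) (d₁ d₃ m δ : ℝ) : ℝ :=
  (d₃ * Real.log d + Real.log (1 / δ)) * √(d₁ + Real.log (m / δ)) / m +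
    (√(Real.log (1 / δ)) + √(d₁ * Real.log d)) / √m

end StatPrecond

end

open MeasureTheory ProbabilityTheory
open scoped NNReal Matrix

namespace StatPrecond

/-! Both statements reduce to one uniform law of large numbers. With `g = ℓ''`, the Hessian form of
an empirical risk is the mean of `g (aᵀx) (aᵀu)²` plus the regularizer. If each sample mean is
within `μ / 2` of the common expectation, uniformly over `‖x‖ ≤ R` and `‖u‖ ≤ 1`, the triangle
inequality gives the Hessian bound. No independence between the two samples is needed, only a union
bound.

Rotating to the eigenbasis of `S` and dividing by `σ₁` gives a vector with diagonal proxy `s i = σ_i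
/ σ₁ ≤ 1`. Rescaling `x` by `R` and `g` by `A` leaves a 1-Lipschitz `G` with `|G 0| ≤ 1` and both
arguments in the unit ball. The form is cubic in `a`, so its tails are too heavy for Bernstein. It
is therefore truncated at `‖a‖ ≤ M` with `M² ~ d_eff(1) + ln(n/δ)`. With high probability no sample
point exceeds `M`, and the bias is `O(1/√n)` by a second moment bound. One factor of the cubic form
is then at most `M`, which gives increments between nearby parameters a Bernstein inequality with
variance of order `ρ²` and linear scale `M ρ`, where `ρ` is the distance in the ellipsoidal norm.

Chaining over dyadic nets in that norm (`exists_nets`, `abs_le_of_chain`) yields two sums over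
scales. The Gaussian part `∑ 2⁻ᵏ √H(2⁻ᵏ)` costs `√(d_eff(1) ln d)`. The linear part `∑ 2⁻ᵏ H(2⁻ᵏ)`
costs `d_eff(3)`, because `H(ε)` is at most a multiple of `∑ (s i / ε)^(2/3)` and an exponent below
1 makes the series geometric. This is `measure_exists_truncDev_gt_le`. Removing the truncation and
undoing the scaling gives `measure_exists_sample_dev_gt_le`.

On the good event `∇²F ≤ ∇²φ ≤ ∇²F + 2μ ≤ (1 + 2μ/λ) ∇²F` on the ball. Integrating along segments
transfers this to Bregman divergences (`bregman_regRisk_le`), so the condition number lies between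
`1` and `1 + 2μ/λ`. -/

/-! ### Exponential moments of subgaussian vectors. -/

/-- Layer-cake formula: levels below 1 contribute at most 1. At a level `t > 1` the tail at `2 √(log
t)` is at most `2 t⁻²`, which integrates to 2. -/
theorem lintegral_exp_sq_le_of_tail {α : Type*} [MeasurableSpace α] (ν : Measure α)
    [IsProbabilityMeasure ν] {f : α → ℝ} (hf : Measurable f)
    (h : ∀ t : ℝ, 0 < t → ν {a | t < |f a|} ≤ ENNReal.ofReal (2 * Real.exp (-(t ^ 2 / 2)))) :
    ∫⁻ a, ENNReal.ofReal (Real.exp (f a ^ 2 / 4)) ∂ν ≤ 3 := by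
  rw [lintegral_eq_lintegral_meas_lt ν (Filter.Eventually.of_forall fun a => (Real.exp_pos _).le)
    (by fun_prop)]
  rw [← Set.Ioc_union_Ioi_eq_Ioi (zero_le_one' ℝ),
    lintegral_union measurableSet_Ioi (Set.Ioc_disjoint_Ioi le_rfl)]
  have h1 : ∫⁻ t in Set.Ioc (0 : ℝ) 1, ν {a | t < Real.exp (f a ^ 2 / 4)} ≤ 1 := by
    calc _ ≤ ∫⁻ t in Set.Ioc (0 : ℝ) 1, 1 := lintegral_mono fun t => prob_le_one
      _ = 1 := by simp
  have h2 : ∫⁻ t in Set.Ioi (1 : ℝ), ν {a | t < Real.exp (f a ^ 2 / 4)} ≤ 2 := by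
    calc _ ≤ ∫⁻ t in Set.Ioi (1 : ℝ), ENNReal.ofReal (2 * t ^ (-2 : ℝ)) := by
          refine setLIntegral_mono (by fun_prop) fun t ht => ?_
          have ht1 : (1 : ℝ) < t := ht
          have hl : 0 < Real.log t := Real.log_pos ht1
          refine (measure_mono ?_).trans ((h (2 * √(Real.log t)) (by positivity)).trans ?_)
          · intro a ha
            have ha' : t < Real.exp (f a ^ 2 / 4) := ha
            have : Real.log t < f a ^ 2 / 4 := by
              rwa [Real.log_lt_iff_lt_exp (by linarith)]
            change 2 * √(Real.log t) < |f a|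
            apply lt_of_pow_lt_pow_left₀ 2 (abs_nonneg _)
            rw [mul_pow, Real.sq_sqrt hl.le, sq_abs]
            linarith
          · apply ENNReal.ofReal_le_ofReal
            rw [mul_pow, Real.sq_sqrt hl.le, Real.rpow_def_of_pos (by linarith)]
            apply le_of_eq
            congr 2
            ring
      _ = ENNReal.ofReal (∫ t in Set.Ioi (1 : ℝ), 2 * t ^ (-2 : ℝ)) := by
          rw [ofReal_integral_eq_lintegral_ofReal]
          · exact (integrableOn_Ioi_rpow_of_lt (by norm_num) one_pos).const_mul 2
          · refine (ae_restrict_iff' measurableSet_Ioi).2 (Filter.Eventually.of_forall ?_)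
            intro t ht
            have ht1 : (1 : ℝ) < t := ht
            have : (0 : ℝ) < t := by linarith
            change 0 ≤ 2 * t ^ (-2 : ℝ)
            positivity
      _ = 2 := by
          rw [integral_const_mul, integral_Ioi_rpow_of_lt (by norm_num) one_pos]
          norm_num
  calc _ ≤ (1 : ENNReal) + 2 := add_le_add h1 h2
    _ = 3 := by norm_num

/-- The quadratic form with eigenvalues `s i ^ 2` in the standard basis. -/
def quad {d : ℕ} (s : Fin d → ℝ) (w : Vec d) : ℝ := ∑ i, s i ^ 2 * w i ^ 2

/-- `ν` is subgaussian with covariance proxy `diag (s i ^ 2)`, in terms of exponential moments. -/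
def HasSubgaussianDiag {d : ℕ} (ν : Measure (Vec d)) (s : Fin d → ℝ) : Prop :=
  ∀ (w : Vec d) (q : ℝ), 0 < q → quad s w ≤ q ^ 2 →
    ∫⁻ a, ENNReal.ofReal (Real.exp ((inner ℝ a w / q) ^ 2 / 4)) ∂ν ≤ 3

/-- The exact value is `(1 - 2b)^(-1/2)`, and `(1 - 2b)⁻¹ ≤ 1 + 4b ≤ exp (4b)` holds for `b ≤ 1/4`.
-/
theorem integral_exp_mul_sq_gaussianReal {b : ℝ} (hb0 : 0 ≤ b) (hb : b ≤ 1 / 4) :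
    ∫⁻ x, ENNReal.ofReal (Real.exp (b * x ^ 2)) ∂(gaussianReal 0 1)
      ≤ ENNReal.ofReal (Real.exp (2 * b)) := by
  have hpos : 0 < 1 / 2 - b := by linarith
  rw [gaussianReal_of_var_ne_zero 0 one_ne_zero,
    lintegral_withDensity_eq_lintegral_mul _ (measurable_gaussianPDF 0 1) (by fun_prop)]
  have : ∀ x, (gaussianPDF 0 1 * fun x => ENNReal.ofReal (Real.exp (b * x ^ 2))) x
      = ENNReal.ofReal ((√(2 * Real.pi))⁻¹ * Real.exp (-(1 / 2 - b) * x ^ 2)) := by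
    intro x
    simp only [Pi.mul_apply, gaussianPDF, gaussianPDFReal]
    rw [← ENNReal.ofReal_mul (by positivity), mul_assoc, ← Real.exp_add]
    congr 3
    · simp
    · simp; ring
  simp_rw [this]
  rw [← ofReal_integral_eq_lintegral_ofReal]
  · apply ENNReal.ofReal_le_ofReal
    rw [integral_const_mul, integral_gaussian, ← Real.sqrt_inv, ← Real.sqrt_mul (by positivity)]
    refine (Real.sqrt_le_left (Real.exp_pos _).le).2 ?_
    rw [← Real.exp_nat_mul]
    have e1 : (2 * Real.pi)⁻¹ * (Real.pi / (1 / 2 - b)) = (1 - 2 * b)⁻¹ := by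
      have := Real.pi_ne_zero
      field_simp
    rw [e1]
    have h3 : 1 + 4 * b ≤ Real.exp (4 * b) := by linarith [Real.add_one_le_exp (4 * b)]
    have h4 : (1 - 2 * b)⁻¹ ≤ 1 + 4 * b := by
      rw [inv_le_iff_one_le_mul₀ (by linarith)]
      nlinarith
    refine h4.trans (h3.trans (le_of_eq ?_))
    congr 1
    push_cast
    ring
  · exact (integrable_exp_neg_mul_sq hpos).const_mul _
  · exact Filter.Eventually.of_forall fun x => by positivity

theorem lintegral_exp_mul_gaussianReal (c : ℝ) :
    ∫⁻ x, ENNReal.ofReal (Real.exp (c * x)) ∂(gaussianReal 0 1)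
      = ENNReal.ofReal (Real.exp (c ^ 2 / 2)) := by
  rw [← ofReal_integral_eq_lintegral_ofReal (integrable_exp_mul_gaussianReal c)
    (Filter.Eventually.of_forall fun x => (Real.exp_pos _).le)]
  have := congrFun (mgf_fun_id_gaussianReal (μ := 0) (v := 1)) c
  simp only [mgf] at this
  rw [this]
  simp

theorem lintegral_pi_gaussian_exp_sum {d : ℕ} (f : Fin d → ℝ → ℝ)
    (hf : ∀ i, Measurable (f i)) :
    ∫⁻ g, ENNReal.ofReal (Real.exp (∑ i, f i (g i))) ∂(Measure.pi fun _ : Fin d => gaussianReal 0 1)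
      = ∏ i, ∫⁻ x, ENNReal.ofReal (Real.exp (f i x)) ∂(gaussianReal 0 1) := by
  have h := iIndepFun_pi (Ω := fun _ : Fin d => ℝ) (μ := fun _ : Fin d => gaussianReal 0 1)
    (X := fun i x => ENNReal.ofReal (Real.exp (f i x))) (fun i => by fun_prop)
  have h2 := lintegral_prod_eq_prod_lintegral_of_indepFun Finset.univ _ h (fun i => by fun_prop)
  simp_rw [Real.exp_sum]
  calc _ = ∫⁻ g, ∏ i, ENNReal.ofReal (Real.exp (f i (g i)))
        ∂(Measure.pi fun _ : Fin d => gaussianReal 0 1) := by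
        congr 1
        ext g
        rw [ENNReal.ofReal_prod_of_nonneg fun i _ => (Real.exp_pos _).le]
    _ = _ := by
        rw [h2]
        refine Finset.prod_congr rfl fun i _ => ?_
        exact (measurePreserving_eval (fun _ : Fin d => gaussianReal 0 1) i).lintegral_comp
          (f := fun x => ENNReal.ofReal (Real.exp (f i x))) (by fun_prop)

theorem inner_eq_sum_mul {d : ℕ} (x y : Vec d) : inner ℝ x y = ∑ i, x i * y i := by
  simp [PiLp.inner_apply, mul_comm]

/-- Young's inequality `z q / 2 ≤ z² / 4 + q² / 4`, with `q² = quad s w` and `z` the normalized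
inner product, turns the square-exponential moment into a Laplace transform bound. -/
theorem HasSubgaussianDiag.lintegral_exp_half_inner_le {d : ℕ} {ν : Measure (Vec d)}
    [IsProbabilityMeasure ν] {s : Fin d → ℝ} (h : HasSubgaussianDiag ν s) (hs : ∀ i, 0 < s i)
    (w : Vec d) :
    ∫⁻ a, ENNReal.ofReal (Real.exp (1 / 2 * inner ℝ a w)) ∂ν
      ≤ 3 * ENNReal.ofReal (Real.exp (1 / 4 * quad s w)) := by
  by_cases hw : w = 0
  · subst hw
    simp only [inner_zero_right, mul_zero, Real.exp_zero, ENNReal.ofReal_one, lintegral_one,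
      measure_univ]
    have : (1 : ENNReal) ≤ ENNReal.ofReal (Real.exp (1 / 4 * quad s (0 : Vec d))) := by
      simp [quad]
    calc (1 : ENNReal) ≤ 3 * 1 := by norm_num
      _ ≤ _ := by gcongr
  · have hq : 0 < quad s w := by
      obtain ⟨i, hi⟩ : ∃ i, w i ≠ 0 := by
        by_contra! hc
        exact hw (by ext i; simpa using hc i)
      refine Finset.sum_pos' (fun i _ => by positivity) ⟨i, Finset.mem_univ _, ?_⟩
      have := hs i
      positivity
    set q := √(quad s w) with hqd
    have hqp : 0 < q := Real.sqrt_pos.2 hq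
    have hqq : q ^ 2 = quad s w := Real.sq_sqrt hq.le
    calc _ ≤ ∫⁻ a, ENNReal.ofReal (Real.exp ((inner ℝ a w / q) ^ 2 / 4))
          * ENNReal.ofReal (Real.exp (1 / 4 * quad s w)) ∂ν := by
          refine lintegral_mono fun a => ?_
          rw [← ENNReal.ofReal_mul (Real.exp_pos _).le, ← Real.exp_add]
          apply ENNReal.ofReal_le_ofReal
          apply Real.exp_le_exp.2
          rw [← hqq]
          set z := inner ℝ a w / q with hz
          have : inner ℝ a w = z * q := by rw [hz, div_mul_cancel₀ _ hqp.ne']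
          rw [this]
          nlinarith [sq_nonneg (z - q)]
      _ = (∫⁻ a, ENNReal.ofReal (Real.exp ((inner ℝ a w / q) ^ 2 / 4)) ∂ν)
          * ENNReal.ofReal (Real.exp (1 / 4 * quad s w)) :=
          lintegral_mul_const _ (by fun_prop)
      _ ≤ _ := by gcongr; exact h w q hqp hqq.ge

/-- Gaussian linearization: `exp (‖a‖² / 8)` is the average of `exp (⟨a, g⟩ / 2)` over a standard
Gaussian `g`. After exchanging the integrals, the Laplace bound for `a` leaves a Gaussian integral
of `exp (quad s g / 4)`, which factors over coordinates. -/
theorem HasSubgaussianDiag.lintegral_exp_norm_sq_le {d : ℕ} {ν : Measure (Vec d)}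
    [IsProbabilityMeasure ν] {s : Fin d → ℝ} (h : HasSubgaussianDiag ν s) (hs : ∀ i, 0 < s i)
    (hs1 : ∀ i, s i ≤ 1) :
    ∫⁻ a, ENNReal.ofReal (Real.exp (‖a‖ ^ 2 / 8)) ∂ν
      ≤ 3 * ENNReal.ofReal (Real.exp ((∑ i, s i ^ 2) / 2)) := by
  set γ : Measure (Fin d → ℝ) := Measure.pi fun _ : Fin d => gaussianReal 0 1
  have e1 : ∀ a : Vec d, ENNReal.ofReal (Real.exp (‖a‖ ^ 2 / 8))
      = ∫⁻ g, ENNReal.ofReal (Real.exp (1 / 2 * inner ℝ a (WithLp.toLp 2 g))) ∂γ := by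
    intro a
    have := lintegral_pi_gaussian_exp_sum (fun i x => (1 / 2 * a i) * x) (fun i => by fun_prop)
    simp_rw [inner_eq_sum_mul, Finset.mul_sum, ← mul_assoc]
    rw [this]
    simp_rw [lintegral_exp_mul_gaussianReal]
    rw [← ENNReal.ofReal_prod_of_nonneg fun i _ => (Real.exp_pos _).le, ← Real.exp_sum,
      EuclideanSpace.real_norm_sq_eq, Finset.sum_div]
    congr 2
    refine Finset.sum_congr rfl fun i _ => ?_
    ring
  simp_rw [e1]
  rw [lintegral_lintegral_swap (by fun_prop)]
  calc _ ≤ ∫⁻ g, 3 * ENNReal.ofReal (Real.exp (1 / 4 * quad s (WithLp.toLp 2 g))) ∂γ :=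
        lintegral_mono fun g => h.lintegral_exp_half_inner_le hs _
    _ = 3 * ∫⁻ g, ENNReal.ofReal (Real.exp (∑ i, (1 / 4 * s i ^ 2) * g i ^ 2)) ∂γ := by
        rw [lintegral_const_mul]
        · simp_rw [quad, Finset.mul_sum, ← mul_assoc]
        · unfold quad; fun_prop
    _ ≤ _ := by
        rw [lintegral_pi_gaussian_exp_sum (fun i x => (1 / 4 * s i ^ 2) * x ^ 2)
          (fun i => by fun_prop)]
        gcongr
        calc _ ≤ ∏ i, ENNReal.ofReal (Real.exp (2 * (1 / 4 * s i ^ 2))) := by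
              gcongr with i
              apply integral_exp_mul_sq_gaussianReal (by positivity)
              nlinarith [hs i, hs1 i]
          _ = _ := by
              rw [← ENNReal.ofReal_prod_of_nonneg fun i _ => (Real.exp_pos _).le, ← Real.exp_sum,
                Finset.sum_div]
              congr 2
              refine Finset.sum_congr rfl fun i _ => ?_
              ring

theorem HasSubgaussianDiag.measure_norm_sq_gt_le {d : ℕ} {ν : Measure (Vec d)}
    [IsProbabilityMeasure ν] {s : Fin d → ℝ} (h : HasSubgaussianDiag ν s) (hs : ∀ i, 0 < s i)
    (hs1 : ∀ i, s i ≤ 1) {η : ℝ} (hη : 0 < η) :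
    ν {a | 4 * ∑ i, s i ^ 2 + 8 * Real.log (3 / η) < ‖a‖ ^ 2} ≤ ENNReal.ofReal η := by
  set T := 4 * ∑ i, s i ^ 2 + 8 * Real.log (3 / η)
  have hT : Real.exp (T / 8) = Real.exp ((∑ i, s i ^ 2) / 2) * (3 / η) := by
    rw [← Real.exp_log (show 0 < 3 / η by positivity), ← Real.exp_add]
    congr 1
    simp only [T]
    ring
  have hm := mul_meas_ge_le_lintegral₀ (μ := ν)
    (f := fun a => ENNReal.ofReal (Real.exp (‖a‖ ^ 2 / 8))) (by fun_prop)
    (ENNReal.ofReal (Real.exp (T / 8)))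
  have hm2 := hm.trans (h.lintegral_exp_norm_sq_le hs hs1)
  have hle : ν {a | T < ‖a‖ ^ 2} ≤ ν {a | ENNReal.ofReal (Real.exp (T / 8))
      ≤ ENNReal.ofReal (Real.exp (‖a‖ ^ 2 / 8))} := by
    refine measure_mono fun a ha => ?_
    have ha' : T < ‖a‖ ^ 2 := ha
    exact ENNReal.ofReal_le_ofReal (Real.exp_le_exp.2 (by linarith))
  refine hle.trans ?_
  rw [hT, mul_comm (Real.exp _), ENNReal.ofReal_mul (by positivity)] at hm2
  set E := ENNReal.ofReal (Real.exp ((∑ i, s i ^ 2) / 2)) with hE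
  have hE0 : E ≠ 0 := by simp [hE, Real.exp_pos]
  have hEt : E ≠ ⊤ := ENNReal.ofReal_ne_top
  rw [hT, mul_comm (Real.exp _), ENNReal.ofReal_mul (by positivity)]
  set p := ν {a | ENNReal.ofReal (3 / η) * E ≤ ENNReal.ofReal (Real.exp (‖a‖ ^ 2 / 8))}
  have hm3 : ENNReal.ofReal (3 / η) * p ≤ 3 := by
    refine (ENNReal.mul_le_mul_iff_left hE0 hEt).1 ?_
    calc _ = ENNReal.ofReal (3 / η) * E * p := by ring
      _ ≤ _ := hm2
  calc p = ENNReal.ofReal (η / 3) * (ENNReal.ofReal (3 / η) * p) := by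
        rw [← mul_assoc, ← ENNReal.ofReal_mul (by positivity)]
        rw [show η / 3 * (3 / η) = 1 by field_simp]
        simp
    _ ≤ ENNReal.ofReal (η / 3) * 3 := by gcongr
    _ = ENNReal.ofReal η := by
        rw [show (3 : ENNReal) = ENNReal.ofReal 3 by simp, ← ENNReal.ofReal_mul (by positivity)]
        congr 1
        ring

/-! ### A Bernstein inequality from a weighted second moment. -/

theorem exp_le_one_add_add_sq_mul_exp_abs (y : ℝ) :
    Real.exp y ≤ 1 + y + y ^ 2 * Real.exp |y| := by
  have h := Complex.norm_exp_sub_sum_le_norm_mul_exp (y : ℂ) 2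
  simp only [Finset.sum_range_succ, Finset.sum_range_zero, pow_zero, Nat.factorial_zero,
    Nat.cast_one, div_one, zero_add, pow_one, Nat.factorial_one] at h
  rw [← Complex.ofReal_exp, ← Complex.ofReal_one, ← Complex.ofReal_add, ← Complex.ofReal_sub,
    Complex.norm_real, Complex.norm_real, Real.norm_eq_abs, Real.norm_eq_abs, sq_abs] at h
  linarith [le_abs_self (Real.exp y - (1 + y))]

theorem integrable_of_measurable_of_bound {α : Type*} [MeasurableSpace α] {ν : Measure α}
    [IsFiniteMeasure ν] {X : α → ℝ} (hX : Measurable X) {B : ℝ} (hB : ∀ a, |X a| ≤ B) :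
    Integrable X ν :=
  Integrable.of_bound hX.aestronglyMeasurable B (Filter.Eventually.of_forall hB)

/-- Expanding to second order, the linear term is absorbed by the centering through `1 + y ≤ exp y`.
The bound `B` only supplies integrability and does not enter the estimate. -/
theorem integral_exp_centered_le {α : Type*} [MeasurableSpace α] {ν : Measure α}
    [IsProbabilityMeasure ν] {X : α → ℝ} (hX : Measurable X) {B : ℝ} (hB : ∀ a, |X a| ≤ B)
    {l₀ K : ℝ} (hl₀ : 0 < l₀) (hK : ∫ a, X a ^ 2 * Real.exp (l₀ * |X a|) ∂ν ≤ K)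
    {l : ℝ} (hl : |l| ≤ l₀) :
    ∫ a, Real.exp (l * (X a - ∫ b, X b ∂ν)) ∂ν ≤ Real.exp (l ^ 2 * K) := by
  set e := ∫ b, X b ∂ν
  have hB0 : ∀ a, 0 ≤ B := fun a => (abs_nonneg _).trans (hB a)
  have i1 : Integrable (fun a => X a ^ 2 * Real.exp (l₀ * |X a|)) ν := by
    refine integrable_of_measurable_of_bound (by fun_prop) (B := B ^ 2 * Real.exp (l₀ * B))
      fun a => ?_
    rw [abs_mul, abs_of_pos (Real.exp_pos _), abs_pow]
    have := hB a
    have := hB0 a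
    gcongr
  have iX : Integrable X ν := integrable_of_measurable_of_bound hX hB
  have i2 : Integrable (fun a => Real.exp (l * X a)) ν := by
    refine integrable_of_measurable_of_bound (by fun_prop) (B := Real.exp (l₀ * B)) fun a => ?_
    rw [abs_of_pos (Real.exp_pos _)]
    apply Real.exp_le_exp.2
    calc l * X a ≤ |l| * |X a| := by rw [← abs_mul]; exact le_abs_self _
      _ ≤ l₀ * B := mul_le_mul hl (hB a) (abs_nonneg _) hl₀.le
  have iA : Integrable (fun a => 1 + l * X a) ν := (integrable_const _).add (iX.const_mul l)
  have h1 : ∫ a, Real.exp (l * X a) ∂ν ≤ 1 + l * e + l ^ 2 * K := by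
    calc _ ≤ ∫ a, (1 + l * X a + l ^ 2 * (X a ^ 2 * Real.exp (l₀ * |X a|))) ∂ν := by
          refine integral_mono i2
            (iA.add (i1.const_mul _)) fun a => ?_
          refine (exp_le_one_add_add_sq_mul_exp_abs _).trans ?_
          have : |l * X a| ≤ l₀ * |X a| := by rw [abs_mul]; gcongr
          have h3 := Real.exp_le_exp.2 this
          have h4 : 0 ≤ (l * X a) ^ 2 := sq_nonneg _
          have := mul_le_mul_of_nonneg_left h3 h4
          nlinarith
      _ = 1 + l * e + l ^ 2 * ∫ a, X a ^ 2 * Real.exp (l₀ * |X a|) ∂ν := by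
          rw [integral_add iA (i1.const_mul _),
            integral_add (integrable_const _) (iX.const_mul l), integral_const_mul,
            integral_const_mul]
          simp [e]
      _ ≤ _ := by gcongr
  calc _ = Real.exp (-(l * e)) * ∫ a, Real.exp (l * X a) ∂ν := by
        rw [← integral_const_mul]
        congr 1
        ext a
        rw [← Real.exp_add]
        congr 1
        ring
    _ ≤ Real.exp (-(l * e)) * Real.exp (l * e + l ^ 2 * K) := by
        gcongr
        linarith [Real.add_one_le_exp (l * e + l ^ 2 * K)]
    _ = _ := by
        rw [← Real.exp_add]
        congr 1
        ring

/-- Chernoff's method, with the moment generating function controlled for parameters up to `l₀`. The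
two terms of the threshold correspond to whether the Gaussian parameter is admissible. -/
theorem measure_mean_sub_integral_ge_le {Ω α : Type*} [MeasurableSpace Ω] [MeasurableSpace α]
    {P : Measure Ω} [IsProbabilityMeasure P] {ν : Measure α} [IsProbabilityMeasure ν]
    {n : ℕ} (hn : 1 ≤ n) {Y : Fin n → Ω → α} (hY : ∀ j, Measurable (Y j))
    (hind : iIndepFun Y P) (hlaw : ∀ j, P.map (Y j) = ν)
    {X : α → ℝ} (hX : Measurable X) {B : ℝ} (hB : ∀ a, |X a| ≤ B)
    {l₀ K τ : ℝ} (hl₀ : 0 < l₀) (hK0 : 0 < K)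
    (hK : ∫ a, X a ^ 2 * Real.exp (l₀ * |X a|) ∂ν ≤ K) (hτ : 0 ≤ τ) :
    P {ω | 2 * √(K * τ / n) + 2 * τ / (l₀ * n) ≤ 1 / (n : ℝ) * ∑ j, X (Y j ω) - ∫ a, X a ∂ν}
      ≤ ENNReal.ofReal (Real.exp (-τ)) := by
  have hn0 : (0 : ℝ) < n := by exact_mod_cast hn
  set e := ∫ b, X b ∂ν
  set t := 2 * √(K * τ / n) + 2 * τ / (l₀ * n) with ht
  set Z : Fin n → Ω → ℝ := fun j ω => X (Y j ω) - e with hZ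
  have hZm : ∀ j, Measurable (Z j) := fun j => (hX.comp (hY j)).sub_const _
  have hZi : iIndepFun Z P := hind.comp (fun _ a => X a - e) fun _ => hX.sub_const _
  have hset : {ω | t ≤ 1 / (n : ℝ) * ∑ j, X (Y j ω) - e} = {ω | n * t ≤ (∑ j, Z j) ω} := by
    ext ω
    simp only [Set.mem_ofPred_eq, Finset.sum_apply, hZ, Finset.sum_sub_distrib, Finset.sum_const,
      Finset.card_univ, Fintype.card_fin, nsmul_eq_mul]
    rw [show 1 / (n : ℝ) * ∑ j, X (Y j ω) - e = (∑ j, X (Y j ω) - n * e) / n by field_simp,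
      le_div_iff₀ hn0, mul_comm]
  -- The parameter for which `n r² K = τ`. It is used if `r ≤ l₀`; otherwise the parameter is `l₀`,
  -- and the linear term of `t` alone already gives `2τ`.
  set r := √(τ / (n * K)) with hr
  have hr0 : 0 ≤ r := Real.sqrt_nonneg _
  have hr2 : n * r ^ 2 * K = τ := by
    rw [hr, Real.sq_sqrt (by positivity)]
    field_simp
  have hKr : √(K * τ / n) = K * r := by
    rw [Real.sqrt_eq_iff_mul_self_eq (by positivity) (by positivity), ← hr2]
    field_simp
  have key : ∀ l : ℝ, 0 ≤ l → l ≤ l₀ → P.real {ω | n * t ≤ (∑ j, Z j) ω}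
      ≤ Real.exp (n * (l ^ 2 * K) - l * (n * t)) := by
    intro l hl hll
    have hint : Integrable (fun ω => Real.exp (l * (∑ j, Z j) ω)) P := by
      refine integrable_of_measurable_of_bound (B := Real.exp (l * ∑ j : Fin n, (B + |e|))) ?_
        fun ω => ?_
      · simp only [Finset.sum_apply]
        fun_prop
      · rw [abs_of_pos (Real.exp_pos _)]
        apply Real.exp_le_exp.2
        apply mul_le_mul_of_nonneg_left _ hl
        rw [Finset.sum_apply]
        refine Finset.sum_le_sum fun j _ => ?_
        have h1 := hB (Y j ω)
        have h2 := neg_abs_le e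
        have h3 := le_abs_self (X (Y j ω))
        simp only [hZ]
        linarith
    refine (measure_ge_le_exp_mul_mgf (n * t) hl hint).trans ?_
    rw [iIndepFun.mgf_sum hZi hZm]
    have hm : ∀ j, mgf (Z j) P l ≤ Real.exp (l ^ 2 * K) := by
      intro j
      have h1 := integral_exp_centered_le hX hB hl₀ hK (l := l) (by rwa [abs_of_nonneg hl])
      refine le_of_eq_of_le ?_ h1
      rw [mgf, ← hlaw j, integral_map (hY j).aemeasurable]
      · rw [hlaw j]
      · exact Measurable.aestronglyMeasurable (by fun_prop)
    calc _ ≤ Real.exp (-l * (n * t)) * ∏ _j : Fin n, Real.exp (l ^ 2 * K) := by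
          gcongr with j
          · exact fun i _ => mgf_nonneg
          · exact hm j
      _ = _ := by
          rw [Finset.prod_const, Finset.card_univ, Fintype.card_fin, ← Real.exp_nat_mul,
            ← Real.exp_add]
          congr 1
          ring
  rw [hset, ← ofReal_measureReal]
  apply ENNReal.ofReal_le_ofReal
  have ht2 : n * t = 2 * (n * (K * r)) + 2 * τ / l₀ := by
    rw [ht, hKr]; field_simp
  rcases le_total r l₀ with h | h
  · refine (key r hr0 h).trans (Real.exp_le_exp.2 ?_)
    have : 0 ≤ r * (2 * τ / l₀) := by positivity
    rw [ht2]
    nlinarith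
  · refine (key l₀ hl₀.le le_rfl).trans (Real.exp_le_exp.2 ?_)
    rw [ht2, mul_add, show l₀ * (2 * τ / l₀) = 2 * τ by field_simp]
    have h1 : n * (l₀ ^ 2 * K) ≤ τ := by
      rw [← hr2]
      have : l₀ ^ 2 ≤ r ^ 2 := by gcongr
      have := mul_le_mul_of_nonneg_right this (by positivity : 0 ≤ (n : ℝ) * K)
      nlinarith
    have : 0 ≤ l₀ * (2 * (n * (K * r))) := by positivity
    linarith

theorem measure_abs_mean_sub_integral_ge_le {Ω α : Type*} [MeasurableSpace Ω] [MeasurableSpace α]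
    {P : Measure Ω} [IsProbabilityMeasure P] {ν : Measure α} [IsProbabilityMeasure ν]
    {n : ℕ} (hn : 1 ≤ n) {Y : Fin n → Ω → α} (hY : ∀ j, Measurable (Y j))
    (hind : iIndepFun Y P) (hlaw : ∀ j, P.map (Y j) = ν)
    {X : α → ℝ} (hX : Measurable X) {B : ℝ} (hB : ∀ a, |X a| ≤ B)
    {l₀ K τ : ℝ} (hl₀ : 0 < l₀) (hK0 : 0 < K)
    (hK : ∫ a, X a ^ 2 * Real.exp (l₀ * |X a|) ∂ν ≤ K) (hτ : 0 ≤ τ) :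
    P {ω | 2 * √(K * τ / n) + 2 * τ / (l₀ * n) < |1 / (n : ℝ) * ∑ j, X (Y j ω) - ∫ a, X a ∂ν|}
      ≤ ENNReal.ofReal (2 * Real.exp (-τ)) := by
  have h1 := measure_mean_sub_integral_ge_le hn hY hind hlaw hX hB hl₀ hK0 hK hτ
  have h2 := measure_mean_sub_integral_ge_le hn hY hind hlaw (X := fun a => -X a) hX.neg (B := B)
    (fun a => by simpa using hB a) hl₀ hK0 (by simpa using hK) hτ
  rw [two_mul (Real.exp (-τ)), ENNReal.ofReal_add (Real.exp_pos _).le (Real.exp_pos _).le]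
  refine (measure_mono fun ω hω => ?_).trans ((measure_union_le _ _).trans (add_le_add h1 h2))
  simp only [Set.mem_ofPred_eq, Set.mem_union, Finset.sum_neg_distrib, integral_neg] at hω ⊢
  rcases lt_abs.1 hω with h | h
  · exact Or.inl h.le
  · right; linarith

/-! ### Nets of ellipsoids. -/

/-- Rounding toward zero never increases a coordinate in absolute value, so net points stay in the
unit ball. -/
theorem exists_int_abs_le_abs_sub_le_one (y : ℝ) : ∃ z : ℤ, |(z : ℝ)| ≤ |y| ∧ |y - z| ≤ 1 := by
  rcases le_total 0 y with hy | hy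
  · have h0 : (0 : ℝ) ≤ ⌊y⌋ := by exact_mod_cast Int.floor_nonneg.2 hy
    have h1 := Int.floor_le y
    have h2 := Int.lt_floor_add_one y
    refine ⟨⌊y⌋, ?_, ?_⟩
    · rwa [abs_of_nonneg h0, abs_of_nonneg hy]
    · rw [abs_le]; constructor <;> linarith
  · have h0 : ((⌈y⌉ : ℤ) : ℝ) ≤ 0 := by exact_mod_cast Int.ceil_nonpos.2 hy
    have h1 := Int.le_ceil y
    have h2 := Int.ceil_lt_add_one y
    refine ⟨⌈y⌉, ?_, ?_⟩
    · rw [abs_of_nonpos h0, abs_of_nonpos hy]; linarith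
    · rw [abs_le]; constructor <;> linarith

theorem sum_Icc_exp_neg_abs_div_le {r : ℝ} (hr : 0 < r) (B : ℕ) :
    ∑ z ∈ Finset.Icc (-(B : ℤ)) B, Real.exp (-(|(z : ℝ)| / r)) ≤ 1 + 2 * r := by
  -- The strengthened bound makes the induction telescope: the two new terms are at most `2r` times
  -- the drop of the exponential.
  suffices h : ∑ z ∈ Finset.Icc (-(B : ℤ)) B, Real.exp (-(|(z : ℝ)| / r))
      ≤ 1 + 2 * r * (1 - Real.exp (-(B / r))) by
    have := Real.exp_pos (-(B / r))
    nlinarith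
  induction B with
  | zero => simp
  | succ B ih =>
    have e : Finset.Icc (-((B + 1 : ℕ) : ℤ)) ((B + 1 : ℕ) : ℤ)
        = insert (-((B : ℤ) + 1)) (insert ((B : ℤ) + 1) (Finset.Icc (-(B : ℤ)) B)) := by
      ext z
      simp only [Finset.mem_Icc, Finset.mem_insert]
      omega
    rw [e, Finset.sum_insert, Finset.sum_insert]
    · have ha : |(((B : ℤ) + 1 : ℤ) : ℝ)| = B + 1 := by
        push_cast; exact abs_of_nonneg (by positivity)
      have hb : |((-((B : ℤ) + 1) : ℤ) : ℝ)| = B + 1 := by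
        push_cast; rw [abs_neg]; exact abs_of_nonneg (by positivity)
      rw [ha, hb]
      have h1 : Real.exp (-(B / r)) = Real.exp (-(((B + 1 : ℕ) : ℝ) / r)) * Real.exp (1 / r) := by
        rw [← Real.exp_add]; congr 1; push_cast; field_simp; ring
      have h2 := Real.add_one_le_exp (1 / r)
      have h3 := Real.exp_pos (-(((B + 1 : ℕ) : ℝ) / r))
      rw [h1] at ih
      push_cast at *
      set E := Real.exp (-(((B : ℝ) + 1) / r))
      have h4 : 1 ≤ r * (Real.exp (1 / r) - 1) := by
        calc (1 : ℝ) = r * (1 / r) := by field_simp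
          _ ≤ _ := by gcongr; linarith
      nlinarith
    · simp
    · simp only [Finset.mem_insert, Finset.mem_Icc]
      omega

/-- A bound on the logarithm of the size of an `ε`-net of the ellipsoid with semi-axes `s i`. -/
noncomputable def entropy {d : ℕ} (s : Fin d → ℝ) (ε : ℝ) : ℝ :=
  ∑ i, if ε < s i then 1 + Real.log (1 + 2 * (s i / ε)) else 0

/-- Only the `D` coordinates with `s i > ε` are discretized, on a grid of spacing `ε / (s i √D)`;
each contributes at most `ε² / D` to the squared error. The others are set to 0 and together cost at
most `ε²`. The grid points needed satisfy an `ℓ¹` constraint and are counted by exponential weights.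
-/
theorem exists_net {d : ℕ} {s : Fin d → ℝ} (hs : ∀ i, 0 < s i) {ε : ℝ} (hε : 0 < ε) :
    ∃ N : Finset (Vec d), (N.card : ℝ) ≤ Real.exp (entropy s ε) ∧ (∀ y ∈ N, ‖y‖ ≤ 1) ∧
      ∀ x : Vec d, ‖x‖ ≤ 1 → ∃ y ∈ N, quad s (x - y) ≤ 2 * ε ^ 2 := by
  classical
  set A : Finset (Fin d) := Finset.univ.filter fun i => ε < s i with hA
  set r : Fin d → ℝ := fun i => s i / ε with hr
  have hr0 : ∀ i, 0 < r i := fun i => div_pos (hs i) hε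
  set D : ℝ := (A.card : ℝ) with hD
  have hD0 : 0 ≤ D := by positivity
  set h : Fin d → ℝ := fun i => ε / (s i * √D) with hh
  -- A box large enough to contain every point satisfying the constraint. It only makes the index
  -- set finite, and its size does not enter the count.
  set B : ℕ := ⌈∑ i, r i * D⌉₊ with hB
  set T : Finset (Fin d → ℤ) :=
    Fintype.piFinset fun i => if i ∈ A then Finset.Icc (-(B : ℤ)) B else {0} with hT
  set Z : Finset (Fin d → ℤ) := T.filter fun z => ∑ i, |(z i : ℝ)| / r i ≤ D with hZ
  set pt : (Fin d → ℤ) → Vec d := fun z => WithLp.toLp 2 fun i => h i * z i with hpt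
  have hcard : (Z.card : ℝ) ≤ Real.exp (entropy s ε) := by
    calc (Z.card : ℝ) = ∑ z ∈ Z, (1 : ℝ) := by simp
      -- On `Z` this weight is at least 1. It is a product, so its sum over the whole box factors
      -- into one-dimensional sums bounded by `1 + 2 r i`.
      _ ≤ ∑ z ∈ Z, Real.exp D * ∏ i, Real.exp (-(|(z i : ℝ)| / r i)) := by
          refine Finset.sum_le_sum fun z hz => ?_
          rw [← Real.exp_sum, ← Real.exp_add]
          apply Real.one_le_exp
          have := (Finset.mem_filter.1 hz).2
          rw [Finset.sum_neg_distrib]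
          linarith
      _ ≤ ∑ z ∈ T, Real.exp D * ∏ i, Real.exp (-(|(z i : ℝ)| / r i)) :=
          Finset.sum_le_sum_of_subset_of_nonneg (Finset.filter_subset _ _)
            fun z _ _ => mul_nonneg (Real.exp_pos _).le
              (Finset.prod_nonneg fun i _ => (Real.exp_pos _).le)
      _ = Real.exp D * ∏ i, ∑ t ∈ (if i ∈ A then Finset.Icc (-(B : ℤ)) B else {0}),
            Real.exp (-(|(t : ℝ)| / r i)) := by
          rw [← Finset.mul_sum, Finset.prod_univ_sum]
      _ ≤ Real.exp D * ∏ i, Real.exp (if ε < s i then Real.log (1 + 2 * (s i / ε)) else 0) := by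
          gcongr with i
          by_cases hi : ε < s i
          · have hiA : i ∈ A := by simp [hA, hi]
            have := hr0 i
            rw [if_pos hi, if_pos hiA, Real.exp_log (by positivity)]
            exact sum_Icc_exp_neg_abs_div_le (hr0 i) B
          · have hiA : i ∉ A := by simp [hA, hi]
            rw [if_neg hi, if_neg hiA]
            simp
      _ = _ := by
          rw [← Real.exp_sum, ← Real.exp_add, entropy]
          congr 1
          have : D = ∑ i, if ε < s i then (1 : ℝ) else 0 := by
            rw [hD, hA, Finset.card_filter]; push_cast; rfl
          rw [this, ← Finset.sum_add_distrib]
          refine Finset.sum_congr rfl fun i _ => ?_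
          split_ifs <;> simp
  refine ⟨(Z.image pt).filter fun y => ‖y‖ ≤ 1, ?_, fun y hy => (Finset.mem_filter.1 hy).2, ?_⟩
  · refine le_trans ?_ hcard
    exact_mod_cast (Finset.card_filter_le _ _).trans Finset.card_image_le
  · intro x hx
    choose f hf1 hf2 using exists_int_abs_le_abs_sub_le_one
    set z : Fin d → ℤ := fun i => if i ∈ A then f (x i / h i) else 0 with hz
    have hxsq : ∑ i, x i ^ 2 ≤ 1 := by
      rw [← EuclideanSpace.real_norm_sq_eq]
      exact pow_le_one₀ (norm_nonneg _) hx
    have hDpos : ∀ i ∈ A, 0 < √D := fun i hi => by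
      apply Real.sqrt_pos.2
      rw [hD]
      exact_mod_cast Finset.card_pos.2 ⟨i, hi⟩
    have hhpos : ∀ i ∈ A, 0 < h i := fun i hi =>
      div_pos hε (mul_pos (hs i) (hDpos i hi))
    have hzle : ∀ i, |(z i : ℝ)| / r i ≤ if i ∈ A then √D * |x i| else 0 := by
      intro i
      by_cases hi : i ∈ A
      · simp only [hz, if_pos hi]
        rw [div_le_iff₀ (hr0 i)]
        refine (hf1 _).trans (le_of_eq ?_)
        rw [abs_div, abs_of_pos (hhpos i hi), hh, hr]
        have := (hs i).ne'
        have := (hDpos i hi).ne'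
        field_simp
      · simp [hz, hi]
    -- Cauchy–Schwarz over the `D` active coordinates of a unit-ball point. The spacing was chosen
    -- so that the left side is at most `√D ∑ |x i|` over them.
    have hsum : ∑ i, |(z i : ℝ)| / r i ≤ D := by
      calc _ ≤ ∑ i, if i ∈ A then √D * |x i| else 0 := Finset.sum_le_sum fun i _ => hzle i
        _ = √D * ∑ i ∈ A, |x i| := by rw [Finset.mul_sum, Finset.sum_ite_mem, Finset.univ_inter]
        _ ≤ √D * √D := by
            gcongr
            apply Real.le_sqrt_of_sq_le
            calc _ ≤ (A.card : ℝ) * ∑ i ∈ A, |x i| ^ 2 := sq_sum_le_card_mul_sum_sq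
              _ ≤ D * 1 := by
                  gcongr
                  refine le_trans ?_ hxsq
                  simp_rw [sq_abs]
                  exact Finset.sum_le_sum_of_subset_of_nonneg (Finset.subset_univ _)
                    fun i _ _ => sq_nonneg _
              _ = D := mul_one D
        _ = D := Real.mul_self_sqrt hD0
    have hzT : z ∈ T := by
      rw [hT, Fintype.mem_piFinset]
      intro i
      by_cases hi : i ∈ A
      · rw [if_pos hi, Finset.mem_Icc]
        have h1 : |(z i : ℝ)| / r i ≤ D :=
          (Finset.single_le_sum (f := fun i => |(z i : ℝ)| / r i)
            (fun j _ => div_nonneg (abs_nonneg _) (hr0 j).le) (Finset.mem_univ i)).trans hsum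
        rw [div_le_iff₀ (hr0 i)] at h1
        have h2 : r i * D ≤ ∑ i, r i * D :=
          Finset.single_le_sum (f := fun i => r i * D)
            (fun j _ => mul_nonneg (hr0 j).le hD0) (Finset.mem_univ i)
        have h3 : |(z i : ℝ)| ≤ B := by
          linarith [Nat.le_ceil (∑ i, r i * D)]
        have h4 : |z i| ≤ (B : ℤ) := by exact_mod_cast h3
        exact abs_le.1 h4
      · simp [hz, hi]
    have hy : ∀ i, pt z i = h i * z i := fun i => rfl
    have hyA : ∀ i ∈ A, |pt z i| ≤ |x i| ∧ |x i - pt z i| ≤ h i := by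
      intro i hi
      have hp := hhpos i hi
      have h1 := hf1 (x i / h i)
      have h2 := hf2 (x i / h i)
      rw [abs_div, abs_of_pos hp, le_div_iff₀ hp] at h1
      rw [hy]
      simp only [hz, if_pos hi]
      constructor
      · rw [abs_mul, abs_of_pos hp]; linarith
      · rw [show x i - h i * (f (x i / h i)) = h i * (x i / h i - f (x i / h i)) by
          field_simp, abs_mul, abs_of_pos hp]
        nlinarith
    have hyN : ∀ i, i ∉ A → pt z i = 0 := fun i hi => by rw [hy]; simp [hz, hi]
    refine ⟨pt z, Finset.mem_filter.2 ⟨Finset.mem_image.2 ⟨z, Finset.mem_filter.2 ⟨hzT, hsum⟩, rfl⟩,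
      ?_⟩, ?_⟩
    · refine le_trans ?_ hx
      refine (sq_le_sq₀ (norm_nonneg _) (norm_nonneg x)).1 ?_
      rw [EuclideanSpace.real_norm_sq_eq, EuclideanSpace.real_norm_sq_eq]
      refine Finset.sum_le_sum fun i _ => ?_
      by_cases hi : i ∈ A
      · exact sq_le_sq.2 (hyA i hi).1
      · rw [hyN i hi]; simpa using sq_nonneg (x i)
    · calc quad s (x - pt z) ≤ ∑ i, ((if i ∈ A then ε ^ 2 / D else 0) + ε ^ 2 * x i ^ 2) := by
            refine Finset.sum_le_sum fun i _ => ?_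
            by_cases hi : i ∈ A
            · rw [if_pos hi]
              have h1 := (hyA i hi).2
              have h2 : (x i - pt z i) ^ 2 ≤ h i ^ 2 := sq_le_sq' (abs_le.1 h1).1 (abs_le.1 h1).2
              have h3 : s i ^ 2 * h i ^ 2 = ε ^ 2 / D := by
                have := (hs i).ne'
                rw [hh]
                simp only [div_pow, mul_pow, Real.sq_sqrt hD0]
                field_simp
              have h4 := mul_le_mul_of_nonneg_left h2 (sq_nonneg (s i))
              have h5 : 0 ≤ ε ^ 2 * x i ^ 2 := by positivity
              simp only [PiLp.sub_apply]
              linarith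
            · rw [if_neg hi]
              simp only [PiLp.sub_apply, hyN i hi, sub_zero, zero_add]
              have : s i ≤ ε := by
                by_contra hc
                exact hi (by simp [hA]; linarith)
              have := (hs i).le
              gcongr
        _ ≤ ε ^ 2 + ε ^ 2 * 1 := by
            rw [Finset.sum_add_distrib, ← Finset.mul_sum]
            gcongr
            rw [Finset.sum_ite_mem, Finset.univ_inter, Finset.sum_const, nsmul_eq_mul]
            change D * (ε ^ 2 / D) ≤ ε ^ 2
            rcases hD0.eq_or_lt with h0 | h0
            · rw [← h0]; simp; positivity
            · rw [mul_div_cancel₀ _ h0.ne']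
        _ = _ := by ring

/-! ### Entropy sums over dyadic scales, and the dyadic nets. -/

theorem entropy_nonneg {d : ℕ} {s : Fin d → ℝ} {ε : ℝ} (hε : 0 < ε) : 0 ≤ entropy s ε := by
  refine Finset.sum_nonneg fun i _ => ?_
  split_ifs with h
  · have : 0 < s i / ε := div_pos (hε.trans h) hε
    have := Real.log_nonneg (show (1 : ℝ) ≤ 1 + 2 * (s i / ε) by linarith)
    linarith
  · exact le_rfl

theorem entropy_le_linear {d : ℕ} (s : Fin d → ℝ) {ε : ℝ} (hε : 0 < ε) :
    entropy s ε ≤ 3 * ∑ i, if ε < s i then s i / ε else 0 := by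
  rw [entropy, Finset.mul_sum]
  refine Finset.sum_le_sum fun i _ => ?_
  split_ifs with h
  · have h1 : 1 < s i / ε := (one_lt_div hε).2 h
    have := Real.log_le_sub_one_of_pos (show (0 : ℝ) < 1 + 2 * (s i / ε) by linarith)
    linarith
  · simp

theorem one_add_log_le_rpow {r : ℝ} (hr : 1 ≤ r) :
    1 + Real.log (1 + 2 * r) ≤ 3 * r ^ (2 / 3 : ℝ) := by
  set y := r ^ (1 / 3 : ℝ) with hy
  have hr0 : 0 ≤ r := by linarith
  have hy1 : 1 ≤ y := Real.one_le_rpow hr (by norm_num)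
  have hy2 : y ^ 2 = r ^ (2 / 3 : ℝ) := by
    rw [hy, ← Real.rpow_natCast, ← Real.rpow_mul hr0]; norm_num
  have hy3 : y ^ 3 = r := by
    rw [hy, ← Real.rpow_natCast, ← Real.rpow_mul hr0]; norm_num
  rw [← hy2]
  have h1 : Real.log (1 + 2 * r) ≤ Real.log (3 * y ^ 3) :=
    Real.log_le_log (by linarith) (by linarith)
  rw [Real.log_mul (by norm_num) (by positivity), Real.log_pow] at h1
  have h2 := Real.log_le_sub_one_of_pos (show (0 : ℝ) < y by linarith)
  have h3 := Real.log_le_sub_one_of_pos (show (0 : ℝ) < 3 by norm_num)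
  push_cast at h1
  nlinarith

theorem entropy_le_rpow {d : ℕ} {s : Fin d → ℝ} (hs : ∀ i, 0 < s i) {ε : ℝ} (hε : 0 < ε) :
    entropy s ε ≤ 3 * ∑ i, (s i / ε) ^ (2 / 3 : ℝ) := by
  rw [entropy, Finset.mul_sum]
  refine Finset.sum_le_sum fun i _ => ?_
  split_ifs with h
  · exact one_add_log_le_rpow ((one_lt_div hε).2 h).le
  · have := hs i
    positivity

/-- Splitting off `k = 0` rescales `s` to `2 s`. The second bound `2` is carried along because the
induction needs it when `s > 1`. -/
theorem sum_half_pow_lt_le (T : ℕ) (s : ℝ) (hs : 0 < s) :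
    ∑ k ∈ Finset.range T, (if (1 / 2 : ℝ) ^ k < s then (1 / 2 : ℝ) ^ k else 0) ≤ min (2 * s) 2 := by
  induction T generalizing s with
  | zero => simp; positivity
  | succ T ih =>
    rw [Finset.sum_range_succ']
    have h := ih (2 * s) (by positivity)
    have e : ∑ k ∈ Finset.range T,
        (if (1 / 2 : ℝ) ^ (k + 1) < s then (1 / 2 : ℝ) ^ (k + 1) else 0)
        = 1 / 2 * ∑ k ∈ Finset.range T,
          (if (1 / 2 : ℝ) ^ k < 2 * s then (1 / 2 : ℝ) ^ k else 0) := by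
      rw [Finset.mul_sum]
      refine Finset.sum_congr rfl fun k _ => ?_
      have : (1 / 2 : ℝ) ^ (k + 1) < s ↔ (1 / 2 : ℝ) ^ k < 2 * s := by
        rw [pow_succ]; constructor <;> intro h <;> linarith
      simp only [this]
      split_ifs
      · rw [pow_succ]; ring
      · simp
    rw [e]
    have h1 := h.trans (min_le_left _ _)
    have h2 := h.trans (min_le_right _ _)
    simp only [pow_zero]
    split_ifs with hc <;> apply le_min <;> linarith

/-- The source of `d_eff(3)`: with `H(ε)` bounded through `(s i / ε)^(2/3)`, the terms decay like
`2^(-k/3)`, and `2^(-1/3) ≤ 4/5`. -/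
theorem sum_half_pow_mul_entropy_le {d : ℕ} {s : Fin d → ℝ} (hs : ∀ i, 0 < s i) (T : ℕ) :
    ∑ k ∈ Finset.range T, (1 / 2 : ℝ) ^ k * entropy s ((1 / 2 : ℝ) ^ (k + 1))
      ≤ 30 * ∑ i, s i ^ (2 / 3 : ℝ) := by
  set c : ℝ := 2 ^ (2 / 3 : ℝ) with hc
  have hc0 : 0 < c := by positivity
  have hc3 : c ^ 3 = 4 := by
    rw [hc, ← Real.rpow_natCast, ← Real.rpow_mul (by norm_num)]; norm_num
  have hc1 : c ≤ 8 / 5 := by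
    refine (pow_le_pow_iff_left₀ hc0.le (by norm_num) (n := 3) (by norm_num)).1 ?_
    rw [hc3]; norm_num
  have hterm : ∀ k : ℕ, (1 / 2 : ℝ) ^ k * entropy s ((1 / 2 : ℝ) ^ (k + 1))
      ≤ (6 * ∑ i, s i ^ (2 / 3 : ℝ)) * (4 / 5) ^ k := by
    intro k
    have h := entropy_le_rpow hs (show (0 : ℝ) < (1 / 2) ^ (k + 1) by positivity)
    have e : ∀ i, (s i / (1 / 2 : ℝ) ^ (k + 1)) ^ (2 / 3 : ℝ) = s i ^ (2 / 3 : ℝ) * c ^ (k + 1) := by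
      intro i
      have : s i / (1 / 2 : ℝ) ^ (k + 1) = s i * 2 ^ (k + 1) := by
        rw [one_div, inv_pow, div_inv_eq_mul]
      rw [this, Real.mul_rpow (hs i).le (by positivity), hc, ← Real.rpow_natCast,
        ← Real.rpow_natCast, ← Real.rpow_mul (by norm_num), ← Real.rpow_mul (by norm_num),
        mul_comm ((k + 1 : ℕ) : ℝ)]
    simp_rw [e, ← Finset.sum_mul] at h
    have hS : 0 ≤ ∑ i, s i ^ (2 / 3 : ℝ) := Finset.sum_nonneg fun i _ =>
      Real.rpow_nonneg (hs i).le _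
    calc _ ≤ (1 / 2 : ℝ) ^ k * (3 * ((∑ i, s i ^ (2 / 3 : ℝ)) * c ^ (k + 1))) := by gcongr
      _ = (3 * ∑ i, s i ^ (2 / 3 : ℝ)) * (c * (c / 2) ^ k) := by
          rw [div_pow, div_pow, pow_succ]; field_simp; simp
      _ ≤ (3 * ∑ i, s i ^ (2 / 3 : ℝ)) * (2 * (4 / 5) ^ k) := by
          have h5 : (c / 2) ^ k ≤ (4 / 5) ^ k := pow_le_pow_left₀ (by positivity) (by linarith) k
          have h6 : c ≤ 2 := by linarith
          gcongr
      _ = _ := by ring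
  have hS : 0 ≤ ∑ i, s i ^ (2 / 3 : ℝ) := Finset.sum_nonneg fun i _ =>
      Real.rpow_nonneg (hs i).le _
  calc _ ≤ ∑ k ∈ Finset.range T, (6 * ∑ i, s i ^ (2 / 3 : ℝ)) * (4 / 5) ^ k :=
        Finset.sum_le_sum fun k _ => hterm k
    _ = (6 * ∑ i, s i ^ (2 / 3 : ℝ)) * ∑ k ∈ Finset.range T, (4 / 5 : ℝ) ^ k :=
        (Finset.mul_sum _ _ _).symm
    _ ≤ (6 * ∑ i, s i ^ (2 / 3 : ℝ)) * 5 := by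
        gcongr
        rw [geom_sum_eq (by norm_num)]
        have : (0 : ℝ) < (4 / 5) ^ T := by positivity
        rw [div_le_iff_of_neg (by norm_num)]
        linarith
    _ = _ := by ring

theorem sum_geometric_three_quarters_le (T : ℕ) : ∑ k ∈ Finset.range T, (3 / 4 : ℝ) ^ k ≤ 4 := by
  rw [geom_sum_eq (by norm_num)]
  have : (0 : ℝ) < (3 / 4) ^ T := by positivity
  rw [div_le_iff_of_neg (by norm_num)]
  linarith

theorem natClog_two_le (d : ℕ) (hd : 1 ≤ d) : (Nat.clog 2 d : ℝ) ≤ 3 * Real.log d := by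
  rcases hd.eq_or_lt with h | h
  · simp [← h]
  · have h2 : 1 < d := h
    have hlt : 2 ^ (Nat.clog 2 d - 1) < d := Nat.pow_pred_clog_lt_self (by norm_num) h2
    have hpos : 0 < Nat.clog 2 d := Nat.clog_pos (by norm_num) h2
    set K := Nat.clog 2 d
    have h3 : ((2 : ℝ) ^ (K - 1)) ≤ d := by exact_mod_cast hlt.le
    have h4 := Real.log_le_log (by positivity) h3
    rw [Real.log_pow] at h4
    have h5 : Real.log 2 ≤ Real.log d := Real.log_le_log (by norm_num) (by exact_mod_cast h2)
    have h6 := Real.log_two_gt_d9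
    have h7 : ((K - 1 : ℕ) : ℝ) = K - 1 := by
      rw [Nat.cast_sub hpos]; simp
    rw [h7] at h4
    nlinarith

/-- The source of `√(d_eff(1) ln d)`. Only about `log₂ d` scales matter: Cauchy–Schwarz over them
pays the logarithm, and the sum of squares is at most `6 ∑ s i²`. At finer scales the crude bound
`H(ε) ≤ 3 d / ε` makes the terms geometric. -/
theorem sum_half_pow_mul_sqrt_entropy_le {d : ℕ} (hd : 1 ≤ d) {s : Fin d → ℝ} (hs : ∀ i, 0 < s i)
    (hs1 : ∀ i, s i ≤ 1) (T : ℕ) :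
    ∑ k ∈ Finset.range T, (1 / 2 : ℝ) ^ k * √(entropy s ((1 / 2 : ℝ) ^ k))
      ≤ √(18 * ((∑ i, s i ^ 2) * Real.log d)) + 8 := by
  set K := Nat.clog 2 d with hK
  set f : ℕ → ℝ := fun k => (1 / 2 : ℝ) ^ k * √(entropy s ((1 / 2 : ℝ) ^ k)) with hf
  have hf0 : ∀ k, 0 ≤ f k := fun k => by positivity
  have hent : ∀ k : ℕ, 0 ≤ entropy s ((1 / 2 : ℝ) ^ k) := fun k => entropy_nonneg (by positivity)
  have hf2 : ∀ k, f k ^ 2 = (1 / 4 : ℝ) ^ k * entropy s ((1 / 2 : ℝ) ^ k) := fun k => by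
    rw [hf]
    simp only [mul_pow, Real.sq_sqrt (hent k)]
    rw [← pow_mul, mul_comm k 2, pow_mul]
    norm_num
  have hterm : ∀ k, f k ^ 2 ≤ 3 * ∑ i, s i * (if (1 / 2 : ℝ) ^ k < s i then (1 / 2 : ℝ) ^ k else 0) := by
    intro k
    rw [hf2]
    calc _ ≤ (1 / 4 : ℝ) ^ k * (3 * ∑ i, if (1 / 2 : ℝ) ^ k < s i then s i / (1 / 2 : ℝ) ^ k else 0) := by
          gcongr
          exact entropy_le_linear s (by positivity)
      _ = _ := by
          rw [mul_left_comm, Finset.mul_sum]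
          congr 1
          refine Finset.sum_congr rfl fun i _ => ?_
          split_ifs
          · rw [show (1 / 4 : ℝ) = 1 / 2 * (1 / 2) by norm_num, mul_pow]
            field_simp
          · simp
  have hsub : ∑ k ∈ Finset.range T, f k
      ≤ ∑ k ∈ Finset.range K, f k + ∑ k ∈ Finset.range T, f (K + k) := by
    rw [← Finset.sum_range_add]
    exact Finset.sum_le_sum_of_subset_of_nonneg
      (Finset.range_subset_range.2 (Nat.le_add_left T K)) fun k _ _ => hf0 k
  have h1 : ∑ k ∈ Finset.range K, f k ≤ √(18 * ((∑ i, s i ^ 2) * Real.log d)) := by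
    apply Real.le_sqrt_of_sq_le
    calc _ ≤ (Finset.range K).card * ∑ k ∈ Finset.range K, f k ^ 2 := sq_sum_le_card_mul_sum_sq
      _ ≤ (3 * Real.log d) * (6 * ∑ i, s i ^ 2) := by
          apply mul_le_mul _ _ (Finset.sum_nonneg fun k _ => sq_nonneg _)
            (mul_nonneg (by norm_num) (Real.log_natCast_nonneg d))
          · rw [Finset.card_range]; exact natClog_two_le d hd
          · calc _ ≤ ∑ k ∈ Finset.range K,
                  3 * ∑ i, s i * (if (1 / 2 : ℝ) ^ k < s i then (1 / 2 : ℝ) ^ k else 0) :=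
                  Finset.sum_le_sum fun k _ => hterm k
              _ = 3 * ∑ i, s i * ∑ k ∈ Finset.range K,
                  (if (1 / 2 : ℝ) ^ k < s i then (1 / 2 : ℝ) ^ k else 0) := by
                  rw [← Finset.mul_sum, Finset.sum_comm]
                  simp_rw [Finset.mul_sum]
              _ ≤ 3 * ∑ i, s i * (2 * s i) := by
                  gcongr with i
                  · exact (hs i).le
                  · exact (sum_half_pow_lt_le K (s i) (hs i)).trans (min_le_left _ _)
              _ = _ := by
                  rw [Finset.mul_sum, Finset.mul_sum]
                  refine Finset.sum_congr rfl fun i _ => ?_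
                  ring
      _ = _ := by ring
  have h2 : ∑ k ∈ Finset.range T, f (K + k) ≤ 8 := by
    calc _ ≤ ∑ k ∈ Finset.range T, 2 * (3 / 4 : ℝ) ^ k := by
          refine Finset.sum_le_sum fun k _ => ?_
          refine (sq_le_sq₀ (hf0 _) (by positivity)).1 ?_
          calc _ ≤ 3 * ∑ i : Fin d, (1 / 2 : ℝ) ^ (K + k) := by
                refine (hterm _).trans ?_
                gcongr with i
                have := hs i
                have := hs1 i
                split_ifs
                · have : (0 : ℝ) < (1 / 2) ^ (K + k) := by positivity
                  nlinarith
                · rw [mul_zero]; positivity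
            _ = 3 * ((d * (1 / 2) ^ K) * (1 / 2) ^ k) := by
                simp only [Finset.sum_const, Finset.card_univ, Fintype.card_fin, nsmul_eq_mul,
                  pow_add]
                ring
            _ ≤ 3 * (1 * (9 / 16) ^ k) := by
                have h5 : (1 / 2 : ℝ) ^ k ≤ (9 / 16) ^ k :=
                  pow_le_pow_left₀ (by norm_num) (by norm_num) k
                have h6 : (d : ℝ) * (1 / 2) ^ K ≤ 1 := by
                  have : (d : ℝ) ≤ 2 ^ K := by exact_mod_cast Nat.le_pow_clog (by norm_num) d
                  rwa [one_div, inv_pow, ← div_eq_mul_inv, div_le_one (by positivity)]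
                gcongr
            _ ≤ _ := by
                rw [mul_pow, ← pow_mul, mul_comm k 2, pow_mul]
                have : (0 : ℝ) < (9 / 16) ^ k := by positivity
                norm_num
      _ = 2 * ∑ k ∈ Finset.range T, (3 / 4 : ℝ) ^ k := by rw [Finset.mul_sum]
      _ ≤ 8 := by linarith [sum_geometric_three_quarters_le T]
  linarith

theorem entropy_antitone {d : ℕ} (s : Fin d → ℝ) {ε ε' : ℝ} (hε : 0 < ε) (h : ε ≤ ε') :
    entropy s ε' ≤ entropy s ε := by
  refine Finset.sum_le_sum fun i _ => ?_
  split_ifs with h1 h2 h2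
  · have h3 : s i / ε' ≤ s i / ε :=
      div_le_div_of_nonneg_left ((hε.trans_le h).trans h1).le hε h
    have h4 : 0 < s i / ε' := div_pos ((hε.trans_le h).trans h1) (hε.trans_le h)
    have := Real.log_le_log (show 0 < 1 + 2 * (s i / ε') by linarith)
      (show 1 + 2 * (s i / ε') ≤ 1 + 2 * (s i / ε) by linarith)
    linarith
  · exact absurd (h.trans_lt h1) h2
  · have : 0 < s i / ε := div_pos (hε.trans h2) hε
    have := Real.log_nonneg (show (1 : ℝ) ≤ 1 + 2 * (s i / ε) by linarith)
    linarith
  · exact le_rfl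

theorem quad_le_norm_sq {d : ℕ} {s : Fin d → ℝ} (hs : ∀ i, 0 < s i) (hs1 : ∀ i, s i ≤ 1)
    (w : Vec d) : quad s w ≤ ‖w‖ ^ 2 := by
  rw [EuclideanSpace.real_norm_sq_eq]
  refine Finset.sum_le_sum fun i _ => ?_
  have : s i ^ 2 ≤ 1 := pow_le_one₀ (hs i).le (hs1 i)
  nlinarith [sq_nonneg (w i)]

theorem exists_nets {d : ℕ} {s : Fin d → ℝ} (hs : ∀ i, 0 < s i) (hs1 : ∀ i, s i ≤ 1) :
    ∃ N : ℕ → Finset (Vec d), (∀ k, ((N k).card : ℝ) ≤ Real.exp (entropy s ((1 / 2) ^ k))) ∧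
      (∀ k, ∀ y ∈ N k, ‖y‖ ≤ 1) ∧
      ∀ x : Vec d, ‖x‖ ≤ 1 → ∃ y : ℕ → Vec d, y 0 = 0 ∧ (∀ k, y k ∈ N k) ∧
        ∀ k, quad s (x - y k) ≤ 2 * ((1 / 2) ^ k) ^ 2 := by
  choose N hN1 hN2 hN3 using fun k : ℕ =>
    exists_net hs (show (0 : ℝ) < (1 / 2) ^ k by positivity)
  -- Level 0 can be the single point 0, since `quad s x ≤ 1` on the unit ball. Chains then start
  -- where the deviation vanishes.
  refine ⟨fun k => if k = 0 then {0} else N k, fun k => ?_, fun k y hy => ?_, fun x hx => ?_⟩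
  · by_cases hk : k = 0
    · simp only [if_pos hk, Finset.card_singleton, Nat.cast_one]
      exact Real.one_le_exp (entropy_nonneg (by positivity))
    · simpa only [if_neg hk] using hN1 k
  · by_cases hk : k = 0
    · simp only [if_pos hk, Finset.mem_singleton] at hy
      simp [hy]
    · simp only [if_neg hk] at hy
      exact hN2 k y hy
  · choose y hy1 hy2 using fun k => hN3 k x hx
    refine ⟨fun k => if k = 0 then 0 else y k, by simp, fun k => ?_, fun k => ?_⟩
    · by_cases hk : k = 0
      · simp [hk]
      · simpa only [if_neg hk] using hy1 k
    · by_cases hk : k = 0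
      · subst hk
        simp only [if_true, sub_zero, pow_zero, one_pow, mul_one]
        have := quad_le_norm_sq hs hs1 x
        have : ‖x‖ ^ 2 ≤ 1 := pow_le_one₀ (norm_nonneg x) hx
        linarith
      · simpa only [if_neg hk] using hy2 k

/-! ### Moments of the Hessian form and of its truncated increments. -/

/-- Convexity of `exp` averages five square-exponential moments without any independence. The five
directions are those entering an increment: the two differences and `u`, `u'`, `x'`. -/
theorem HasSubgaussianDiag.lintegral_exp_sum_five_le {d : ℕ} {ν : Measure (Vec d)}
    [IsProbabilityMeasure ν] {s : Fin d → ℝ} (h : HasSubgaussianDiag ν s) (w : Fin 5 → Vec d)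
    (q : Fin 5 → ℝ) (hq : ∀ i, 0 < q i) (hw : ∀ i, quad s (w i) ≤ q i ^ 2) :
    ∫⁻ a, ENNReal.ofReal (Real.exp ((1 + ∑ i, (inner ℝ a (w i) / q i) ^ 2) / 20)) ∂ν
      ≤ ENNReal.ofReal 4 := by
  have hpt : ∀ a, Real.exp ((1 + ∑ i, (inner ℝ a (w i) / q i) ^ 2) / 20)
      ≤ ∑ i, 4 / 15 * Real.exp ((inner ℝ a (w i) / q i) ^ 2 / 4) := by
    intro a
    have h1 := convexOn_exp.map_sum_le (t := Finset.univ) (w := fun _ : Fin 5 => (1 / 5 : ℝ))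
      (p := fun i => (inner ℝ a (w i) / q i) ^ 2 / 4) (fun _ _ => by norm_num) (by simp)
      (fun _ _ => Set.mem_univ _)
    simp only [smul_eq_mul] at h1
    have h2 : Real.exp (1 / 20) ≤ 4 / 3 := by
      refine (Real.exp_bound_div_one_sub_of_interval (by norm_num) (by norm_num)).trans ?_
      norm_num
    have h3 : (1 + ∑ i, (inner ℝ a (w i) / q i) ^ 2) / 20
        = 1 / 20 + ∑ i, 1 / 5 * ((inner ℝ a (w i) / q i) ^ 2 / 4) := by
      rw [← Finset.mul_sum, ← Finset.sum_div]; ring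
    rw [h3, Real.exp_add]
    calc _ ≤ 4 / 3 * ∑ i, 1 / 5 * Real.exp ((inner ℝ a (w i) / q i) ^ 2 / 4) := by gcongr
      _ = _ := by
        rw [Finset.mul_sum]
        refine Finset.sum_congr rfl fun i _ => ?_
        ring
  calc _ ≤ ∫⁻ a, ∑ i, ENNReal.ofReal (4 / 15)
        * ENNReal.ofReal (Real.exp ((inner ℝ a (w i) / q i) ^ 2 / 4)) ∂ν := by
        refine lintegral_mono fun a => ?_
        refine (ENNReal.ofReal_le_ofReal (hpt a)).trans (le_of_eq ?_)
        rw [ENNReal.ofReal_sum_of_nonneg fun i _ => by positivity]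
        refine Finset.sum_congr rfl fun i _ => ENNReal.ofReal_mul (by norm_num)
    _ = ∑ i, ENNReal.ofReal (4 / 15)
        * ∫⁻ a, ENNReal.ofReal (Real.exp ((inner ℝ a (w i) / q i) ^ 2 / 4)) ∂ν := by
        rw [lintegral_finsetSum _ fun i _ => by fun_prop]
        refine Finset.sum_congr rfl fun i _ => lintegral_const_mul _ (by fun_prop)
    _ ≤ ∑ _i : Fin 5, ENNReal.ofReal (4 / 15) * 3 := by
        gcongr with i
        exact h (w i) (q i) (hq i) (hw i)
    _ = _ := by
        rw [show (3 : ENNReal) = ENNReal.ofReal 3 by simp, ← ENNReal.ofReal_mul (by norm_num)]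
        rw [Finset.sum_const, Finset.card_univ, Fintype.card_fin, nsmul_eq_mul,
          show ((5 : ℕ) : ENNReal) = ENNReal.ofReal 5 by simp, ← ENNReal.ofReal_mul (by norm_num)]
        norm_num

theorem lintegral_ofReal_le_of_le_const_mul {α : Type*} [MeasurableSpace α] {ν : Measure α}
    {f g : α → ℝ} {c b : ℝ} (hc : 0 ≤ c) (hg : Measurable g)
    (hfg : ∀ a, f a ≤ c * g a) (hb : ∫⁻ a, ENNReal.ofReal (g a) ∂ν ≤ ENNReal.ofReal b) :
    ∫⁻ a, ENNReal.ofReal (f a) ∂ν ≤ ENNReal.ofReal (c * b) := by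
  calc _ ≤ ∫⁻ a, ENNReal.ofReal c * ENNReal.ofReal (g a) ∂ν := by
        refine lintegral_mono fun a => ?_
        rw [← ENNReal.ofReal_mul hc]
        exact ENNReal.ofReal_le_ofReal (hfg a)
    _ = ENNReal.ofReal c * ∫⁻ a, ENNReal.ofReal (g a) ∂ν := lintegral_const_mul _ (by fun_prop)
    _ ≤ ENNReal.ofReal c * ENNReal.ofReal b := by gcongr
    _ = _ := (ENNReal.ofReal_mul hc).symm

theorem integral_le_of_lintegral_ofReal_le {α : Type*} [MeasurableSpace α] {ν : Measure α}
    {f : α → ℝ} {b : ℝ} (hf : Measurable f) (hf0 : ∀ a, 0 ≤ f a) (hb : 0 ≤ b)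
    (h : ∫⁻ a, ENNReal.ofReal (f a) ∂ν ≤ ENNReal.ofReal b) : ∫ a, f a ∂ν ≤ b := by
  rw [integral_eq_lintegral_of_nonneg_ae (Filter.Eventually.of_forall hf0)
    hf.aestronglyMeasurable]
  exact ENNReal.toReal_le_of_le_ofReal hb h

theorem cube_le_exp {V : ℝ} (hV : 0 ≤ V) : V ^ 3 ≤ 384000 * Real.exp (V / 40) := by
  have h := Real.pow_div_factorial_le_exp (V / 40) (by positivity) 3
  norm_num [Nat.factorial] at h
  linarith

theorem abs_le_one_add_abs_of_lipschitz {G : ℝ → ℝ} (hG : LipschitzWith 1 G) (hG0 : |G 0| ≤ 1)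
    (t : ℝ) : |G t| ≤ 1 + |t| := by
  have h := hG.dist_le_mul t 0
  simp only [Real.dist_eq, NNReal.coe_one, one_mul, sub_zero] at h
  calc |G t| = |G 0 + (G t - G 0)| := by congr 1; ring
    _ ≤ |G 0| + |G t - G 0| := abs_add_le _ _
    _ ≤ _ := by linarith

/-- The contribution `G (aᵀx) (aᵀu)²` of the data point `a` to the Hessian form, truncated to
`‖a‖ ≤ M`. -/
noncomputable def truncForm {d : ℕ} (G : ℝ → ℝ) (M : ℝ) (x u a : Vec d) : ℝ :=
  if ‖a‖ ≤ M then G (inner ℝ a x) * inner ℝ a u ^ 2 else 0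

theorem measurable_truncForm {d : ℕ} {G : ℝ → ℝ} (hG : LipschitzWith 1 G) (M : ℝ) (x u : Vec d) :
    Measurable (truncForm G M x u) := by
  have := hG.continuous.measurable
  unfold truncForm
  exact Measurable.ite (measurableSet_le (by fun_prop) measurable_const) (by fun_prop)
    measurable_const

theorem abs_inner_le_of_norm_le {d : ℕ} {M : ℝ} {a x : Vec d} (ha : ‖a‖ ≤ M) (hx : ‖x‖ ≤ 1) :
    |inner ℝ a x| ≤ M := by
  refine (abs_real_inner_le_norm a x).trans ?_
  nlinarith [norm_nonneg a, norm_nonneg x]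

theorem abs_truncForm_le {d : ℕ} {G : ℝ → ℝ} (hG : LipschitzWith 1 G) (hG0 : |G 0| ≤ 1) {M : ℝ}
    (hM : 0 ≤ M) {x u : Vec d} (hx : ‖x‖ ≤ 1) (hu : ‖u‖ ≤ 1) (a : Vec d) :
    |truncForm G M x u a| ≤ (1 + M) * M ^ 2 := by
  unfold truncForm
  split_ifs with h
  · rw [abs_mul, abs_pow]
    have h1 := abs_inner_le_of_norm_le h hx
    have h2 := abs_inner_le_of_norm_le h hu
    have h3 := abs_le_one_add_abs_of_lipschitz hG hG0 (inner ℝ a x)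
    gcongr
    linarith
  · simp; positivity

theorem cubic_form_le_mul {p r y y' w M V : ℝ} (hp : 0 ≤ p) (hr : 0 ≤ r) (hy : 0 ≤ y)
    (hy' : 0 ≤ y') (hM : 1 ≤ M) (hyM : y ≤ M) (hwM : w ≤ M)
    (hV : V = 1 + (p ^ 2 + r ^ 2 + y ^ 2 + y' ^ 2 + w ^ 2)) :
    p * y ^ 2 + (1 + w) * r * (y + y') ≤ 2 * M * V := by
  have i1 : p * y ^ 2 ≤ M * (p * y) := by
    calc _ = y * (p * y) := by ring
      _ ≤ _ := by gcongr
  have i2 : (1 + w) * r * (y + y') ≤ M * (2 * (r * (y + y'))) := by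
    calc (1 + w) * r * (y + y') = (1 + w) * (r * (y + y')) := by ring
      _ ≤ (2 * M) * (r * (y + y')) := by gcongr; linarith
      _ = _ := by ring
  have i3 : p * y + 2 * (r * (y + y')) ≤ 2 * V := by
    linarith [sq_nonneg (p - y), sq_nonneg (r - y), sq_nonneg (r - y'), sq_nonneg p,
      sq_nonneg y, sq_nonneg y', sq_nonneg w]
  have := mul_le_mul_of_nonneg_left i3 (by linarith : 0 ≤ M)
  linarith

theorem cubic_form_sq_le {p r y y' w V : ℝ}
    (hV : V = 1 + (p ^ 2 + r ^ 2 + y ^ 2 + y' ^ 2 + w ^ 2)) :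
    (p * y ^ 2 + (1 + w) * r * (y + y')) ^ 2 ≤ 10 * V ^ 3 := by
  have a1 := sq_nonneg p
  have a2 := sq_nonneg r
  have a3 := sq_nonneg y
  have a4 := sq_nonneg y'
  have a5 := sq_nonneg w
  have hV0 : 0 ≤ V := by linarith
  have j1 : p ^ 2 ≤ V := by linarith
  have j2 : y ^ 2 ≤ V := by linarith
  have j3 : r ^ 2 ≤ V := by linarith
  have j4 : (1 + w) ^ 2 ≤ 2 * V := by linarith [sq_nonneg (1 - w)]
  have j5 : (y + y') ^ 2 ≤ 2 * V := by linarith [sq_nonneg (y - y')]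
  have k1 : (p * y ^ 2) ^ 2 ≤ V ^ 3 := by
    calc _ = p ^ 2 * (y ^ 2 * y ^ 2) := by ring
      _ ≤ V * (V * V) := by gcongr
      _ = _ := by ring
  have k2 : ((1 + w) * r * (y + y')) ^ 2 ≤ 4 * V ^ 3 := by
    calc _ = (1 + w) ^ 2 * r ^ 2 * (y + y') ^ 2 := by ring
      _ ≤ 2 * V * V * (2 * V) := by gcongr
      _ = _ := by ring
  linarith [sq_nonneg (p * y ^ 2 - (1 + w) * r * (y + y'))]

/-- The increment is `ρ` times a cubic polynomial in normalized linear forms. Bounding one factor by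
`M` leaves a quadratic, fit for an exponential moment. Squaring without using `M` gives `V³`, so the
variance is free of `M`. -/
theorem truncForm_sub_bounds {d : ℕ} {G : ℝ → ℝ} (hG : LipschitzWith 1 G) (hG0 : |G 0| ≤ 1)
    {M : ℝ} (hM : 1 ≤ M) {x x' u u' : Vec d} (hx' : ‖x'‖ ≤ 1) (hu : ‖u‖ ≤ 1)
    {ρ : ℝ} (hρ : 0 < ρ) (a : Vec d) :
    let V := 1 + ((inner ℝ a (x - x') / ρ) ^ 2 + (inner ℝ a (u - u') / ρ) ^ 2
      + inner ℝ a u ^ 2 + inner ℝ a u' ^ 2 + inner ℝ a x' ^ 2)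
    |truncForm G M x u a - truncForm G M x' u' a| ≤ 2 * ρ * M * V ∧
      (truncForm G M x u a - truncForm G M x' u' a) ^ 2 ≤ 10 * ρ ^ 2 * V ^ 3 := by
  intro V
  set p := |inner ℝ a (x - x') / ρ| with hp
  set r := |inner ℝ a (u - u') / ρ| with hr
  set y := |inner ℝ a u| with hy
  set y' := |inner ℝ a u'| with hy'
  set w := |inner ℝ a x'| with hw
  have hV : V = 1 + (p ^ 2 + r ^ 2 + y ^ 2 + y' ^ 2 + w ^ 2) := by
    simp only [V, p, r, y, y', w, sq_abs]
  have hp0 : 0 ≤ p := abs_nonneg _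
  have hr0 : 0 ≤ r := abs_nonneg _
  have hy0 : 0 ≤ y := abs_nonneg _
  have hy'0 : 0 ≤ y' := abs_nonneg _
  have hw0 : 0 ≤ w := abs_nonneg _
  have hV0 : 0 ≤ V := by rw [hV]; positivity
  by_cases h : ‖a‖ ≤ M
  · have hyM : y ≤ M := abs_inner_le_of_norm_le h hu
    have hwM : w ≤ M := abs_inner_le_of_norm_le h hx'
    have hmain : |truncForm G M x u a - truncForm G M x' u' a|
        ≤ ρ * (p * y ^ 2 + (1 + w) * r * (y + y')) := by
      simp only [truncForm, if_pos h]
      have e : G (inner ℝ a x) * inner ℝ a u ^ 2 - G (inner ℝ a x') * inner ℝ a u' ^ 2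
          = (G (inner ℝ a x) - G (inner ℝ a x')) * inner ℝ a u ^ 2
            + G (inner ℝ a x') * (inner ℝ a (u - u') * (inner ℝ a u + inner ℝ a u')) := by
        rw [inner_sub_right]; ring
      have h1 : |G (inner ℝ a x) - G (inner ℝ a x')| ≤ ρ * p := by
        have := hG.dist_le_mul (inner ℝ a x) (inner ℝ a x')
        simp only [Real.dist_eq, NNReal.coe_one, one_mul] at this
        rw [← inner_sub_right] at this
        rw [hp, abs_div, abs_of_pos hρ]
        field_simp
        exact this
      have h2 : |inner ℝ a (u - u')| = ρ * r := by
        rw [hr, abs_div, abs_of_pos hρ]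
        field_simp
      have h3 := abs_le_one_add_abs_of_lipschitz hG hG0 (inner ℝ a x')
      rw [e]
      refine (abs_add_le _ _).trans ?_
      rw [abs_mul, abs_mul, abs_mul, abs_pow, h2]
      have h4 : |inner ℝ a u + inner ℝ a u'| ≤ y + y' := abs_add_le _ _
      calc _ ≤ ρ * p * y ^ 2 + (1 + w) * (ρ * r * (y + y')) := by gcongr
        _ = _ := by ring
    constructor
    · refine hmain.trans ?_
      rw [show 2 * ρ * M * V = ρ * (2 * M * V) by ring]
      gcongr
      exact cubic_form_le_mul hp0 hr0 hy0 hy'0 hM hyM hwM hV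
    · have hsq : (truncForm G M x u a - truncForm G M x' u' a) ^ 2
          ≤ (ρ * (p * y ^ 2 + (1 + w) * r * (y + y'))) ^ 2 := by
        rw [← sq_abs]
        gcongr
      refine hsq.trans ?_
      rw [mul_pow, show 10 * ρ ^ 2 * V ^ 3 = ρ ^ 2 * (10 * V ^ 3) by ring]
      gcongr
      exact cubic_form_sq_le hV
  · simp only [truncForm, if_neg h]
    constructor
    · simp; positivity
    · simp; positivity

theorem HasSubgaussianDiag.integral_truncForm_sub_le {d : ℕ} {ν : Measure (Vec d)}
    [IsProbabilityMeasure ν] {s : Fin d → ℝ} (h : HasSubgaussianDiag ν s) (hs : ∀ i, 0 < s i)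
    (hs1 : ∀ i, s i ≤ 1) {G : ℝ → ℝ} (hG : LipschitzWith 1 G) (hG0 : |G 0| ≤ 1)
    {M : ℝ} (hM : 1 ≤ M) {x x' u u' : Vec d} (hx' : ‖x'‖ ≤ 1) (hu : ‖u‖ ≤ 1)
    (hu' : ‖u'‖ ≤ 1) {ρ : ℝ} (hρ : 0 < ρ) (hxρ : quad s (x - x') ≤ ρ ^ 2)
    (huρ : quad s (u - u') ≤ ρ ^ 2) :
    ∫ a, (truncForm G M x u a - truncForm G M x' u' a) ^ 2
      * Real.exp (1 / (80 * M * ρ) * |truncForm G M x u a - truncForm G M x' u' a|) ∂ν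
      ≤ 15360000 * ρ ^ 2 := by
  have hm1 := measurable_truncForm hG M x u
  have hm2 := measurable_truncForm hG M x' u'
  have hM0 : 0 < M := by linarith
  have hq1 : ∀ w : Vec d, ‖w‖ ≤ 1 → quad s w ≤ 1 ^ 2 := fun w hw =>
    (quad_le_norm_sq hs hs1 w).trans (by gcongr)
  have h5 := h.lintegral_exp_sum_five_le ![x - x', u - u', u, u', x'] ![ρ, ρ, 1, 1, 1]
    (by intro i; fin_cases i <;> simp [hρ])
    (by
      intro i
      fin_cases i
      · exact hxρ
      · exact huρ
      · exact hq1 u hu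
      · exact hq1 u' hu'
      · exact hq1 x' hx')
  -- `l₀ = 1 / (80 M ρ)` makes the exponential at most `exp (V / 40)`, and the cube costs another
  -- `exp (V / 40)`. Together they are exactly the available moment `exp (V / 20)`, whose bound 4
  -- turns 3840000 into 15360000.
  have hle := lintegral_ofReal_le_of_le_const_mul (ν := ν)
    (f := fun a => (truncForm G M x u a - truncForm G M x' u' a) ^ 2
      * Real.exp (1 / (80 * M * ρ) * |truncForm G M x u a - truncForm G M x' u' a|))
    (c := 3840000 * ρ ^ 2) (by positivity) (by fun_prop) (fun a => ?_) h5
  · refine integral_le_of_lintegral_ofReal_le (by fun_prop) (fun a => by positivity)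
      (by positivity) (hle.trans (ENNReal.ofReal_le_ofReal (le_of_eq ?_)))
    ring
  · have hb := truncForm_sub_bounds hG hG0 hM hx' hu (x := x) (u' := u') hρ a
    simp only [Fin.sum_univ_five, Matrix.cons_val, div_one]
    set V := 1 + ((inner ℝ a (x - x') / ρ) ^ 2 + (inner ℝ a (u - u') / ρ) ^ 2
      + inner ℝ a u ^ 2 + inner ℝ a u' ^ 2 + inner ℝ a x' ^ 2) with hV
    obtain ⟨hb1, hb2⟩ := hb
    have hV0 : 0 ≤ V := by positivity
    have hc := cube_le_exp hV0
    set X := truncForm G M x u a - truncForm G M x' u' a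
    have hlam : 1 / (80 * M * ρ) * |X| ≤ V / 40 := by
      rw [one_div, inv_mul_le_iff₀ (by positivity)]
      linarith
    calc X ^ 2 * Real.exp (1 / (80 * M * ρ) * |X|)
        ≤ (10 * ρ ^ 2 * V ^ 3) * Real.exp (V / 40) := by gcongr
      _ ≤ (10 * ρ ^ 2 * (384000 * Real.exp (V / 40))) * Real.exp (V / 40) := by gcongr
      _ = 3840000 * ρ ^ 2 * (Real.exp (V / 40) * Real.exp (V / 40)) := by ring
      _ = _ := by rw [← Real.exp_add]; congr 2; ring

theorem HasSubgaussianDiag.lintegral_form_sq_le {d : ℕ} {ν : Measure (Vec d)}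
    [IsProbabilityMeasure ν] {s : Fin d → ℝ} (h : HasSubgaussianDiag ν s) (hs : ∀ i, 0 < s i)
    (hs1 : ∀ i, s i ≤ 1) {G : ℝ → ℝ} (hG : LipschitzWith 1 G) (hG0 : |G 0| ≤ 1)
    {x u : Vec d} (hx : ‖x‖ ≤ 1) (hu : ‖u‖ ≤ 1) :
    ∫⁻ a, ENNReal.ofReal ((G (inner ℝ a x) * inner ℝ a u ^ 2) ^ 2) ∂ν
      ≤ ENNReal.ofReal 3072000 := by
  have hq1 : ∀ w : Vec d, ‖w‖ ≤ 1 → quad s w ≤ 1 ^ 2 := fun w hw =>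
    (quad_le_norm_sq hs hs1 w).trans (by gcongr)
  have h5 := h.lintegral_exp_sum_five_le ![x, u, u, u, u] ![1, 1, 1, 1, 1]
    (by intro i; fin_cases i <;> simp)
    (by
      intro i
      fin_cases i
      · exact hq1 x hx
      all_goals exact hq1 u hu)
  refine (lintegral_ofReal_le_of_le_const_mul (c := 768000) (by positivity) (by fun_prop)
    (fun a => ?_) h5).trans (ENNReal.ofReal_le_ofReal (by norm_num))
  simp only [Fin.sum_univ_five, Matrix.cons_val, div_one]
  set V := 1 + (inner ℝ a x ^ 2 + inner ℝ a u ^ 2 + inner ℝ a u ^ 2 + inner ℝ a u ^ 2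
    + inner ℝ a u ^ 2) with hV
  have hV0 : 0 ≤ V := by positivity
  have hc := cube_le_exp hV0
  have hG1 := abs_le_one_add_abs_of_lipschitz hG hG0 (inner ℝ a x)
  have j1 : G (inner ℝ a x) ^ 2 ≤ 2 * V := by
    rw [← sq_abs]
    calc _ ≤ (1 + |inner ℝ a x|) ^ 2 := by gcongr
      _ ≤ 2 * V := by
        rw [hV]
        nlinarith [sq_nonneg (1 - |inner ℝ a x|), sq_abs (inner ℝ a x), sq_nonneg (inner ℝ a u)]
  have j2 : inner ℝ a u ^ 2 ≤ V := by
    rw [hV]; nlinarith [sq_nonneg (inner ℝ a u), sq_nonneg (inner ℝ a x)]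
  calc (G (inner ℝ a x) * inner ℝ a u ^ 2) ^ 2
      = G (inner ℝ a x) ^ 2 * (inner ℝ a u ^ 2 * inner ℝ a u ^ 2) := by ring
    _ ≤ 2 * V * (V * V) := by gcongr
    _ = 2 * V ^ 3 := by ring
    _ ≤ 2 * (384000 * Real.exp (V / 40)) := by gcongr
    _ ≤ 2 * (384000 * Real.exp (V / 20)) := by gcongr; norm_num
    _ = _ := by ring

/-! ### Chaining for the truncated deviation. -/

theorem tendsto_of_quad_sub_le {d : ℕ} {s : Fin d → ℝ} (hs : ∀ i, 0 < s i) {x : Vec d}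
    {y : ℕ → Vec d} (h : ∀ k, quad s (x - y k) ≤ 2 * ((1 / 2) ^ k) ^ 2) :
    Filter.Tendsto y Filter.atTop (nhds x) := by
  set c := √(∑ i, 2 / s i ^ 2) with hc
  have hb : ∀ k, ‖y k - x‖ ≤ c * (1 / 2) ^ k := by
    intro k
    rw [norm_sub_rev]
    refine (sq_le_sq₀ (norm_nonneg _) (by positivity)).1 ?_
    rw [mul_pow, hc, Real.sq_sqrt (Finset.sum_nonneg fun i _ => by positivity),
      EuclideanSpace.real_norm_sq_eq, Finset.sum_mul]
    refine Finset.sum_le_sum fun i _ => ?_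
    have h1 : s i ^ 2 * (x - y k) i ^ 2 ≤ quad s (x - y k) :=
      Finset.single_le_sum (f := fun i => s i ^ 2 * (x - y k) i ^ 2)
        (fun j _ => by positivity) (Finset.mem_univ i)
    have h2 := hs i
    rw [div_mul_eq_mul_div, le_div_iff₀ (by positivity)]
    linarith [h k]
  rw [tendsto_iff_norm_sub_tendsto_zero]
  refine squeeze_zero (fun k => norm_nonneg _) hb ?_
  simpa using (tendsto_pow_atTop_nhds_zero_of_lt_one (r := (1 / 2 : ℝ)) (by norm_num)
    (by norm_num)).const_mul c

/-- The deterministic half of chaining: increments along the approximations telescope from `z 0 0 =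
0`, and continuity passes to the limit point. -/
theorem abs_le_of_chain {d : ℕ} {s : Fin d → ℝ} {N : ℕ → Finset (Vec d)}
    {z : Vec d → Vec d → ℝ} (hz0 : z 0 0 = 0) {t : ℕ → ℝ} {b : ℝ}
    (hb : ∀ T, ∑ k ∈ Finset.range T, t k ≤ b)
    (hinc : ∀ k, ∀ x ∈ N (k + 1), ∀ u ∈ N (k + 1), ∀ x' ∈ N k, ∀ u' ∈ N k,
      quad s (x - x') ≤ (3 * (1 / 2) ^ k) ^ 2 → quad s (u - u') ≤ (3 * (1 / 2) ^ k) ^ 2 →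
      |z x u - z x' u'| ≤ t k) {x u : Vec d} {y v : ℕ → Vec d} (hy0 : y 0 = 0) (hv0 : v 0 = 0)
    (hyN : ∀ k, y k ∈ N k) (hvN : ∀ k, v k ∈ N k)
    (hyq : ∀ k, quad s (x - y k) ≤ 2 * ((1 / 2) ^ k) ^ 2)
    (hvq : ∀ k, quad s (u - v k) ≤ 2 * ((1 / 2) ^ k) ^ 2)
    (hcont : Filter.Tendsto (fun k => z (y k) (v k)) Filter.atTop (nhds (z x u))) :
    |z x u| ≤ b := by
  -- Consecutive approximations differ by at most `5 · 4⁻ᵏ` in `quad s`, which the radius `3 · 2⁻ᵏ`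
  -- covers.
  have hstep : ∀ (x : Vec d) (y : ℕ → Vec d), (∀ k, quad s (x - y k) ≤ 2 * ((1 / 2) ^ k) ^ 2) →
      ∀ k, quad s (y (k + 1) - y k) ≤ (3 * (1 / 2) ^ k) ^ 2 := by
    intro x y h k
    have h1 : quad s (y (k + 1) - y k) ≤ 2 * quad s (x - y (k + 1)) + 2 * quad s (x - y k) := by
      simp only [quad]
      rw [Finset.mul_sum, Finset.mul_sum, ← Finset.sum_add_distrib]
      refine Finset.sum_le_sum fun i _ => ?_
      simp only [PiLp.sub_apply]
      have : (y (k + 1) i - y k i) ^ 2 ≤ 2 * (x i - y (k + 1) i) ^ 2 + 2 * (x i - y k i) ^ 2 := by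
        nlinarith [sq_nonneg ((x i - y (k + 1) i) + (x i - y k i))]
      have := mul_le_mul_of_nonneg_left this (sq_nonneg (s i))
      linarith
    have h2 := h (k + 1)
    have h3 := h k
    have h4 : (0 : ℝ) ≤ ((1 / 2) ^ k) ^ 2 := by positivity
    rw [pow_succ (1 / 2 : ℝ) k, mul_pow] at h2
    rw [mul_pow]
    linarith
  have hT : ∀ T, |z (y T) (v T)| ≤ ∑ k ∈ Finset.range T, t k := by
    intro T
    induction T with
    | zero => simp [hy0, hv0, hz0]
    | succ T ih =>
      rw [Finset.sum_range_succ]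
      have h1 := hinc T _ (hyN (T + 1)) _ (hvN (T + 1)) _ (hyN T) _ (hvN T)
        (hstep x y hyq T) (hstep u v hvq T)
      have h2 := abs_sub_abs_le_abs_sub (z (y (T + 1)) (v (T + 1))) (z (y T) (v T))
      linarith
  exact le_of_tendsto hcont.abs (Filter.Eventually.of_forall fun T => (hT T).trans (hb T))

/-- The deviation of the empirical mean of the truncated Hessian form from its expectation. -/
noncomputable def truncDev {d n : ℕ} (G : ℝ → ℝ) (M : ℝ) (ν : Measure (Vec d))
    (v : Fin n → Vec d) (x u : Vec d) : ℝ :=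
  1 / (n : ℝ) * ∑ j, truncForm G M x u (v j) - ∫ a, truncForm G M x u a ∂ν

theorem continuous_truncForm {d : ℕ} {G : ℝ → ℝ} (hG : LipschitzWith 1 G) (M : ℝ) (a : Vec d) :
    Continuous fun p : Vec d × Vec d => truncForm G M p.1 p.2 a := by
  unfold truncForm
  have := hG.continuous
  split_ifs
  · fun_prop
  · exact continuous_const

theorem tendsto_truncDev {d n : ℕ} {G : ℝ → ℝ} (hG : LipschitzWith 1 G) (hG0 : |G 0| ≤ 1) {M : ℝ}
    (hM : 0 ≤ M) {ν : Measure (Vec d)} [IsProbabilityMeasure ν] (w : Fin n → Vec d)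
    {x u : Vec d} {y v : ℕ → Vec d} (hy : ∀ k, ‖y k‖ ≤ 1) (hv : ∀ k, ‖v k‖ ≤ 1)
    (hyx : Filter.Tendsto y Filter.atTop (nhds x)) (hvu : Filter.Tendsto v Filter.atTop (nhds u)) :
    Filter.Tendsto (fun k => truncDev G M ν w (y k) (v k)) Filter.atTop
      (nhds (truncDev G M ν w x u)) := by
  have hp : ∀ a, Filter.Tendsto (fun k => truncForm G M (y k) (v k) a) Filter.atTop
      (nhds (truncForm G M x u a)) := by
    intro a
    have h1 : Filter.Tendsto (fun k => (y k, v k)) Filter.atTop (nhds (x, u)) :=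
      hyx.prodMk_nhds hvu
    have hc := continuous_truncForm hG M a
    have h2 := hc.tendsto (x, u)
    have h3 := h2.comp h1
    simpa only [Function.comp_def] using h3
  have h1 : Filter.Tendsto (fun k => ∑ j, truncForm G M (y k) (v k) (w j)) Filter.atTop
      (nhds (∑ j, truncForm G M x u (w j))) := tendsto_finsetSum _ fun j _ => hp (w j)
  have hb : ∀ k a, ‖truncForm G M (y k) (v k) a‖ ≤ (1 + M) * M ^ 2 := fun k a => by
    rw [Real.norm_eq_abs]
    exact abs_truncForm_le hG hG0 hM (hy k) (hv k) a
  have h2 : Filter.Tendsto (fun k => ∫ a, truncForm G M (y k) (v k) a ∂ν) Filter.atTop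
      (nhds (∫ a, truncForm G M x u a ∂ν)) := tendsto_integral_of_dominated_convergence
    (F := fun k a => truncForm G M (y k) (v k) a) (f := fun a => truncForm G M x u a)
    (fun _ => (1 + M) * M ^ 2)
    (fun k => (measurable_truncForm hG M (y k) (v k)).aestronglyMeasurable) (integrable_const _)
    (fun k => Filter.Eventually.of_forall fun a => hb k a)
    (Filter.Eventually.of_forall fun a => hp a)
  unfold truncDev
  exact (h1.const_mul (1 / (n : ℝ))).sub h2

theorem sum_half_pow_mul_add_two_le (T : ℕ) :
    ∑ k ∈ Finset.range T, (1 / 2 : ℝ) ^ k * (k + 2) ≤ 6 := by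
  suffices h : ∑ k ∈ Finset.range T, (1 / 2 : ℝ) ^ k * (k + 2)
      = 6 - (1 / 2 : ℝ) ^ T * (2 * T + 6) by
    rw [h]
    have : (0 : ℝ) ≤ (1 / 2 : ℝ) ^ T * (2 * T + 6) := by positivity
    linarith
  induction T with
  | zero => norm_num
  | succ T ih =>
    rw [Finset.sum_range_succ, ih, pow_succ]
    push_cast
    ring

theorem sum_half_pow_le (T : ℕ) : ∑ k ∈ Finset.range T, (1 / 2 : ℝ) ^ k ≤ 2 := by
  rw [geom_sum_eq (by norm_num)]
  have : (0 : ℝ) < (1 / 2) ^ T := by positivity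
  rw [div_le_iff_of_neg (by norm_num)]
  linarith

/-- The exponent of the union bound at the level `k` of the chaining. -/
noncomputable def chainExponent {d : ℕ} (s : Fin d → ℝ) (η : ℝ) (k : ℕ) : ℝ :=
  4 * entropy s ((1 / 2) ^ (k + 1)) + (k + 2) * Real.log 2 + Real.log (1 / η)

/-- The increment allowed at the level `k` of the chaining. -/
noncomputable def chainStep {d : ℕ} (s : Fin d → ℝ) (M n η : ℝ) (k : ℕ) : ℝ :=
  2 * √(15360000 * (3 * (1 / 2) ^ k) ^ 2 * chainExponent s η k / n)
    + 2 * chainExponent s η k / (1 / (80 * M * (3 * (1 / 2) ^ k)) * n)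

/-- The bound of the truncated deviation that results from the chaining. -/
noncomputable def chainBound (d : ℕ) (d₁ d₃ M n η : ℝ) : ℝ :=
  23520 * (20 * √(d₁ * Real.log d) + 38 + 2 * √(Real.log (1 / η))) / √n
    + 480 * M * (120 * d₃ + 6 + 2 * Real.log (1 / η)) / n

theorem chainExponent_nonneg {d : ℕ} (s : Fin d → ℝ) {η : ℝ} (hη : 0 < η) (hη1 : η ≤ 1) (k : ℕ) :
    0 ≤ chainExponent s η k := by
  have h1 : 0 ≤ entropy s ((1 / 2) ^ (k + 1)) := entropy_nonneg (by positivity)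
  have h2 : 0 ≤ Real.log (1 / η) := Real.log_nonneg (by rwa [one_le_div hη])
  unfold chainExponent
  positivity

/-- The square-root part of Bernstein sums to the `1/√n` term through `√H`, and the linear part to
the `M/n` term through `H`. The confidence terms are summable against `2⁻ᵏ`. -/
theorem sum_chainStep_le {d : ℕ} (hd : 1 ≤ d) {s : Fin d → ℝ} (hs : ∀ i, 0 < s i)
    (hs1 : ∀ i, s i ≤ 1) {M n η : ℝ} (hM : 0 < M) (hn : 0 < n) (hη : 0 < η) (hη1 : η ≤ 1) (T : ℕ) :
    ∑ k ∈ Finset.range T, chainStep s M n η k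
      ≤ chainBound d (∑ i, s i ^ 2) (∑ i, s i ^ (2 / 3 : ℝ)) M n η := by
  set τ := chainExponent s η with hτ
  have hτ0 : ∀ k, 0 ≤ τ k := chainExponent_nonneg s hη hη1
  have hl : 0 ≤ Real.log (1 / η) := Real.log_nonneg (by rwa [one_le_div hη])
  have hent : ∀ k : ℕ, 0 ≤ entropy s ((1 / 2 : ℝ) ^ k) := fun k => entropy_nonneg (by positivity)
  have hlog2 : Real.log 2 ≤ 1 := by linarith [Real.log_two_lt_d9]
  have hlog20 : 0 ≤ Real.log 2 := Real.log_nonneg (by norm_num)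
  have hstep : ∀ k, chainStep s M n η k
      ≤ 23520 / √n * ((1 / 2) ^ k * √(τ k)) + 480 * M / n * ((1 / 2) ^ k * τ k) := by
    intro k
    unfold chainStep
    apply add_le_add
    · have h1 : √(15360000 * (3 * (1 / 2) ^ k) ^ 2 * τ k / n)
          = √15360000 * (3 * (1 / 2) ^ k) * √(τ k) / √n := by
        rw [Real.sqrt_div' _ hn.le, Real.sqrt_mul (by positivity), Real.sqrt_mul (by positivity),
          Real.sqrt_sq (by positivity)]
      have h2 : √(15360000 : ℝ) ≤ 3920 := by
        rw [Real.sqrt_le_left (by norm_num)]; norm_num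
      rw [h1]
      calc _ ≤ 2 * (3920 * (3 * (1 / 2) ^ k) * √(τ k) / √n) := by gcongr
        _ = _ := by ring
    · apply le_of_eq
      field_simp
      ring
  have hsqrt : ∀ k, (1 / 2 : ℝ) ^ k * √(τ k)
      ≤ 4 * ((1 / 2 : ℝ) ^ (k + 1) * √(entropy s ((1 / 2 : ℝ) ^ (k + 1))))
        + (1 / 2 : ℝ) ^ k * (k + 2) + (1 / 2 : ℝ) ^ k * √(Real.log (1 / η)) := by
    intro k
    have h1 : √(τ k) ≤ 2 * √(entropy s ((1 / 2 : ℝ) ^ (k + 1))) + (k + 2)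
        + √(Real.log (1 / η)) := by
      have hh := hent (k + 1)
      apply Real.sqrt_le_iff.2 ⟨by positivity, ?_⟩
      have e1 := Real.sq_sqrt hh
      have e2 := Real.sq_sqrt hl
      set A := √(entropy s ((1 / 2 : ℝ) ^ (k + 1)))
      set B := √(Real.log (1 / η))
      have hA : 0 ≤ A := Real.sqrt_nonneg _
      have hB : 0 ≤ B := Real.sqrt_nonneg _
      have hk : (0 : ℝ) ≤ k := Nat.cast_nonneg k
      simp only [hτ, chainExponent]
      rw [← e1, ← e2]
      have h5 : ((k : ℝ) + 2) * Real.log 2 ≤ (k + 2) ^ 2 := by nlinarith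
      nlinarith [mul_nonneg hA hB, mul_nonneg hA (by positivity : (0 : ℝ) ≤ k + 2),
        mul_nonneg hB (by positivity : (0 : ℝ) ≤ k + 2)]
    calc _ ≤ (1 / 2 : ℝ) ^ k * (2 * √(entropy s ((1 / 2 : ℝ) ^ (k + 1))) + (k + 2)
        + √(Real.log (1 / η))) := by gcongr
      _ = _ := by rw [pow_succ]; ring
  have hS1 : ∑ k ∈ Finset.range T, (1 / 2 : ℝ) ^ k * √(τ k)
      ≤ 20 * √((∑ i, s i ^ 2) * Real.log d) + 38 + 2 * √(Real.log (1 / η)) := by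
    have h1 : ∑ k ∈ Finset.range T, (1 / 2 : ℝ) ^ (k + 1) * √(entropy s ((1 / 2 : ℝ) ^ (k + 1)))
        ≤ √(18 * ((∑ i, s i ^ 2) * Real.log d)) + 8 := by
      have := sum_half_pow_mul_sqrt_entropy_le hd hs hs1 (T + 1)
      rw [Finset.sum_range_succ'] at this
      have h0 : 0 ≤ (1 / 2 : ℝ) ^ 0 * √(entropy s ((1 / 2 : ℝ) ^ 0)) := by positivity
      linarith
    have h2 : √(18 * ((∑ i, s i ^ 2) * Real.log d)) ≤ 5 * √((∑ i, s i ^ 2) * Real.log d) := by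
      rw [Real.sqrt_mul (by norm_num)]
      gcongr
      rw [Real.sqrt_le_left (by norm_num)]; norm_num
    calc _ ≤ _ := Finset.sum_le_sum fun k _ => hsqrt k
      _ = 4 * ∑ k ∈ Finset.range T, ((1 / 2 : ℝ) ^ (k + 1) * √(entropy s ((1 / 2 : ℝ) ^ (k + 1))))
          + ∑ k ∈ Finset.range T, (1 / 2 : ℝ) ^ k * (k + 2)
          + (∑ k ∈ Finset.range T, (1 / 2 : ℝ) ^ k) * √(Real.log (1 / η)) := by
        rw [Finset.sum_add_distrib, Finset.sum_add_distrib, Finset.mul_sum, Finset.sum_mul]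
      _ ≤ 4 * (5 * √((∑ i, s i ^ 2) * Real.log d) + 8) + 6 + 2 * √(Real.log (1 / η)) := by
        gcongr
        · exact h1.trans (by linarith)
        · exact sum_half_pow_mul_add_two_le T
        · exact sum_half_pow_le T
      _ = _ := by ring
  have hS2 : ∑ k ∈ Finset.range T, (1 / 2 : ℝ) ^ k * τ k
      ≤ 120 * ∑ i, s i ^ (2 / 3 : ℝ) + 6 + 2 * Real.log (1 / η) := by
    calc _ ≤ ∑ k ∈ Finset.range T, (4 * ((1 / 2 : ℝ) ^ k * entropy s ((1 / 2 : ℝ) ^ (k + 1)))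
          + (1 / 2 : ℝ) ^ k * (k + 2) + (1 / 2 : ℝ) ^ k * Real.log (1 / η)) := by
          refine Finset.sum_le_sum fun k _ => ?_
          simp only [hτ, chainExponent]
          have h5 : ((k : ℝ) + 2) * Real.log 2 ≤ k + 2 := by
            have hk : (0 : ℝ) ≤ k := Nat.cast_nonneg k
            nlinarith
          have := mul_le_mul_of_nonneg_left h5 (by positivity : (0 : ℝ) ≤ (1 / 2) ^ k)
          linarith
      _ = 4 * ∑ k ∈ Finset.range T, ((1 / 2 : ℝ) ^ k * entropy s ((1 / 2 : ℝ) ^ (k + 1)))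
          + ∑ k ∈ Finset.range T, (1 / 2 : ℝ) ^ k * (k + 2)
          + (∑ k ∈ Finset.range T, (1 / 2 : ℝ) ^ k) * Real.log (1 / η) := by
        rw [Finset.sum_add_distrib, Finset.sum_add_distrib, Finset.mul_sum, Finset.sum_mul]
      _ ≤ 4 * (30 * ∑ i, s i ^ (2 / 3 : ℝ)) + 6 + 2 * Real.log (1 / η) := by
        gcongr
        · exact sum_half_pow_mul_entropy_le hs T
        · exact sum_half_pow_mul_add_two_le T
        · exact sum_half_pow_le T
      _ = _ := by ring
  calc _ ≤ _ := Finset.sum_le_sum fun k _ => hstep k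
    _ = 23520 / √n * ∑ k ∈ Finset.range T, ((1 / 2) ^ k * √(τ k))
        + 480 * M / n * ∑ k ∈ Finset.range T, ((1 / 2) ^ k * τ k) := by
        rw [Finset.sum_add_distrib, Finset.mul_sum, Finset.mul_sum]
    _ ≤ 23520 / √n * (20 * √((∑ i, s i ^ 2) * Real.log d) + 38 + 2 * √(Real.log (1 / η)))
        + 480 * M / n * (120 * ∑ i, s i ^ (2 / 3 : ℝ) + 6 + 2 * Real.log (1 / η)) := by gcongr
    _ = _ := by unfold chainBound; ring

/-- Bernstein for each quadruple of net points, then a union bound. The exponent pays `4 H` for the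
four nets and `(k + 2) log 2` for both the factor 2 of the two-sided bound and the share `2^-(k+1)`
of `η`. -/
theorem measure_exists_increment_gt_le {Ω : Type*} [MeasurableSpace Ω] {P : Measure Ω}
    [IsProbabilityMeasure P] {d : ℕ} {ν : Measure (Vec d)} [IsProbabilityMeasure ν]
    {s : Fin d → ℝ} (h : HasSubgaussianDiag ν s) (hs : ∀ i, 0 < s i) (hs1 : ∀ i, s i ≤ 1)
    {G : ℝ → ℝ} (hG : LipschitzWith 1 G) (hG0 : |G 0| ≤ 1) {M : ℝ} (hM : 1 ≤ M)
    {n : ℕ} (hn : 1 ≤ n) {Y : Fin n → Ω → Vec d} (hY : ∀ j, Measurable (Y j))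
    (hind : iIndepFun Y P) (hlaw : ∀ j, P.map (Y j) = ν) {η : ℝ} (hη : 0 < η) (hη1 : η ≤ 1)
    {N : ℕ → Finset (Vec d)}
    (hNc : ∀ k, ((N k).card : ℝ) ≤ Real.exp (entropy s ((1 / 2) ^ k)))
    (hNb : ∀ k, ∀ y ∈ N k, ‖y‖ ≤ 1) (k : ℕ) :
    P {ω | ∃ x ∈ N (k + 1), ∃ u ∈ N (k + 1), ∃ x' ∈ N k, ∃ u' ∈ N k,
      quad s (x - x') ≤ (3 * (1 / 2) ^ k) ^ 2 ∧ quad s (u - u') ≤ (3 * (1 / 2) ^ k) ^ 2 ∧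
      chainStep s M n η k < |truncDev G M ν (fun j => Y j ω) x u
        - truncDev G M ν (fun j => Y j ω) x' u'|} ≤ ENNReal.ofReal (η * (1 / 2) ^ (k + 1)) := by
  classical
  set ρ : ℝ := 3 * (1 / 2) ^ k with hρ
  have hρ0 : 0 < ρ := by positivity
  set τ := chainExponent s η k with hτ
  set I := (N (k + 1) ×ˢ N (k + 1)) ×ˢ (N k ×ˢ N k) with hI
  set E : (Vec d × Vec d) × (Vec d × Vec d) → Set Ω := fun p =>
    {ω | quad s (p.1.1 - p.2.1) ≤ ρ ^ 2 ∧ quad s (p.1.2 - p.2.2) ≤ ρ ^ 2 ∧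
      chainStep s M n η k < |truncDev G M ν (fun j => Y j ω) p.1.1 p.1.2
        - truncDev G M ν (fun j => Y j ω) p.2.1 p.2.2|} with hE
  have hEp : ∀ p ∈ I, P (E p) ≤ ENNReal.ofReal (2 * Real.exp (-τ)) := by
    rintro ⟨⟨x, u⟩, ⟨x', u'⟩⟩ hp
    simp only [hI, Finset.mem_product] at hp
    obtain ⟨⟨hx, hu⟩, hx', hu'⟩ := hp
    by_cases hq : quad s (x - x') ≤ ρ ^ 2 ∧ quad s (u - u') ≤ ρ ^ 2
    · have hK := h.integral_truncForm_sub_le hs hs1 hG hG0 hM (x := x) (hNb _ _ hx') (hNb _ _ hu)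
        (hNb _ _ hu') hρ0 hq.1 hq.2
      have hm1 := measurable_truncForm hG M x u
      have hm2 := measurable_truncForm hG M x' u'
      have hM0 : 0 ≤ M := by linarith
      have hB1 := abs_truncForm_le hG hG0 hM0 (hNb _ _ hx) (hNb _ _ hu)
      have hB2 := abs_truncForm_le hG hG0 hM0 (hNb _ _ hx') (hNb _ _ hu')
      have hb := measure_abs_mean_sub_integral_ge_le hn hY hind hlaw
        (X := fun a => truncForm G M x u a - truncForm G M x' u' a) (hm1.sub hm2)
        (B := (1 + M) * M ^ 2 + (1 + M) * M ^ 2)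
        (fun a => (abs_sub _ _).trans (add_le_add (hB1 a) (hB2 a)))
        (l₀ := 1 / (80 * M * ρ)) (by positivity) (K := 15360000 * ρ ^ 2) (by positivity) hK
        (chainExponent_nonneg s hη hη1 k)
      refine (measure_mono ?_).trans hb
      rintro ω ⟨-, -, hω⟩
      refine lt_of_lt_of_eq hω ?_
      rw [integral_sub (integrable_of_measurable_of_bound hm1 hB1)
        (integrable_of_measurable_of_bound hm2 hB2), Finset.sum_sub_distrib]
      unfold truncDev
      congr 1
      ring
    · have : E ((x, u), (x', u')) = ∅ := by
        ext ω
        simp only [hE, Set.mem_ofPred_eq, Set.mem_empty_iff_false, iff_false]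
        exact fun hc => hq ⟨hc.1, hc.2.1⟩
      rw [this]
      simp
  have hcard : (I.card : ℝ) ≤ Real.exp (4 * entropy s ((1 / 2) ^ (k + 1))) := by
    have h1 := hNc (k + 1)
    have h2 : ((N k).card : ℝ) ≤ Real.exp (entropy s ((1 / 2) ^ (k + 1))) := by
      refine (hNc k).trans (Real.exp_le_exp.2 (entropy_antitone s (by positivity) ?_))
      exact pow_le_pow_of_le_one (by norm_num) (by norm_num) (Nat.le_succ k)
    rw [hI]
    simp only [Finset.card_product]
    push_cast
    set e := Real.exp (entropy s ((1 / 2) ^ (k + 1)))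
    calc _ ≤ (e * e) * (e * e) := by gcongr
      _ = _ := by
        rw [show (4 : ℝ) * entropy s ((1 / 2) ^ (k + 1))
          = ((4 : ℕ) : ℝ) * entropy s ((1 / 2) ^ (k + 1)) by norm_num, Real.exp_nat_mul]
        ring
  calc _ ≤ P (⋃ p ∈ I, E p) := by
        refine measure_mono ?_
        rintro ω ⟨x, hx, u, hu, x', hx', u', hu', hω⟩
        simp only [Set.mem_iUnion]
        exact ⟨((x, u), (x', u')), by simp [hI, hx, hu, hx', hu'], hω⟩
    _ ≤ ∑ p ∈ I, P (E p) := measure_biUnion_finset_le _ _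
    _ ≤ ∑ _p ∈ I, ENNReal.ofReal (2 * Real.exp (-τ)) := Finset.sum_le_sum hEp
    _ = ENNReal.ofReal (I.card * (2 * Real.exp (-τ))) := by
        rw [Finset.sum_const, nsmul_eq_mul, ENNReal.ofReal_mul (Nat.cast_nonneg _),
          ENNReal.ofReal_natCast]
    _ ≤ _ := by
        apply ENNReal.ofReal_le_ofReal
        have e1 : Real.exp (-τ) = Real.exp (-(4 * entropy s ((1 / 2) ^ (k + 1))))
            * ((1 / 2) ^ (k + 2) * η) := by
          have hp : 0 < (1 / 2 : ℝ) ^ (k + 2) * η := by positivity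
          rw [← Real.exp_log hp, ← Real.exp_add, Real.log_mul (by positivity) hη.ne',
            Real.log_pow]
          congr 1
          have l1 : Real.log (1 / 2) = -Real.log 2 := by rw [one_div, Real.log_inv]
          have l2 : Real.log (1 / η) = -Real.log η := by rw [one_div, Real.log_inv]
          rw [hτ, chainExponent, l1, l2]
          push_cast
          ring
        calc _ ≤ Real.exp (4 * entropy s ((1 / 2) ^ (k + 1))) * (2 * Real.exp (-τ)) := by gcongr
          _ = _ := by
            rw [e1, Real.exp_neg]
            have := (Real.exp_pos (4 * entropy s ((1 / 2) ^ (k + 1)))).ne'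
            field_simp
            ring

/-- The exceptional event ranges over uncountably many `(x, u)` but lies in the countable union of
the increment failures. Hence only outer measure is needed, and the shares of `η` sum to `η`. -/
theorem measure_exists_truncDev_gt_le {Ω : Type*} [MeasurableSpace Ω] {P : Measure Ω}
    [IsProbabilityMeasure P] {d : ℕ} (hd : 1 ≤ d) {ν : Measure (Vec d)} [IsProbabilityMeasure ν]
    {s : Fin d → ℝ} (h : HasSubgaussianDiag ν s) (hs : ∀ i, 0 < s i) (hs1 : ∀ i, s i ≤ 1)
    {G : ℝ → ℝ} (hG : LipschitzWith 1 G) (hG0 : |G 0| ≤ 1) {M : ℝ} (hM : 1 ≤ M)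
    {n : ℕ} (hn : 1 ≤ n) {Y : Fin n → Ω → Vec d} (hY : ∀ j, Measurable (Y j))
    (hind : iIndepFun Y P) (hlaw : ∀ j, P.map (Y j) = ν) {η : ℝ} (hη : 0 < η) (hη1 : η ≤ 1) :
    P {ω | ∃ x u : Vec d, ‖x‖ ≤ 1 ∧ ‖u‖ ≤ 1 ∧
      chainBound d (∑ i, s i ^ 2) (∑ i, s i ^ (2 / 3 : ℝ)) M n η
        < |truncDev G M ν (fun j => Y j ω) x u|} ≤ ENNReal.ofReal η := by
  obtain ⟨N, hNc, hNb, hN⟩ := exists_nets hs hs1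
  have hM0 : 0 < M := by linarith
  have hn0 : (0 : ℝ) < n := by exact_mod_cast hn
  set E : ℕ → Set Ω := fun k => {ω | ∃ x ∈ N (k + 1), ∃ u ∈ N (k + 1), ∃ x' ∈ N k, ∃ u' ∈ N k,
      quad s (x - x') ≤ (3 * (1 / 2) ^ k) ^ 2 ∧ quad s (u - u') ≤ (3 * (1 / 2) ^ k) ^ 2 ∧
      chainStep s M n η k < |truncDev G M ν (fun j => Y j ω) x u
        - truncDev G M ν (fun j => Y j ω) x' u'|} with hE
  calc _ ≤ P (⋃ k, E k) := by
        refine measure_mono fun ω hω => ?_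
        obtain ⟨x, u, hx, hu, hlt⟩ := hω
        by_contra hc
        simp only [Set.mem_iUnion, not_exists] at hc
        obtain ⟨y, hy0, hyN, hyq⟩ := hN x hx
        obtain ⟨v, hv0, hvN, hvq⟩ := hN u hu
        refine absurd hlt (not_lt.2 ?_)
        refine abs_le_of_chain (s := s) (N := N) (z := truncDev G M ν (fun j => Y j ω))
          (t := chainStep s M n η) (by simp [truncDev, truncForm])
          (sum_chainStep_le hd hs hs1 hM0 hn0 hη hη1) ?_ hy0 hv0 hyN hvN hyq hvq
          (tendsto_truncDev hG hG0 hM0.le _ (fun k => hNb k _ (hyN k)) (fun k => hNb k _ (hvN k))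
            (tendsto_of_quad_sub_le hs hyq) (tendsto_of_quad_sub_le hs hvq))
        intro k a ha b hb a' ha' b' hb' hq1 hq2
        by_contra hlt'
        exact hc k ⟨a, ha, b, hb, a', ha', b', hb', hq1, hq2, not_le.1 hlt'⟩
    _ ≤ ∑' k, P (E k) := measure_iUnion_le _
    _ ≤ ∑' k : ℕ, ENNReal.ofReal (η * (1 / 2) ^ (k + 1)) := ENNReal.tsum_le_tsum fun k =>
        measure_exists_increment_gt_le h hs hs1 hG hG0 hM hn hY hind hlaw hη hη1 hNc hNb k
    _ = ENNReal.ofReal η := by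
        have hsum : HasSum (fun k : ℕ => η * (1 / 2 : ℝ) ^ (k + 1)) η := by
          have := (hasSum_geometric_two' 1).mul_left η
          simp only [mul_one] at this
          have e : (fun k : ℕ => η * (1 / 2 : ℝ) ^ (k + 1)) = fun k => η * (1 / 2 / 2 ^ k) := by
            ext k
            rw [pow_succ, one_div, inv_pow]
            ring
          rwa [e]
        rw [← ENNReal.ofReal_tsum_of_nonneg (fun k => by positivity) hsum.summable, hsum.tsum_eq]

/-! ### Removing the truncation. -/

/-- The deviation of the empirical mean of the Hessian form `G (aᵀx) (aᵀu)²` from its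
expectation. -/
noncomputable def formDev {d n : ℕ} (G : ℝ → ℝ) (ν : Measure (Vec d))
    (v : Fin n → Vec d) (x u : Vec d) : ℝ :=
  1 / (n : ℝ) * ∑ j, G (inner ℝ (v j) x) * inner ℝ (v j) u ^ 2
    - ∫ a, G (inner ℝ a x) * inner ℝ a u ^ 2 ∂ν

theorem HasSubgaussianDiag.abs_integral_form_sub_truncForm_le {d : ℕ} {ν : Measure (Vec d)}
    [IsProbabilityMeasure ν] {s : Fin d → ℝ} (h : HasSubgaussianDiag ν s) (hs : ∀ i, 0 < s i)
    (hs1 : ∀ i, s i ≤ 1) {G : ℝ → ℝ} (hG : LipschitzWith 1 G) (hG0 : |G 0| ≤ 1)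
    {M : ℝ} (hM : 0 ≤ M) {n : ℝ} (hn : 0 < n) (hν : ν {a | M < ‖a‖} ≤ ENNReal.ofReal (1 / n))
    {x u : Vec d} (hx : ‖x‖ ≤ 1) (hu : ‖u‖ ≤ 1) :
    |∫ a, G (inner ℝ a x) * inner ℝ a u ^ 2 ∂ν - ∫ a, truncForm G M x u a ∂ν|
      ≤ 2000000 / √n := by
  have hGm := hG.continuous.measurable
  set f : Vec d → ℝ := fun a => G (inner ℝ a x) * inner ℝ a u ^ 2 with hf
  have hfm : Measurable f := by fun_prop
  have hl := h.lintegral_form_sq_le hs hs1 hG hG0 hx hu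
  have hf2 : Integrable (fun a => f a ^ 2) ν := by
    refine ⟨(hfm.pow_const 2).aestronglyMeasurable, ?_⟩
    rw [hasFiniteIntegral_iff_ofReal (Filter.Eventually.of_forall fun a => sq_nonneg _)]
    exact hl.trans_lt ENNReal.ofReal_lt_top
  have hf2i : ∫ a, f a ^ 2 ∂ν ≤ 3072000 :=
    integral_le_of_lintegral_ofReal_le (hfm.pow_const 2) (fun a => sq_nonneg _) (by norm_num) hl
  have hfi : Integrable f ν := by
    refine Integrable.mono' (hf2.add (integrable_const (1 : ℝ))) hfm.aestronglyMeasurable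
      (Filter.Eventually.of_forall fun a => ?_)
    rw [Real.norm_eq_abs, Pi.add_apply, ← sq_abs]
    nlinarith [sq_nonneg (|f a| - 1), abs_nonneg (f a)]
  have hti : Integrable (truncForm G M x u) ν :=
    integrable_of_measurable_of_bound (measurable_truncForm hG M x u)
      (abs_truncForm_le hG hG0 hM hx hu)
  set B : Set (Vec d) := {a | M < ‖a‖} with hB
  have hBm : MeasurableSet B := measurableSet_lt measurable_const measurable_norm
  have hBi : Integrable (B.indicator fun _ => (1 : ℝ)) ν := (integrable_const _).indicator hBm
  have hBv : ∫ a, B.indicator (fun _ => (1 : ℝ)) a ∂ν ≤ 1 / n := by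
    rw [integral_indicator_const _ hBm, smul_eq_mul, mul_one]
    exact ENNReal.toReal_le_of_le_ofReal (by positivity) hν
  have hsn : 0 < √n := Real.sqrt_pos.2 hn
  have hsn2 : √n * √n = n := Real.mul_self_sqrt hn.le
  rw [← integral_sub hfi hti]
  refine (abs_integral_le_integral_abs).trans ?_
  -- The two integrands differ only where `‖a‖ > M`. There the weighted inequality `2|f| ≤ f² / √n +
  -- √n` balances a bounded second moment against a probability of at most `1 / n`.
  calc _ ≤ ∫ a, (1 / √n * f a ^ 2 + √n * B.indicator (fun _ => (1 : ℝ)) a) / 2 ∂ν := by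
        refine integral_mono (hfi.sub hti).abs
          (((hf2.const_mul _).add (hBi.const_mul _)).div_const 2) fun a => ?_
        simp only [truncForm]
        by_cases ha : ‖a‖ ≤ M
        · have hnB : a ∉ B := not_lt.2 ha
          simp only [if_pos ha, hnB, not_false_eq_true, Set.indicator_of_notMem, hf, sub_self,
            abs_zero]
          positivity
        · have hmB : a ∈ B := not_le.1 ha
          simp only [if_neg ha, hmB, Set.indicator_of_mem, sub_zero]
          rw [← sq_abs]
          set z := |f a|
          have : 2 * z ≤ 1 / √n * z ^ 2 + √n := by
            have h1 : 0 ≤ (z - √n) ^ 2 / √n := by positivity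
            have h2 : (z - √n) ^ 2 / √n = 1 / √n * z ^ 2 + √n - 2 * z := by
              field_simp
              ring
            linarith
          linarith
    _ = (1 / √n * ∫ a, f a ^ 2 ∂ν + √n * ∫ a, B.indicator (fun _ => (1 : ℝ)) a ∂ν) / 2 := by
        rw [integral_div, integral_add (hf2.const_mul _) (hBi.const_mul _), integral_const_mul,
          integral_const_mul]
    _ ≤ (1 / √n * 3072000 + √n * (1 / n)) / 2 := by gcongr
    _ ≤ 2000000 / √n := by
        have : √n * (1 / n) = 1 / √n := by
          rw [← hsn2]; field_simp; simp [Real.sqrt_sq hsn.le]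
        rw [this]
        have : 0 < 1 / √n := by positivity
        rw [div_eq_mul_one_div (2000000 : ℝ)]
        linarith

/-- `M` is chosen so that one point exceeds it with probability at most `η / n`. Off an event of
probability `η`, truncation leaves the sample unchanged and affects only the expectation. Chaining
spends the other `η`. -/
theorem measure_exists_formDev_gt_le {Ω : Type*} [MeasurableSpace Ω] {P : Measure Ω}
    [IsProbabilityMeasure P] {d : ℕ} (hd : 1 ≤ d) {ν : Measure (Vec d)} [IsProbabilityMeasure ν]
    {s : Fin d → ℝ} (h : HasSubgaussianDiag ν s) (hs : ∀ i, 0 < s i) (hs1 : ∀ i, s i ≤ 1)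
    (hsum : 1 ≤ ∑ i, s i ^ 2)
    {G : ℝ → ℝ} (hG : LipschitzWith 1 G) (hG0 : |G 0| ≤ 1)
    {n : ℕ} (hn : 1 ≤ n) {Y : Fin n → Ω → Vec d} (hY : ∀ j, Measurable (Y j))
    (hind : iIndepFun Y P) (hlaw : ∀ j, P.map (Y j) = ν) {η : ℝ} (hη : 0 < η) (hη1 : η ≤ 1) :
    P {ω | ∃ x u : Vec d, ‖x‖ ≤ 1 ∧ ‖u‖ ≤ 1 ∧
      chainBound d (∑ i, s i ^ 2) (∑ i, s i ^ (2 / 3 : ℝ))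
          √(4 * ∑ i, s i ^ 2 + 8 * Real.log (3 * n / η)) n η + 2000000 / √n
        < |formDev G ν (fun j => Y j ω) x u|} ≤ ENNReal.ofReal (2 * η) := by
  have hn0 : (0 : ℝ) < n := by exact_mod_cast hn
  have hn1 : (1 : ℝ) ≤ n := by exact_mod_cast hn
  have hlog : 0 ≤ Real.log (3 * n / η) := Real.log_nonneg (by rw [one_le_div hη]; linarith)
  set M := √(4 * ∑ i, s i ^ 2 + 8 * Real.log (3 * n / η)) with hMd
  have hM : 1 ≤ M := by rw [hMd, Real.one_le_sqrt]; linarith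
  have hM2 : M ^ 2 = 4 * ∑ i, s i ^ 2 + 8 * Real.log (3 / (η / n)) := by
    rw [hMd, Real.sq_sqrt (by linarith)]
    congr 3
    field_simp
  have hM0 : 0 ≤ M := by linarith
  have hnorm : ν {a | M < ‖a‖} ≤ ENNReal.ofReal (η / n) := by
    refine (measure_mono fun a ha => ?_).trans
      (h.measure_norm_sq_gt_le hs hs1 (show 0 < η / n by positivity))
    change _ < ‖a‖ ^ 2
    rw [← hM2]
    exact pow_lt_pow_left₀ ha hM0 (by norm_num)
  have hbias := fun (x u : Vec d) (hx : ‖x‖ ≤ 1) (hu : ‖u‖ ≤ 1) =>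
    h.abs_integral_form_sub_truncForm_le hs hs1 hG hG0 hM0 hn0
      (hnorm.trans (ENNReal.ofReal_le_ofReal (by gcongr))) hx hu
  have hchain := measure_exists_truncDev_gt_le hd h hs hs1 hG hG0 hM hn hY hind hlaw hη hη1
  have htail : P (⋃ j, {ω | M < ‖Y j ω‖}) ≤ ENNReal.ofReal η := by
    calc _ ≤ ∑ j, P {ω | M < ‖Y j ω‖} := measure_iUnion_fintype_le _ _
      _ ≤ ∑ _j : Fin n, ENNReal.ofReal (η / n) := by
          refine Finset.sum_le_sum fun j _ => ?_
          have : P {ω | M < ‖Y j ω‖} = ν {a | M < ‖a‖} := by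
            rw [← hlaw j, Measure.map_apply (hY j)
              (measurableSet_lt measurable_const measurable_norm)]
            rfl
          rw [this]
          exact hnorm
      _ = ENNReal.ofReal η := by
          rw [Finset.sum_const, Finset.card_univ, Fintype.card_fin, nsmul_eq_mul,
            ← ENNReal.ofReal_natCast, ← ENNReal.ofReal_mul (Nat.cast_nonneg _)]
          congr 1
          field_simp
  rw [two_mul, ENNReal.ofReal_add hη.le hη.le]
  refine (measure_mono ?_).trans ((measure_union_le _ _).trans (add_le_add hchain htail))
  rintro ω ⟨x, u, hx, hu, hlt⟩
  by_cases hω : ∃ j, M < ‖Y j ω‖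
  · right
    simpa using hω
  · left
    push Not at hω
    refine ⟨x, u, hx, hu, ?_⟩
    have e : formDev G ν (fun j => Y j ω) x u = truncDev G M ν (fun j => Y j ω) x u
        - (∫ a, G (inner ℝ a x) * inner ℝ a u ^ 2 ∂ν - ∫ a, truncForm G M x u a ∂ν) := by
      unfold formDev truncDev
      have : ∀ j, truncForm G M x u (Y j ω) = G (inner ℝ (Y j ω) x) * inner ℝ (Y j ω) u ^ 2 :=
        fun j => if_pos (hω j)
      simp_rw [this]
      ring
    rw [e] at hlt
    have h1 := abs_sub (truncDev G M ν (fun j => Y j ω) x u)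
      (∫ a, G (inner ℝ a x) * inner ℝ a u ^ 2 ∂ν - ∫ a, truncForm G M x u a ∂ν)
    have h2 := hbias x u hx hu
    linarith

/-! ### From the chaining bound to the stated rate. -/

/-- The excluded case, `d = 1` with `δ` near 1, is where the rate could degenerate. Keeping one
logarithm away from 0 lets additive constants be absorbed. -/
theorem log_two_le_of_two_le_or {d : ℕ} {δ : ℝ} (hδ : 0 < δ) (hδ1 : δ < 1)
    (hdδ : 2 ≤ d ∨ δ ≤ 1 / 2) : 1 / 2 ≤ Real.log d ∨ 1 / 2 ≤ Real.log (1 / δ) := by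
  have h2 := Real.log_two_gt_d9
  rcases hdδ with h | h
  · left
    have : (2 : ℝ) ≤ d := by exact_mod_cast h
    linarith [Real.log_le_log (by norm_num) this]
  · right
    have : (2 : ℝ) ≤ 1 / δ := by rw [le_div_iff₀ hδ]; linarith
    linarith [Real.log_le_log (by norm_num) this]

theorem chainBound_le_devRate {d : ℕ} (hd : 1 ≤ d) {d₁ d₃ n δ : ℝ} (hd₁ : 1 ≤ d₁) (hd₃ : 1 ≤ d₃)
    (hd₃d : d₃ ≤ d) (hn : 1 ≤ n) (hδ : 0 < δ) (hδ1 : δ < 1) (hdδ : 2 ≤ d ∨ δ ≤ 1 / 2) :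
    chainBound d d₁ d₃ √(4 * d₁ + 8 * Real.log (3 * n / (δ / 4))) n (δ / 4) + 2000000 / √n
      ≤ 10000000 * devRate d d₁ d₃ n δ := by
  have hn0 : 0 < n := by linarith
  set l := Real.log (1 / δ) with hl
  have hl0 : 0 ≤ l := Real.log_nonneg (by rw [one_le_div hδ]; exact hδ1.le)
  have hld : 0 ≤ Real.log d := Real.log_natCast_nonneg d
  have hlog2 := Real.log_two_lt_d9
  set Q := √(d₁ * Real.log d) with hQ
  set E := d₃ * Real.log d + l with hE
  set R := √(d₁ + Real.log (n / δ)) with hR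
  have hnd : 0 ≤ Real.log (n / δ) := Real.log_nonneg (by rw [one_le_div hδ]; linarith)
  have hor := log_two_le_of_two_le_or hδ hδ1 hdδ
  have hQ0 : 0 ≤ Q := Real.sqrt_nonneg _
  have hsl0 : 0 ≤ √l := Real.sqrt_nonneg _
  have hhalf : (1 : ℝ) / 2 ≤ √l + Q := by
    rcases hor with h | h
    · have : 1 / 2 ≤ Q := Real.le_sqrt_of_sq_le (by nlinarith)
      linarith
    · have : 1 / 2 ≤ √l := Real.le_sqrt_of_sq_le (by linarith)
      linarith
  -- The chaining bound has `d₃` without a logarithm. For `d ≥ 2` the factor `log d` dominates; for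
  -- `d = 1` one has `d₃ ≤ 1`, and `log (1 / δ)` takes over.
  have hE0 : d₃ ≤ 2 * E := by
    by_cases h2 : 2 ≤ d
    · have : 1 / 2 ≤ Real.log d := by
        have : (2 : ℝ) ≤ d := by exact_mod_cast h2
        linarith [Real.log_le_log (by norm_num) this, Real.log_two_gt_d9]
      nlinarith
    · have hd1 : d = 1 := by omega
      subst hd1
      have h3 : 1 / 2 ≤ l := by
        rcases hor with h | h
        · simp at h; linarith
        · exact h
      simp only [Nat.cast_one] at hd₃d
      simp only [hE, Nat.cast_one, Real.log_one]
      linarith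
  have hlog4 : Real.log (1 / (δ / 4)) ≤ l + 7 / 5 := by
    have : Real.log (1 / (δ / 4)) = l + 2 * Real.log 2 := by
      rw [hl, show 1 / (δ / 4) = 1 / δ * 2 ^ 2 by field_simp; norm_num,
        Real.log_mul (by positivity) (by norm_num), Real.log_pow]
      norm_num
    linarith
  have hsq4 : √(Real.log (1 / (δ / 4))) ≤ √l + 6 / 5 := by
    rw [Real.sqrt_le_left (by positivity)]
    nlinarith [Real.sq_sqrt hl0]
  have hM : √(4 * d₁ + 8 * Real.log (3 * n / (δ / 4))) ≤ 6 * R := by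
    rw [Real.sqrt_le_left (by positivity), mul_pow, hR, Real.sq_sqrt (by linarith)]
    have h12 : Real.log (3 * n / (δ / 4)) = Real.log 12 + Real.log (n / δ) := by
      rw [← Real.log_mul (by norm_num) (by positivity)]
      congr 1
      field_simp
      norm_num
    have h16 : Real.log 12 ≤ 4 * Real.log 2 := by
      have := Real.log_le_log (by norm_num : (0 : ℝ) < 12) (by norm_num : (12 : ℝ) ≤ 2 ^ 4)
      rwa [Real.log_pow] at this
    rw [h12]
    linarith
  have hR0 : 0 ≤ R := Real.sqrt_nonneg _
  have hE1 : 0 ≤ E := by positivity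
  have hlE : l ≤ E := by
    have : 0 ≤ d₃ * Real.log d := by positivity
    linarith
  have hlη : 0 ≤ Real.log (1 / (δ / 4)) :=
    Real.log_nonneg (by rw [one_le_div (by positivity)]; linarith)
  have t1 : 23520 * (20 * Q + 38 + 2 * √(Real.log (1 / (δ / 4)))) / √n
      ≤ 3000000 * ((√l + Q) / √n) := by
    rw [← mul_div_assoc]
    exact div_le_div_of_nonneg_right (by linarith) (Real.sqrt_nonneg n)
  have t2 : 480 * √(4 * d₁ + 8 * Real.log (3 * n / (δ / 4)))
      * (120 * d₃ + 6 + 2 * Real.log (1 / (δ / 4))) / n ≤ 1000000 * (E * R / n) := by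
    calc _ ≤ 480 * (6 * R) * (120 * (2 * E) + 6 * (2 * E) + 2 * (E + 7 / 5 * (2 * E))) / n := by
          gcongr
          · linarith
          · nlinarith
      _ ≤ 1000000 * (E * R / n) := by
          rw [← mul_div_assoc]
          exact div_le_div_of_nonneg_right (by nlinarith [mul_nonneg hE1 hR0]) hn0.le
  have t3 : 2000000 / √n ≤ 4000000 * ((√l + Q) / √n) := by
    rw [← mul_div_assoc]
    gcongr
    linarith
  have p1 : 0 ≤ (√l + Q) / √n := by positivity
  have p2 : 0 ≤ E * R / n := by positivity
  unfold chainBound devRate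
  rw [← hl, ← hQ, ← hE, ← hR]
  linarith

/-- Lets both samples be measured against the smaller size. The numerator grows with `n` only
through a logarithm, which the division by `n` outweighs. -/
theorem devRate_antitone {d : ℕ} {d₁ d₃ m n δ : ℝ} (hd₁ : 1 ≤ d₁) (hd₃ : 1 ≤ d₃)
    (hm : 1 ≤ m) (hmn : m ≤ n) (hδ : 0 < δ) (hδ1 : δ < 1) :
    devRate d d₁ d₃ n δ ≤ devRate d d₁ d₃ m δ := by
  have hm0 : 0 < m := by linarith
  have hn0 : 0 < n := by linarith
  have hl0 : 0 ≤ Real.log (1 / δ) := Real.log_nonneg (by rw [one_le_div hδ]; exact hδ1.le)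
  have hld : 0 ≤ Real.log d := Real.log_natCast_nonneg d
  have hmd : 0 ≤ Real.log (m / δ) := Real.log_nonneg (by rw [one_le_div hδ]; linarith)
  have hsq : √(d₁ + Real.log (n / δ)) ≤ n / m * √(d₁ + Real.log (m / δ)) := by
    have hr : 1 ≤ n / m := by rwa [one_le_div hm0]
    rw [Real.sqrt_le_left (by positivity), mul_pow, Real.sq_sqrt (by linarith)]
    have h1 : Real.log (n / δ) = Real.log (n / m) + Real.log (m / δ) := by
      rw [← Real.log_mul (by positivity) (by positivity)]
      congr 1
      field_simp
    have h2 := Real.log_le_sub_one_of_pos (show 0 < n / m by positivity)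
    rw [h1]
    set r := n / m
    have h3 : d₁ + (Real.log r + Real.log (m / δ)) ≤ r * (d₁ + Real.log (m / δ)) := by nlinarith
    have h4 : r * (d₁ + Real.log (m / δ)) ≤ r ^ 2 * (d₁ + Real.log (m / δ)) := by
      gcongr
      nlinarith
    exact h3.trans h4
  unfold devRate
  apply add_le_add
  · rw [div_le_div_iff₀ hn0 hm0]
    have hE1 : 0 ≤ d₃ * Real.log d + Real.log (1 / δ) := by positivity
    calc _ ≤ (d₃ * Real.log d + Real.log (1 / δ)) * (n / m * √(d₁ + Real.log (m / δ))) * m := by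
          gcongr
      _ = _ := by field_simp
  · gcongr

/-! ### Diagonalization of the covariance proxy. -/

theorem toEuclideanLin_apply_eigenvectorBasis {d : ℕ} {S : Matrix (Fin d) (Fin d) ℝ}
    (hS : S.IsHermitian) (i : Fin d) :
    Matrix.toEuclideanLin S (hS.eigenvectorBasis i)
      = hS.eigenvalues i • hS.eigenvectorBasis i := by
  have h := hS.mulVec_eigenvectorBasis i
  ext j
  have := congrFun h j
  simpa using this

theorem dotProduct_mulVec_eq_sum_eigenvalues {d : ℕ} {S : Matrix (Fin d) (Fin d) ℝ}
    (hS : S.IsHermitian) (y : Vec d) :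
    y.ofLp ⬝ᵥ (S *ᵥ y.ofLp) = ∑ i, hS.eigenvalues i * hS.eigenvectorBasis.repr y i ^ 2 := by
  set e := hS.eigenvectorBasis
  have h1 : Matrix.toEuclideanLin S y = ∑ i, (e.repr y i * hS.eigenvalues i) • e i := by
    conv_lhs => rw [← e.sum_repr y]
    rw [map_sum]
    refine Finset.sum_congr rfl fun i _ => ?_
    rw [map_smul, toEuclideanLin_apply_eigenvectorBasis, smul_smul]
  have h2 : y.ofLp ⬝ᵥ (S *ᵥ y.ofLp) = inner ℝ (Matrix.toEuclideanLin S y) y := by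
    rw [EuclideanSpace.inner_eq_star_dotProduct]
    simp
  rw [h2, h1, sum_inner]
  refine Finset.sum_congr rfl fun i _ => ?_
  rw [real_inner_smul_left, OrthonormalBasis.repr_apply_apply]
  ring

/-- The ratios `σ_i / σ₁`. -/
noncomputable def sigmaRatio {d : ℕ} {S : Matrix (Fin d) (Fin d) ℝ} (hS : S.IsHermitian)
    (i : Fin d) : ℝ :=
  √(hS.eigenvalues i) / sigmaOne hS

theorem eigenvalues_le_sigmaOne_sq {d : ℕ} {S : Matrix (Fin d) (Fin d) ℝ} (hS : S.PosDef)
    (i : Fin d) : hS.isHermitian.eigenvalues i ≤ ⨆ i, hS.isHermitian.eigenvalues i :=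
  le_ciSup (Set.finite_range _).bddAbove i

theorem sigmaOne_pos {d : ℕ} (hd : 1 ≤ d) {S : Matrix (Fin d) (Fin d) ℝ} (hS : S.PosDef) :
    0 < sigmaOne hS.isHermitian :=
  Real.sqrt_pos.2 ((hS.eigenvalues_pos ⟨0, hd⟩).trans_le (eigenvalues_le_sigmaOne_sq hS _))

theorem sigmaRatio_pos {d : ℕ} {S : Matrix (Fin d) (Fin d) ℝ} (hS : S.PosDef)
    (i : Fin d) : 0 < sigmaRatio hS.isHermitian i :=
  div_pos (Real.sqrt_pos.2 (hS.eigenvalues_pos i)) (sigmaOne_pos (Fin.pos i) hS)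

theorem sigmaRatio_le_one {d : ℕ} {S : Matrix (Fin d) (Fin d) ℝ} (hS : S.PosDef)
    (i : Fin d) : sigmaRatio hS.isHermitian i ≤ 1 :=
  div_le_one_of_le₀ (Real.sqrt_le_sqrt (eigenvalues_le_sigmaOne_sq hS i)) (Real.sqrt_nonneg _)

theorem exists_sigmaRatio_eq_one {d : ℕ} (hd : 1 ≤ d) {S : Matrix (Fin d) (Fin d) ℝ}
    (hS : S.PosDef) : ∃ i, sigmaRatio hS.isHermitian i = 1 := by
  have : Nonempty (Fin d) := ⟨⟨0, hd⟩⟩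
  obtain ⟨i, hi⟩ := exists_eq_ciSup_of_finite (f := hS.isHermitian.eigenvalues)
  refine ⟨i, ?_⟩
  have h := sigmaOne_pos hd hS
  unfold sigmaRatio
  rw [hi]
  exact div_self h.ne'

theorem effDim_one_eq {d : ℕ} {S : Matrix (Fin d) (Fin d) ℝ} (hS : S.IsHermitian) :
    effDim hS 1 = ∑ i, sigmaRatio hS i ^ 2 := by
  refine Finset.sum_congr rfl fun i _ => ?_
  rw [← Real.rpow_natCast]
  norm_num [sigmaRatio]

theorem effDim_three_eq {d : ℕ} {S : Matrix (Fin d) (Fin d) ℝ} (hS : S.IsHermitian) :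
    effDim hS 3 = ∑ i, sigmaRatio hS i ^ (2 / 3 : ℝ) := by
  refine Finset.sum_congr rfl fun i _ => ?_
  norm_num [sigmaRatio]

theorem one_le_effDim_one {d : ℕ} (hd : 1 ≤ d) {S : Matrix (Fin d) (Fin d) ℝ} (hS : S.PosDef) :
    1 ≤ effDim hS.isHermitian 1 := by
  obtain ⟨i, hi⟩ := exists_sigmaRatio_eq_one hd hS
  rw [effDim_one_eq]
  calc (1 : ℝ) = sigmaRatio hS.isHermitian i ^ 2 := by rw [hi]; norm_num
    _ ≤ _ := Finset.single_le_sum (f := fun i => sigmaRatio hS.isHermitian i ^ 2)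
      (fun j _ => sq_nonneg _) (Finset.mem_univ i)

theorem one_le_effDim_three {d : ℕ} (hd : 1 ≤ d) {S : Matrix (Fin d) (Fin d) ℝ} (hS : S.PosDef) :
    1 ≤ effDim hS.isHermitian 3 := by
  obtain ⟨i, hi⟩ := exists_sigmaRatio_eq_one hd hS
  rw [effDim_three_eq]
  calc (1 : ℝ) = sigmaRatio hS.isHermitian i ^ (2 / 3 : ℝ) := by rw [hi]; norm_num
    _ ≤ _ := Finset.single_le_sum (f := fun i => sigmaRatio hS.isHermitian i ^ (2 / 3 : ℝ))
      (fun j _ => Real.rpow_nonneg (sigmaRatio_pos hS j).le _) (Finset.mem_univ i)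

theorem effDim_three_le {d : ℕ} {S : Matrix (Fin d) (Fin d) ℝ} (hS : S.PosDef) :
    effDim hS.isHermitian 3 ≤ d := by
  rw [effDim_three_eq]
  calc _ ≤ ∑ _i : Fin d, (1 : ℝ) := Finset.sum_le_sum fun i _ =>
        Real.rpow_le_one (sigmaRatio_pos hS i).le (sigmaRatio_le_one hS i) (by norm_num)
    _ = d := by simp

/-- The linear map to the eigenbasis of `S`, scaled by `1 / σ₁`. -/
noncomputable def whiten {d : ℕ} {S : Matrix (Fin d) (Fin d) ℝ} (hS : S.IsHermitian)
    (a : Vec d) : Vec d :=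
  (sigmaOne hS)⁻¹ • hS.eigenvectorBasis.repr a

theorem measurable_whiten {d : ℕ} {S : Matrix (Fin d) (Fin d) ℝ} (hS : S.IsHermitian) :
    Measurable (whiten hS) := by
  have : Continuous (whiten hS) := hS.eigenvectorBasis.repr.continuous.const_smul (sigmaOne hS)⁻¹
  exact this.measurable

theorem inner_whiten_repr {d : ℕ} {S : Matrix (Fin d) (Fin d) ℝ} (hS : S.IsHermitian)
    (a y : Vec d) :
    inner ℝ (whiten hS a) (hS.eigenvectorBasis.repr y) = (sigmaOne hS)⁻¹ * inner ℝ a y := by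
  rw [whiten, real_inner_smul_left, LinearIsometryEquiv.inner_map_map]

/-- Normalizing `y` removes the unit-ball restriction, since both the threshold and the quadratic
form scale. The vector 0, whose normalization is meaningless, is treated directly. -/
theorem IsSubgaussianVec.measure_gt_le {Ω : Type*} [MeasurableSpace Ω] {P : Measure Ω}
    [IsProbabilityMeasure P] {d : ℕ} {S : Matrix (Fin d) (Fin d) ℝ} (hS : S.PosDef)
    {a : Ω → Vec d} (h : IsSubgaussianVec P S a) {y : Vec d} {t q : ℝ} (ht : 0 < t) (hq : 0 < q)
    (hyq : y.ofLp ⬝ᵥ (S *ᵥ y.ofLp) ≤ q ^ 2) :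
    P {ω | t * q < |inner ℝ (a ω) y|} ≤ ENNReal.ofReal (2 * Real.exp (-(t ^ 2 / 2))) := by
  by_cases hy : y = 0
  · subst hy
    have : {ω | t * q < |inner ℝ (a ω) (0 : Vec d)|} = ∅ := by
      ext ω
      simp only [inner_zero_right, abs_zero, Set.mem_ofPred_eq, Set.mem_empty_iff_false, iff_false,
        not_lt]
      positivity
    rw [this]
    simp
  · have hn : 0 < ‖y‖ := norm_pos_iff.2 hy
    have hpos : 0 < y.ofLp ⬝ᵥ (S *ᵥ y.ofLp) := by
      have := hS.dotProduct_mulVec_pos (x := y.ofLp) (by simpa using hy)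
      simpa using this
    have h1 := h (t * q / ‖y‖) (by positivity) (‖y‖⁻¹ • y) (by
      rw [norm_smul, norm_inv, norm_norm, inv_mul_cancel₀ hn.ne'])
    have hset : {ω | t * q / ‖y‖ < |inner ℝ (a ω) (‖y‖⁻¹ • y)|}
        = {ω | t * q < |inner ℝ (a ω) y|} := by
      ext ω
      simp only [Set.mem_ofPred_eq]
      rw [real_inner_smul_right, abs_mul, abs_inv, abs_norm, div_eq_inv_mul,
        mul_lt_mul_iff_right₀ (by positivity)]
    have hform : (‖y‖⁻¹ • y).ofLp ⬝ᵥ (S *ᵥ (‖y‖⁻¹ • y).ofLp)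
        = ‖y‖⁻¹ ^ 2 * (y.ofLp ⬝ᵥ (S *ᵥ y.ofLp)) := by
      simp only [WithLp.ofLp_smul, Matrix.mulVec_smul, smul_dotProduct, dotProduct_smul, smul_eq_mul]
      ring
    rw [hset, hform] at h1
    rw [← ofReal_measureReal]
    refine ENNReal.ofReal_le_ofReal (h1.trans ?_)
    set Q := y.ofLp ⬝ᵥ (S *ᵥ y.ofLp)
    have e : (t * q / ‖y‖) ^ 2 / (‖y‖⁻¹ ^ 2 * Q) = t ^ 2 * (q ^ 2 / Q) := by
      field_simp
    have h2 : 1 ≤ q ^ 2 / Q := by rwa [one_le_div hpos]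
    rw [e]
    gcongr
    nlinarith [sq_nonneg t]

theorem IsSubgaussianVec.hasSubgaussianDiag_whiten {Ω : Type*} [MeasurableSpace Ω] {P : Measure Ω}
    [IsProbabilityMeasure P] {d : ℕ} (hd : 1 ≤ d) {S : Matrix (Fin d) (Fin d) ℝ} (hS : S.PosDef)
    {a : Ω → Vec d} (ha : Measurable a) (h : IsSubgaussianVec P S a) :
    HasSubgaussianDiag ((P.map a).map (whiten hS.isHermitian)) (sigmaRatio hS.isHermitian) := by
  intro w q hq hw
  set e := hS.isHermitian.eigenvectorBasis
  set σ := sigmaOne hS.isHermitian with hσ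
  have hσ0 : 0 < σ := sigmaOne_pos hd hS
  have hT := measurable_whiten hS.isHermitian
  rw [lintegral_map (by fun_prop) hT, lintegral_map (by fun_prop) ha]
  set y := e.repr.symm w with hy
  have hin : ∀ ω, inner ℝ (whiten hS.isHermitian (a ω)) w / q
      = inner ℝ (a ω) y / (σ * q) := by
    intro ω
    have := inner_whiten_repr hS.isHermitian (a ω) y
    rw [show hS.isHermitian.eigenvectorBasis.repr y = w from e.repr.apply_symm_apply w] at this
    rw [this, ← hσ]
    field_simp
  simp_rw [hin]
  refine lintegral_exp_sq_le_of_tail P (by fun_prop) fun t ht => ?_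
  have hform : y.ofLp ⬝ᵥ (S *ᵥ y.ofLp) ≤ (σ * q) ^ 2 := by
    rw [dotProduct_mulVec_eq_sum_eigenvalues hS.isHermitian,
      show hS.isHermitian.eigenvectorBasis.repr y = w from e.repr.apply_symm_apply w, mul_pow]
    have e1 : ∑ i, hS.isHermitian.eigenvalues i * w i ^ 2
        = σ ^ 2 * quad (sigmaRatio hS.isHermitian) w := by
      rw [quad, Finset.mul_sum]
      refine Finset.sum_congr rfl fun i _ => ?_
      rw [sigmaRatio, div_pow, Real.sq_sqrt (hS.eigenvalues_pos i).le, ← hσ]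
      field_simp
    rw [e1]
    gcongr
  refine le_of_eq_of_le ?_ (h.measure_gt_le hS ht (by positivity : 0 < σ * q) hform)
  congr 1
  ext ω
  simp only [Set.mem_ofPred_eq]
  rw [abs_div, abs_of_pos (by positivity : 0 < σ * q), lt_div_iff₀ (by positivity)]

/-! ### Uniform deviation for one original sample. -/

theorem deriv_deriv_nonneg_of_convex {f : ℝ → ℝ} (hf : ConvexOn ℝ Set.univ f)
    (hd : Differentiable ℝ f) (t : ℝ) : 0 ≤ deriv (deriv f) t := by
  have h := hf.monotoneOn_deriv fun x _ => hd x
  exact (monotoneOn_univ.1 h).deriv_nonneg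

theorem measure_exists_sample_dev_gt_le {Ω : Type*} [MeasurableSpace Ω] {P : Measure Ω}
    [IsProbabilityMeasure P] {d n : ℕ} (hd : 1 ≤ d) (hn : 1 ≤ n)
    {S : Matrix (Fin d) (Fin d) ℝ} (hS : S.PosDef) {a : Fin n → Ω → Vec d}
    (ha : ∀ j, Measurable (a j)) (hind : iIndepFun a P) {ν : Measure (Vec d)}
    [IsProbabilityMeasure ν] (hlaw : ∀ j, P.map (a j) = ν) (hsub : ∀ j, IsSubgaussianVec P S (a j))
    {g : ℝ → ℝ} {L : ℝ≥0} (hg : LipschitzWith L g) (hg0 : 0 ≤ g 0)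
    {R δ : ℝ} (hR : 0 ≤ R) (hδ : 0 < δ) (hδ1 : δ < 1) (hdδ : 2 ≤ d ∨ δ ≤ 1 / 2) :
    P {ω | ∃ x u : Vec d, ‖x‖ ≤ R ∧ ‖u‖ ≤ 1 ∧
      10000000 * devScale R (sigmaOne hS.isHermitian) L (g 0)
        * devRate d (effDim hS.isHermitian 1) (effDim hS.isHermitian 3) n δ
        < |formDev g ν (fun j => a j ω) x u|} ≤ ENNReal.ofReal (δ / 2) := by
  set e := hS.isHermitian.eigenvectorBasis
  set σ := sigmaOne hS.isHermitian with hσ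
  set s := sigmaRatio hS.isHermitian with hs
  have hσ0 : 0 < σ := sigmaOne_pos hd hS
  have hT := measurable_whiten hS.isHermitian
  set A := devScale R σ L (g 0) with hA
  have hL : (0 : ℝ) ≤ L := L.2
  have hA0 : 0 ≤ A := by rw [hA, devScale]; positivity
  have hlip : ∀ t t', |g t - g t'| ≤ L * |t - t'| := fun t t' => by
    simpa [Real.dist_eq] using hg.dist_le_mul t t'
  -- If `A = 0`, division by `A` is unavailable. But then `g 0 = 0` and `R L = 0`, so `g` vanishes
  -- at every `vᵀx` with `‖x‖ ≤ R` and the deviation is 0.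
  rcases hA0.eq_or_lt with hAz | hApos
  · have h1 : R * σ ^ 3 * L = 0 ∧ σ ^ 2 * g 0 = 0 := by
      have p1 : 0 ≤ R * σ ^ 3 * L := by positivity
      have p2 : 0 ≤ σ ^ 2 * g 0 := by positivity
      rw [hA, devScale] at hAz
      constructor <;> linarith
    have hg00 : g 0 = 0 := by
      rcases mul_eq_zero.1 h1.2 with h | h
      · exact absurd h (by positivity)
      · exact h
    have hRL : R * L = 0 := by
      have : R * L * σ ^ 3 = 0 := by linarith [h1.1]
      rcases mul_eq_zero.1 this with h | h
      · exact h
      · exact absurd h (by positivity)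
    have hz : ∀ v x : Vec d, ‖x‖ ≤ R → g (inner ℝ v x) = 0 := by
      intro v x hx
      have h2 := hlip (inner ℝ v x) 0
      rw [hg00, sub_zero, sub_zero] at h2
      have h3 : L * |inner ℝ v x| ≤ 0 := by
        calc L * |inner ℝ v x| ≤ L * (‖v‖ * R) := by
              gcongr
              exact (abs_real_inner_le_norm v x).trans (by gcongr)
          _ = ‖v‖ * (R * L) := by ring
          _ = 0 := by rw [hRL, mul_zero]
      exact abs_eq_zero.1 (le_antisymm (h2.trans h3) (abs_nonneg _))
    refine le_of_eq_of_le (measure_mono_null (t := ∅) ?_ measure_empty) zero_le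
    rintro ω ⟨x, u, hx, hu, hlt⟩
    rw [← hAz] at hlt
    simp [formDev, hz _ x hx] at hlt
  -- The two summands of `A` are the Lipschitz constant and the value at 0 of `g (R σ t) σ²`, so `G`
  -- is normalized in both respects.
  · set G : ℝ → ℝ := fun t => g (R * σ * t) * σ ^ 2 / A with hG
    have hGlip : LipschitzWith 1 G := by
      refine LipschitzWith.of_dist_le_mul fun t t' => ?_
      rw [Real.dist_eq, Real.dist_eq, NNReal.coe_one, one_mul]
      have h1 : G t - G t' = (g (R * σ * t) - g (R * σ * t')) * (σ ^ 2 / A) := by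
        simp only [hG]; ring
      rw [h1, abs_mul, abs_of_pos (by positivity : 0 < σ ^ 2 / A)]
      have h2 := hlip (R * σ * t) (R * σ * t')
      rw [← mul_sub, abs_mul, abs_of_nonneg (by positivity : 0 ≤ R * σ)] at h2
      have h3 : R * σ ^ 3 * L ≤ A := by
        have : 0 ≤ σ ^ 2 * g 0 := by positivity
        rw [hA, devScale]; linarith
      calc _ ≤ L * (R * σ * |t - t'|) * (σ ^ 2 / A) := by gcongr
        _ = (R * σ ^ 3 * L) / A * |t - t'| := by ring
        _ ≤ 1 * |t - t'| := by
            gcongr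
            rwa [div_le_one hApos]
        _ = _ := one_mul _
    have hG0 : |G 0| ≤ 1 := by
      simp only [hG, mul_zero]
      rw [abs_of_nonneg (by positivity), div_le_one hApos, hA, devScale]
      have : 0 ≤ R * σ ^ 3 * L := by positivity
      linarith
    set Y : Fin n → Ω → Vec d := fun j ω => whiten hS.isHermitian (a j ω) with hY
    have hYm : ∀ j, Measurable (Y j) := fun j => hT.comp (ha j)
    have hYi : iIndepFun Y P := hind.comp (fun _ => whiten hS.isHermitian) fun _ => hT
    have hYl : ∀ j, P.map (Y j) = ν.map (whiten hS.isHermitian) := fun j => by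
      rw [← hlaw j, Measure.map_map hT (ha j)]
      rfl
    have hνp : IsProbabilityMeasure (ν.map (whiten hS.isHermitian)) :=
      Measure.isProbabilityMeasure_map hT.aemeasurable
    have hsg : HasSubgaussianDiag (ν.map (whiten hS.isHermitian)) s := by
      rw [← hlaw ⟨0, hn⟩]
      exact (hsub ⟨0, hn⟩).hasSubgaussianDiag_whiten hd hS (ha _)
    have h1 := one_le_effDim_one hd hS
    have h3 := one_le_effDim_three hd hS
    have hcore := measure_exists_formDev_gt_le hd hsg (sigmaRatio_pos hS) (sigmaRatio_le_one hS)
      (by rwa [effDim_one_eq] at h1) hGlip hG0 hn hYm hYi hYl (η := δ / 4) (by positivity)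
      (by linarith)
    rw [show 2 * (δ / 4) = δ / 2 by ring] at hcore
    refine (measure_mono ?_).trans hcore
    rintro ω ⟨x, u, hx, hu, hlt⟩
    -- This also holds for `R = 0`, where `x = 0` and `R⁻¹ = 0`.
    have hRx : R • (R⁻¹ • x) = x := by
      rcases hR.eq_or_lt with h | h
      · have : x = 0 := by rw [← norm_le_zero_iff]; linarith
        simp [this]
      · rw [smul_smul, mul_inv_cancel₀ h.ne', one_smul]
    refine ⟨e.repr (R⁻¹ • x), e.repr u, ?_, ?_, ?_⟩
    · rw [LinearIsometryEquiv.norm_map, norm_smul, norm_inv, Real.norm_eq_abs, abs_of_nonneg hR,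
        inv_mul_eq_div]
      exact div_le_one_of_le₀ hx hR
    · rwa [LinearIsometryEquiv.norm_map]
    · have hpt : ∀ v : Vec d, G (inner ℝ (whiten hS.isHermitian v) (e.repr (R⁻¹ • x)))
          * inner ℝ (whiten hS.isHermitian v) (e.repr u) ^ 2
          = g (inner ℝ v x) * inner ℝ v u ^ 2 / A := by
        intro v
        rw [inner_whiten_repr, inner_whiten_repr, ← hσ]
        simp only [hG]
        have : R * σ * (σ⁻¹ * inner ℝ v (R⁻¹ • x)) = inner ℝ v x := by
          conv_rhs => rw [← hRx, real_inner_smul_right]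
          field_simp
        rw [this]
        field_simp
      have hdev : formDev G (ν.map (whiten hS.isHermitian)) (fun j => Y j ω)
          (e.repr (R⁻¹ • x)) (e.repr u) = formDev g ν (fun j => a j ω) x u / A := by
        have hGm := hGlip.continuous.measurable
        unfold formDev
        rw [integral_map hT.aemeasurable (Measurable.aestronglyMeasurable (by fun_prop))]
        simp only [hY]
        simp_rw [hpt]
        rw [integral_div, ← Finset.sum_div]
        ring
      have hn1 : (1 : ℝ) ≤ n := by exact_mod_cast hn
      have hrate := chainBound_le_devRate hd h1 h3 (effDim_three_le hS) hn1 hδ hδ1 hdδ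
      rw [hdev, abs_div, abs_of_pos hApos, lt_div_iff₀ hApos]
      rw [effDim_one_eq, effDim_three_eq] at hrate hlt
      refine lt_of_le_of_lt ?_ hlt
      calc _ ≤ _ := mul_le_mul_of_nonneg_right hrate hApos.le
        _ = _ := by ring

/-! ### Derivatives of the regularized risk. -/

/-- The gradient of `regRisk`. -/
noncomputable def riskGrad {d n : ℕ} (ℓs : Fin n → ℝ → ℝ) (v : Fin n → Vec d) (lam : ℝ)
    (x : Vec d) : Vec d :=
  (1 / (n : ℝ)) • ∑ j, deriv (ℓs j) (inner ℝ (v j) x) • v j + lam • x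

/-- The Hessian of `regRisk` for losses with second derivative `g`. -/
noncomputable def riskHess {d n : ℕ} (g : ℝ → ℝ) (v : Fin n → Vec d) (lam : ℝ)
    (x : Vec d) : Vec d →L[ℝ] Vec d :=
  (1 / (n : ℝ)) • ∑ j, g (inner ℝ (v j) x) • (innerSL ℝ (v j)).smulRight (v j)
    + lam • ContinuousLinearMap.id ℝ (Vec d)

/-- The quadratic form of the unregularized Hessian. -/
noncomputable def hessForm {d n : ℕ} (g : ℝ → ℝ) (v : Fin n → Vec d) (x u : Vec d) : ℝ :=
  1 / (n : ℝ) * ∑ j, g (inner ℝ (v j) x) * inner ℝ (v j) u ^ 2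

theorem hasGradientAt_regRisk {d n : ℕ} {ℓs : Fin n → ℝ → ℝ} (hℓ : ∀ j, Differentiable ℝ (ℓs j))
    (v : Fin n → Vec d) (lam : ℝ) (x : Vec d) :
    HasGradientAt (regRisk ℓs v lam) (riskGrad ℓs v lam x) x := by
  rw [hasGradientAt_iff_hasFDerivAt]
  have h1 : ∀ j, HasFDerivAt (fun y : Vec d => ℓs j (inner ℝ (v j) y))
      (deriv (ℓs j) (inner ℝ (v j) x) • innerSL ℝ (v j)) x := fun j => by
    have hi : HasFDerivAt (fun y : Vec d => inner ℝ (v j) y) (innerSL ℝ (v j)) x :=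
      (innerSL ℝ (v j)).hasFDerivAt
    exact (hℓ j (inner ℝ (v j) x)).hasDerivAt.comp_hasFDerivAt x hi
  have h2 := ((HasFDerivAt.fun_sum fun j (_ : j ∈ Finset.univ) => h1 j).const_mul
    (1 / (n : ℝ))).add ((hasStrictFDerivAt_norm_sq x).hasFDerivAt.const_mul (lam / 2))
  refine h2.congr_fderiv ?_
  ext w
  simp only [riskGrad, _root_.add_apply, _root_.smul_apply,
    _root_.sum_apply, innerSL_apply_apply, InnerProductSpace.toDual_apply_apply,
    inner_add_left, real_inner_smul_left, sum_inner, smul_eq_mul, nsmul_eq_mul]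
  push_cast
  ring

theorem hasFDerivAt_riskGrad {d n : ℕ} {ℓs : Fin n → ℝ → ℝ} {g : ℝ → ℝ}
    (hℓ : ∀ j, Differentiable ℝ (deriv (ℓs j))) (hg : ∀ j t, deriv (deriv (ℓs j)) t = g t)
    (v : Fin n → Vec d) (lam : ℝ) (x : Vec d) :
    HasFDerivAt (riskGrad ℓs v lam) (riskHess g v lam x) x := by
  have h1 : ∀ j, HasFDerivAt (fun y : Vec d => deriv (ℓs j) (inner ℝ (v j) y) • v j)
      (g (inner ℝ (v j) x) • (innerSL ℝ (v j)).smulRight (v j)) x := fun j => by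
    have hi : HasFDerivAt (fun y : Vec d => inner ℝ (v j) y) (innerSL ℝ (v j)) x :=
      (innerSL ℝ (v j)).hasFDerivAt
    have h := ((hℓ j (inner ℝ (v j) x)).hasDerivAt.comp_hasFDerivAt x hi).smul_const (v j)
    rw [hg] at h
    refine h.congr_fderiv ?_
    ext w
    simp [mul_assoc]
  exact ((HasFDerivAt.fun_sum fun j (_ : j ∈ Finset.univ) => h1 j).const_smul
    (1 / (n : ℝ))).add ((hasFDerivAt_id x).const_smul lam)

theorem gradient_regRisk {d n : ℕ} {ℓs : Fin n → ℝ → ℝ} (hℓ : ∀ j, Differentiable ℝ (ℓs j))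
    (v : Fin n → Vec d) (lam : ℝ) :
    (fun x => gradient (regRisk ℓs v lam) x) = riskGrad ℓs v lam :=
  funext fun x => (hasGradientAt_regRisk hℓ v lam x).gradient

theorem hess_regRisk {d n : ℕ} {ℓs : Fin n → ℝ → ℝ} {g : ℝ → ℝ}
    (hℓ : ∀ j, Differentiable ℝ (ℓs j))
    (hℓ' : ∀ j, Differentiable ℝ (deriv (ℓs j))) (hg : ∀ j t, deriv (deriv (ℓs j)) t = g t)
    (v : Fin n → Vec d) (lam : ℝ) (x : Vec d) :
    hess (regRisk ℓs v lam) x = riskHess g v lam x := by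
  rw [hess, gradient_regRisk hℓ]
  exact (hasFDerivAt_riskGrad hℓ' hg v lam x).fderiv

theorem inner_riskHess_apply {d n : ℕ} (g : ℝ → ℝ) (v : Fin n → Vec d) (lam : ℝ) (x u w : Vec d) :
    inner ℝ (riskHess g v lam x u) w
      = 1 / (n : ℝ) * ∑ j, g (inner ℝ (v j) x) * (inner ℝ (v j) u * inner ℝ (v j) w)
        + lam * inner ℝ u w := by
  simp only [riskHess, _root_.add_apply, _root_.smul_apply,
    _root_.sum_apply, ContinuousLinearMap.smulRight_apply, innerSL_apply_apply,
    ContinuousLinearMap.id_apply, inner_add_left, real_inner_smul_left, sum_inner]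

theorem inner_riskHess_self {d n : ℕ} (g : ℝ → ℝ) (v : Fin n → Vec d) (lam : ℝ) (x u : Vec d) :
    inner ℝ (riskHess g v lam x u) u = hessForm g v x u + lam * ‖u‖ ^ 2 := by
  rw [inner_riskHess_apply, hessForm, real_inner_self_eq_norm_sq]
  simp_rw [sq]

/-- Polarization: `4 ⟨Tu, w⟩` is the difference of the quadratic form at `u + w` and `u - w`, and
the parallelogram law bounds it by `4c` for unit vectors. Take `w` along `Tu`. -/
theorem opNorm_le_of_symmetric_of_abs_inner_le {E : Type*} [NormedAddCommGroup E]
    [InnerProductSpace ℝ E] {T : E →L[ℝ] E} (hT : ∀ u w, inner ℝ (T u) w = inner ℝ (T w) u)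
    {c : ℝ} (hc : 0 ≤ c) (h : ∀ u, |inner ℝ (T u) u| ≤ c * ‖u‖ ^ 2) : ‖T‖ ≤ c := by
  refine T.opNorm_le_of_unit_norm hc fun u hu => ?_
  by_cases h0 : T u = 0
  · simpa [h0] using hc
  have hn : 0 < ‖T u‖ := norm_pos_iff.2 h0
  set w := ‖T u‖⁻¹ • T u with hw
  have hwn : ‖w‖ = 1 := by rw [hw, norm_smul, norm_inv, norm_norm, inv_mul_cancel₀ hn.ne']
  have h1 : inner ℝ (T u) w = ‖T u‖ := by
    rw [hw, real_inner_smul_right, real_inner_self_eq_norm_sq]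
    field_simp
  have h2 : inner ℝ (T (u + w)) (u + w) - inner ℝ (T (u - w)) (u - w) = 4 * inner ℝ (T u) w := by
    simp only [map_add, map_sub, inner_add_left, inner_add_right, inner_sub_left, inner_sub_right]
    rw [hT w u]
    ring
  have h3 := (abs_le.1 (h (u + w))).2
  have h4 := (abs_le.1 (h (u - w))).1
  have h5 := parallelogram_law_with_norm ℝ u w
  rw [hu, hwn] at h5
  nlinarith

theorem hessForm_nonneg {d n : ℕ} {g : ℝ → ℝ} (hg : ∀ t, 0 ≤ g t) (v : Fin n → Vec d)
    (x u : Vec d) : 0 ≤ hessForm g v x u := by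
  unfold hessForm
  refine mul_nonneg (by positivity) (Finset.sum_nonneg fun j _ => ?_)
  exact mul_nonneg (hg _) (sq_nonneg _)

theorem hessForm_smul {d n : ℕ} (g : ℝ → ℝ) (v : Fin n → Vec d) (x u : Vec d) (r : ℝ) :
    hessForm g v x (r • u) = r ^ 2 * hessForm g v x u := by
  unfold hessForm
  simp only [real_inner_smul_right, mul_pow]
  rw [mul_left_comm (r ^ 2)]
  congr 1
  rw [Finset.mul_sum]
  refine Finset.sum_congr rfl fun j _ => ?_
  ring

theorem abs_hessForm_sub_le_mul_norm_sq {d n N : ℕ} {g : ℝ → ℝ} {v : Fin n → Vec d}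
    {w : Fin N → Vec d} {x : Vec d} {c : ℝ}
    (h : ∀ u, ‖u‖ ≤ 1 → |hessForm g w x u - hessForm g v x u| ≤ c) (u : Vec d) :
    |hessForm g w x u - hessForm g v x u| ≤ c * ‖u‖ ^ 2 := by
  by_cases hu : u = 0
  · subst hu
    simp [hessForm]
  · have hn : 0 < ‖u‖ := norm_pos_iff.2 hu
    have h1 := h (‖u‖⁻¹ • u) (by rw [norm_smul, norm_inv, norm_norm, inv_mul_cancel₀ hn.ne'])
    rw [hessForm_smul, hessForm_smul, ← mul_sub, abs_mul, abs_of_nonneg (by positivity)] at h1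
    calc _ = ‖u‖ ^ 2 * (‖u‖⁻¹ ^ 2 * |hessForm g w x u - hessForm g v x u|) := by field_simp
      _ ≤ ‖u‖ ^ 2 * c := by gcongr
      _ = _ := mul_comm _ _

theorem norm_riskHess_sub_le {d n N : ℕ} {g : ℝ → ℝ} {v : Fin n → Vec d} {w : Fin N → Vec d}
    {x : Vec d} {lam c : ℝ} (hc : 0 ≤ c)
    (h : ∀ u, |hessForm g w x u - hessForm g v x u| ≤ c * ‖u‖ ^ 2) :
    ‖riskHess g w lam x - riskHess g v lam x‖ ≤ c := by
  refine opNorm_le_of_symmetric_of_abs_inner_le (fun a b => ?_) hc fun u => ?_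
  · simp only [_root_.sub_apply, inner_sub_left, inner_riskHess_apply]
    rw [real_inner_comm b a]
    simp_rw [mul_comm (inner ℝ _ b) (inner ℝ _ a)]
  · rw [_root_.sub_apply, inner_sub_left, inner_riskHess_self, inner_riskHess_self]
    simpa using h u

theorem bregman_regRisk {d n : ℕ} {ℓs : Fin n → ℝ → ℝ} (hℓ : ∀ j, Differentiable ℝ (ℓs j))
    (v : Fin n → Vec d) (lam : ℝ) (x y : Vec d) :
    bregman (regRisk ℓs v lam) x y = regRisk ℓs v lam x - regRisk ℓs v lam y
      - inner ℝ (riskGrad ℓs v lam y) (x - y) := by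
  rw [bregman, (hasGradientAt_regRisk hℓ v lam y).gradient]

/-! ### Bregman comparison and the relative condition number. -/

theorem sub_sub_nonneg_of_second_deriv_nonneg {p p' p'' : ℝ → ℝ}
    (h1 : ∀ t, HasDerivAt p (p' t) t) (h2 : ∀ t, HasDerivAt p' (p'' t) t)
    (h3 : ∀ t ∈ Set.Icc (0 : ℝ) 1, 0 ≤ p'' t) : 0 ≤ p 1 - p 0 - p' 0 := by
  have hmono : MonotoneOn p' (Set.Icc 0 1) := by
    refine monotoneOn_of_deriv_nonneg (convex_Icc 0 1)
      (fun t _ => (h2 t).continuousAt.continuousWithinAt)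
      (fun t _ => (h2 t).differentiableAt.differentiableWithinAt) fun t ht => ?_
    rw [(h2 t).deriv]
    exact h3 t (interior_subset ht)
  obtain ⟨c, hc, hc'⟩ := exists_hasDerivAt_eq_slope p p' one_pos
    (fun t _ => (h1 t).continuousAt.continuousWithinAt) fun t _ => h1 t
  have := hmono (Set.left_mem_Icc.2 zero_le_one) ⟨hc.1.le, hc.2.le⟩ hc.1.le
  rw [hc'] at this
  simp only [sub_zero, div_one] at this
  linarith

/-- A Bregman divergence is the first-order Taylor remainder along the segment from `y` to `x`,
which stays in the ball. The function `c · (first risk) - (second risk)` has nonnegative second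
derivative there. -/
theorem bregman_regRisk_le {d n N : ℕ} {ℓs : Fin n → ℝ → ℝ} {ℓt : Fin N → ℝ → ℝ} {g g' : ℝ → ℝ}
    (hs1 : ∀ j, Differentiable ℝ (ℓs j)) (hs2 : ∀ j, Differentiable ℝ (deriv (ℓs j)))
    (hs3 : ∀ j t, deriv (deriv (ℓs j)) t = g t)
    (ht1 : ∀ j, Differentiable ℝ (ℓt j)) (ht2 : ∀ j, Differentiable ℝ (deriv (ℓt j)))
    (ht3 : ∀ j t, deriv (deriv (ℓt j)) t = g' t)
    {v : Fin n → Vec d} {w : Fin N → Vec d} {lam lam' c R : ℝ}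
    (h : ∀ z, ‖z‖ ≤ R → ∀ u, hessForm g' w z u + lam' * ‖u‖ ^ 2
      ≤ c * (hessForm g v z u + lam * ‖u‖ ^ 2)) {x y : Vec d} (hx : ‖x‖ ≤ R) (hy : ‖y‖ ≤ R) :
    bregman (regRisk ℓt w lam') x y ≤ c * bregman (regRisk ℓs v lam) x y := by
  rw [bregman_regRisk hs1, bregman_regRisk ht1]
  have hline : ∀ t : ℝ, HasDerivAt (fun t : ℝ => y + t • (x - y)) (x - y) t := fun t => by
    simpa using ((hasDerivAt_id t).smul_const (x - y)).const_add y
  have d1 : ∀ t : ℝ, HasDerivAt (fun t : ℝ => regRisk ℓs v lam (y + t • (x - y)))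
      (inner ℝ (riskGrad ℓs v lam (y + t • (x - y))) (x - y)) t := fun t => by
    have := (hasGradientAt_regRisk hs1 v lam (y + t • (x - y))).hasFDerivAt.comp_hasDerivAt t
      (hline t)
    simpa [Function.comp_def] using this
  have d2 : ∀ t : ℝ, HasDerivAt (fun t : ℝ => regRisk ℓt w lam' (y + t • (x - y)))
      (inner ℝ (riskGrad ℓt w lam' (y + t • (x - y))) (x - y)) t := fun t => by
    have := (hasGradientAt_regRisk ht1 w lam' (y + t • (x - y))).hasFDerivAt.comp_hasDerivAt t
      (hline t)
    simpa [Function.comp_def] using this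
  have e1 : ∀ t : ℝ, HasDerivAt (fun t : ℝ => inner ℝ (riskGrad ℓs v lam (y + t • (x - y))) (x - y))
      (inner ℝ (riskHess g v lam (y + t • (x - y)) (x - y)) (x - y)) t := fun t => by
    have := (hasFDerivAt_riskGrad hs2 hs3 v lam (y + t • (x - y))).comp_hasDerivAt t (hline t)
    simpa using this.inner ℝ (hasDerivAt_const t (x - y))
  have e2 : ∀ t : ℝ,
      HasDerivAt (fun t : ℝ => inner ℝ (riskGrad ℓt w lam' (y + t • (x - y))) (x - y))
      (inner ℝ (riskHess g' w lam' (y + t • (x - y)) (x - y)) (x - y)) t := fun t => by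
    have := (hasFDerivAt_riskGrad ht2 ht3 w lam' (y + t • (x - y))).comp_hasDerivAt t (hline t)
    simpa using this.inner ℝ (hasDerivAt_const t (x - y))
  have key := sub_sub_nonneg_of_second_deriv_nonneg
    (fun t => ((d1 t).const_mul c).sub (d2 t)) (fun t => ((e1 t).const_mul c).sub (e2 t))
    (fun t ht => by
      have hz : ‖y + t • (x - y)‖ ≤ R := by
        have := (convex_closedBall (0 : Vec d) R).add_smul_sub_mem (x := y) (y := x)
          (by simpa using hy) (by simpa using hx) ht
        simpa using this
      have := h _ hz (x - y)
      rw [inner_riskHess_self, inner_riskHess_self]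
      linarith)
  simp only [Pi.sub_apply, one_smul, zero_smul, add_zero, add_sub_cancel] at key
  linarith

theorem half_mul_norm_sq_le_bregman_regRisk {d n : ℕ} {ℓs : Fin n → ℝ → ℝ} {g : ℝ → ℝ}
    (hs1 : ∀ j, Differentiable ℝ (ℓs j)) (hs2 : ∀ j, Differentiable ℝ (deriv (ℓs j)))
    (hs3 : ∀ j t, deriv (deriv (ℓs j)) t = g t) (hg : ∀ t, 0 ≤ g t)
    (v : Fin n → Vec d) (lam : ℝ) (x y : Vec d) :
    lam / 2 * ‖x - y‖ ^ 2 ≤ bregman (regRisk ℓs v lam) x y := by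
  -- The pure regularizer is the risk with zero losses, and its Bregman divergence is exactly `lam /
  -- 2 * ‖x - y‖ ^ 2`.
  have h := bregman_regRisk_le (ℓt := fun (_ : Fin n) (_ : ℝ) => (0 : ℝ)) (g' := fun _ => 0)
    (w := v) (lam' := lam) (c := 1) (R := max ‖x‖ ‖y‖) (lam := lam) hs1 hs2 hs3
    (fun j => by fun_prop) (fun j => by simp) (fun j t => by simp) (v := v)
    (fun z _ u => by
      have := hessForm_nonneg hg v z u
      simp only [hessForm, zero_mul, Finset.sum_const_zero, mul_zero] at this ⊢
      linarith) (le_max_left ‖x‖ ‖y‖) (le_max_right ‖x‖ ‖y‖)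
  rw [one_mul] at h
  refine le_of_eq_of_le ?_ h
  rw [bregman_regRisk (fun j => by fun_prop)]
  simp only [regRisk, riskGrad, Finset.sum_const_zero, mul_zero, zero_add, deriv_const, zero_smul,
    smul_zero, real_inner_smul_left, inner_sub_right, real_inner_self_eq_norm_sq]
  rw [norm_sub_sq_real, real_inner_comm]
  ring

/-- A pair of distinct points gives a ratio `r` of positive divergences that bounds the infimum's
set below and the supremum's set above. Both constants are thus genuine, and `σ ≤ r ≤ L` gives the
lower bound 1. -/
theorem relCondNumber_mem_Icc {d : ℕ} {D : Set (Vec d)} {F φ : Vec d → ℝ} {c : ℝ} (hc : 0 < c)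
    (hD : D.Nontrivial) (hpos : ∀ x ∈ D, ∀ y ∈ D, x ≠ y → 0 < bregman F x y)
    (h1 : ∀ x ∈ D, ∀ y ∈ D, bregman F x y ≤ bregman φ x y)
    (h2 : ∀ x ∈ D, ∀ y ∈ D, bregman φ x y ≤ c * bregman F x y) :
    1 ≤ relCondNumber D F φ ∧ relCondNumber D F φ ≤ c := by
  obtain ⟨x, hx, y, hy, hxy⟩ := hD
  have hF := hpos x hx y hy hxy
  have hφ : 0 < bregman φ x y := hF.trans_le (h1 x hx y hy)
  set r := bregman F x y / bregman φ x y
  have hL1 : relSmoothConst D F φ ≤ 1 :=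
    csInf_le ⟨r, fun M hM => (div_le_iff₀ hφ).2 (hM x hx y hy)⟩
      fun a ha b hb => by rw [one_mul]; exact h1 a ha b hb
  have hL2 : r ≤ relSmoothConst D F φ :=
    le_csInf ⟨1, fun a ha b hb => by rw [one_mul]; exact h1 a ha b hb⟩
      fun M hM => (div_le_iff₀ hφ).2 (hM x hx y hy)
  have hmem : ∀ a ∈ D, ∀ b ∈ D, c⁻¹ * bregman φ a b ≤ bregman F a b := fun a ha b hb => by
    rw [inv_mul_le_iff₀ hc]; exact h2 a ha b hb
  have hS1 : c⁻¹ ≤ relStrongConvConst D F φ :=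
    le_csSup ⟨r, fun M hM => (le_div_iff₀ hφ).2 (hM x hx y hy)⟩ hmem
  have hS2 : relStrongConvConst D F φ ≤ r :=
    csSup_le ⟨c⁻¹, hmem⟩ fun M hM => (le_div_iff₀ hφ).2 (hM x hx y hy)
  have hS0 : 0 < relStrongConvConst D F φ := (inv_pos.2 hc).trans_le hS1
  constructor
  · rw [relCondNumber, one_le_div hS0]
    exact hS2.trans hL2
  · rw [relCondNumber, div_le_iff₀ hS0]
    refine hL1.trans ?_
    rwa [inv_le_iff_one_le_mul₀' hc] at hS1

/-! ### Simplification of the rate up to logarithms. -/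

theorem devRate_nonneg {d : ℕ} {d₁ d₃ m δ : ℝ} (hd₃ : 0 ≤ d₃) (hm : 0 < m) (hδ : 0 < δ)
    (hδ1 : δ < 1) : 0 ≤ devRate d d₁ d₃ m δ := by
  have hl0 : 0 ≤ Real.log (1 / δ) := Real.log_nonneg (by rw [one_le_div hδ]; exact hδ1.le)
  have hld : 0 ≤ Real.log d := Real.log_natCast_nonneg d
  unfold devRate
  positivity

theorem devRate_le_log_sq_mul_max {d : ℕ} {d₁ d₃ m δ : ℝ} (hd₁ : 1 ≤ d₁) (hd₃ : 1 ≤ d₃)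
    (hm : 1 ≤ m) (hδ : 0 < δ) (hδ1 : δ < 1) :
    devRate d d₁ d₃ m δ ≤ 3 * ((1 + Real.log d + Real.log m + Real.log (1 / δ)) ^ 2
      * max (√d₁ / √m) (√d₁ * d₃ / m)) := by
  have hm0 : 0 < m := by linarith
  have hl0 : 0 ≤ Real.log (1 / δ) := Real.log_nonneg (by rw [one_le_div hδ]; exact hδ1.le)
  have hld : 0 ≤ Real.log d := Real.log_natCast_nonneg d
  have hlm : 0 ≤ Real.log m := Real.log_nonneg hm
  have hmd : Real.log (m / δ) = Real.log m + Real.log (1 / δ) := by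
    rw [← Real.log_mul (by positivity) (by positivity)]
    congr 1
    field_simp
  unfold devRate
  rw [hmd]
  set l := Real.log (1 / δ)
  set Λ := 1 + Real.log d + Real.log m + l with hΛ
  have hΛ1 : 1 ≤ Λ := by linarith
  have hs1 : 1 ≤ √d₁ := by rwa [Real.one_le_sqrt]
  have hsq1 : √d₁ ^ 2 = d₁ := Real.sq_sqrt (by linarith)
  set X := max (√d₁ / √m) (√d₁ * d₃ / m) with hX
  have hX1 : √d₁ / √m ≤ X := le_max_left _ _
  have hX2 : √d₁ * d₃ / m ≤ X := le_max_right _ _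
  have hΛ2 : d₁ * Λ ≤ d₁ * Λ ^ 2 := by
    have : Λ ≤ Λ ^ 2 := by nlinarith
    gcongr
  have b1 : √(d₁ + (Real.log m + l)) ≤ √d₁ * Λ := by
    rw [Real.sqrt_le_left (by positivity), mul_pow, hsq1]
    nlinarith
  have b2 : d₃ * Real.log d + l ≤ d₃ * Λ := by nlinarith
  have b3 : √l ≤ √d₁ * Λ := by
    rw [Real.sqrt_le_left (by positivity), mul_pow, hsq1]
    nlinarith
  have b4 : √(d₁ * Real.log d) ≤ √d₁ * Λ := by
    rw [Real.sqrt_le_left (by positivity), mul_pow, hsq1]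
    exact (mul_le_mul_of_nonneg_left (by linarith) (by linarith)).trans hΛ2
  have t1 : (d₃ * Real.log d + l) * √(d₁ + (Real.log m + l)) / m ≤ Λ ^ 2 * X := by
    calc _ ≤ (d₃ * Λ) * (√d₁ * Λ) / m := by gcongr
      _ = Λ ^ 2 * (√d₁ * d₃ / m) := by ring
      _ ≤ _ := by gcongr
  have t2 : (√l + √(d₁ * Real.log d)) / √m ≤ 2 * (Λ ^ 2 * X) := by
    calc _ ≤ (√d₁ * Λ + √d₁ * Λ) / √m := by gcongr
      _ = 2 * (Λ * (√d₁ / √m)) := by ring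
      _ ≤ 2 * (Λ ^ 2 * X) := by
          gcongr
          nlinarith
  linarith

end StatPrecond

/-! ### The theorem. -/

open MeasureTheory ProbabilityTheory
open scoped NNReal Matrix

theorem mainTheorem7 :
    ∃ C C' : ℝ, ∃ k : ℕ, 0 < C ∧ 0 < C' ∧
      ∀ (Ω : Type*) [MeasurableSpace Ω] (P : Measure Ω) [IsProbabilityMeasure P]
        (d n N : ℕ) (_ : 1 ≤ d) (_ : 1 ≤ n) (_ : 1 ≤ N)
        (S : Matrix (Fin d) (Fin d) ℝ) (hS : S.PosDef)
        (ℓ : ℝ → ℝ) (L : ℝ≥0)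
        (ℓs : Fin n → ℝ → ℝ) (a : Fin n → Ω → StatPrecond.Vec d)
        (ℓt : Fin N → ℝ → ℝ) (b : Fin N → Ω → StatPrecond.Vec d)
        (_ : StatPrecond.IsEmpiricalRiskModel P S ℓ L ℓs a)
        (_ : StatPrecond.IsEmpiricalRiskModel P S ℓ L ℓt b)
        (_ : ∀ i j, IdentDistrib (b i) (a j) P P)
        (lam R δ : ℝ) (_ : 0 < lam) (_ : 0 ≤ R) (_ : 0 < δ) (_ : δ < 1)
        (_ : 2 ≤ d ∨ δ ≤ 1 / 2)
        (D : Set (StatPrecond.Vec d)) (ψ : StatPrecond.Vec d → ℝ) (_ : ConvexOn ℝ D ψ)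
        (_ : ∀ x ∈ D, ‖x‖ ≤ R),
        let m : ℝ := min (n : ℝ) (N : ℝ)
        let d₁ : ℝ := StatPrecond.effDim hS.isHermitian 1
        let d₃ : ℝ := StatPrecond.effDim hS.isHermitian 3
        let A : ℝ :=
          StatPrecond.devScale R (StatPrecond.sigmaOne hS.isHermitian) L (deriv (deriv ℓ) 0)
        let μ : ℝ := C * A * StatPrecond.devRate d d₁ d₃ m δ
        let F : Ω → StatPrecond.Vec d → ℝ :=
          fun ω => StatPrecond.regRisk ℓs (fun j => a j ω) lam
        let ft : Ω → StatPrecond.Vec d → ℝ :=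
          fun ω => StatPrecond.regRisk ℓt (fun i => b i ω) lam
        let φ : Ω → StatPrecond.Vec d → ℝ := fun ω x => ft ω x + μ / 2 * ‖x‖ ^ 2
        P {ω | (∀ x, ‖x‖ ≤ R →
                  ‖StatPrecond.hess (ft ω) x - StatPrecond.hess (F ω) x‖ ≤ μ) ∧
               (D.Nontrivial →
                  1 ≤ StatPrecond.relCondNumber D (F ω) (φ ω) ∧
                  StatPrecond.relCondNumber D (F ω) (φ ω) ≤
                    1 + C' * (1 + Real.log d + Real.log m + Real.log (1 / δ)) ^ k *
                      (A / lam * max (√d₁ / √m) (√d₁ * d₃ / m)))}ᶜ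
          ≤ ENNReal.ofReal δ := by
  -- `C` is twice the one-sample constant. `C'` is `2 C` (from `2μ/λ`) times the 3 of
  -- `devRate_le_log_sq_mul_max`, whose logarithmic factor is squared.
  refine ⟨20000000, 120000000, 2, by norm_num, by norm_num, ?_⟩
  intro Ω _ P _ d n N hd hn hN S hS ℓ L ℓs a ℓt b ha hb hab lam R δ hlam hR hδ hδ1 hdδ D ψ _ hDR
    m d₁ d₃ A μ F ft φ
  set g := deriv (deriv ℓ) with hg
  have hgn : ∀ t, 0 ≤ g t :=
    StatPrecond.deriv_deriv_nonneg_of_convex ha.convex_loss ha.differentiable_loss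
  set ν : Measure (StatPrecond.Vec d) := P.map (a ⟨0, hn⟩) with hν
  have hνp : IsProbabilityMeasure ν :=
    Measure.isProbabilityMeasure_map (ha.measurable_sample _).aemeasurable
  have hla : ∀ j, P.map (a j) = ν := fun j => (ha.identDistrib_sample j _).map_eq
  have hlb : ∀ i, P.map (b i) = ν := fun i => (hab i _).map_eq
  have hn1 : (1 : ℝ) ≤ n := by exact_mod_cast hn
  have hN1 : (1 : ℝ) ≤ N := by exact_mod_cast hN
  have hm1 : 1 ≤ m := le_min hn1 hN1
  have hd₁ : 1 ≤ d₁ := StatPrecond.one_le_effDim_one hd hS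
  have hd₃ : 1 ≤ d₃ := StatPrecond.one_le_effDim_three hd hS
  have hσ := StatPrecond.sigmaOne_pos hd hS
  have hA0 : 0 ≤ A := by
    have := hgn 0
    have := L.2
    simp only [A, StatPrecond.devScale]
    positivity
  have hrate0 : 0 ≤ StatPrecond.devRate d d₁ d₃ m δ :=
    StatPrecond.devRate_nonneg (by linarith) (by linarith) hδ hδ1
  have hμ0 : 0 ≤ μ := by positivity
  have hda := StatPrecond.measure_exists_sample_dev_gt_le hd hn hS ha.measurable_sample
    ha.indep_sample hla ha.subgaussian_sample ha.lipschitz_deriv2_loss (hgn 0) hR hδ hδ1 hdδ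
  have hdb := StatPrecond.measure_exists_sample_dev_gt_le hd hN hS hb.measurable_sample
    hb.indep_sample hlb hb.subgaussian_sample hb.lipschitz_deriv2_loss (hgn 0) hR hδ hδ1 hdδ
  have hδ2 : ENNReal.ofReal δ = ENNReal.ofReal (δ / 2) + ENNReal.ofReal (δ / 2) := by
    rw [← ENNReal.ofReal_add (by positivity) (by positivity), add_halves]
  rw [hδ2]
  -- The failure event is covered by the two one-sample failures of probability `δ / 2`. This is an
  -- outer measure bound, with no measurability required and no independence between samples.
  refine (measure_mono ?_).trans ((measure_union_le _ _).trans (add_le_add hda hdb))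
  rw [Set.compl_subset_comm]
  intro ω hω
  simp only [Set.mem_compl_iff, Set.mem_union, Set.mem_ofPred_eq, not_or, not_exists, not_and,
    not_lt] at hω
  obtain ⟨hωa, hωb⟩ := hω
  have hra := StatPrecond.devRate_antitone (d := d) hd₁ hd₃ hm1 (min_le_left (n : ℝ) N) hδ hδ1
  have hrb := StatPrecond.devRate_antitone (d := d) hd₁ hd₃ hm1 (min_le_right (n : ℝ) N) hδ hδ1
  set va : Fin n → StatPrecond.Vec d := fun j => a j ω
  set vb : Fin N → StatPrecond.Vec d := fun i => b i ω
  have hdev : ∀ x, ‖x‖ ≤ R → ∀ u, |StatPrecond.hessForm g vb x u - StatPrecond.hessForm g va x u|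
      ≤ μ * ‖u‖ ^ 2 := by
    intro x hx u
    refine StatPrecond.abs_hessForm_sub_le_mul_norm_sq (fun u hu => ?_) u
    have h1 := hωa x u hx hu
    have h2 := hωb x u hx hu
    have h3 : 10000000 * A * StatPrecond.devRate d d₁ d₃ n δ
        ≤ 10000000 * A * StatPrecond.devRate d d₁ d₃ m δ := by gcongr
    have h4 : 10000000 * A * StatPrecond.devRate d d₁ d₃ N δ
        ≤ 10000000 * A * StatPrecond.devRate d d₁ d₃ m δ := by gcongr
    have e : StatPrecond.hessForm g vb x u - StatPrecond.hessForm g va x u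
        = StatPrecond.formDev g ν vb x u - StatPrecond.formDev g ν va x u := by
      unfold StatPrecond.hessForm StatPrecond.formDev
      ring
    rw [e]
    calc _ ≤ |StatPrecond.formDev g ν vb x u| + |StatPrecond.formDev g ν va x u| := abs_sub _ _
      _ ≤ 10000000 * A * StatPrecond.devRate d d₁ d₃ m δ
          + 10000000 * A * StatPrecond.devRate d d₁ d₃ m δ :=
        add_le_add (h2.trans h4) (h1.trans h3)
      _ = μ := by simp only [μ]; ring
  -- The extra quadratic merges into the regularizer, so the comparison of risks applies to `φ` as
  -- well.
  have hφ : φ ω = StatPrecond.regRisk ℓt vb (lam + μ) := by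
    ext x
    simp only [φ, ft, StatPrecond.regRisk, vb]
    ring
  refine ⟨fun x hx => ?_, fun hDn => ?_⟩
  · simp only [ft, F]
    rw [StatPrecond.hess_regRisk hb.differentiable_losses hb.differentiable_deriv_losses
      hb.deriv2_losses, StatPrecond.hess_regRisk ha.differentiable_losses
      ha.differentiable_deriv_losses ha.deriv2_losses]
    exact StatPrecond.norm_riskHess_sub_le hμ0 (hdev x hx)
  -- The Hessian of `φ` exceeds that of `F` by at most `2μ`: one `μ` from the deviation and one from
  -- the added quadratic. This is at most `2μ/λ` times the Hessian of `F`, which dominates `λ`.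
  · have hc : 0 < 1 + 2 * μ / lam := by positivity
    have hκ := StatPrecond.relCondNumber_mem_Icc (F := F ω) (φ := φ ω) hc hDn
      (fun x _ y _ hxy => by
        have h1 := StatPrecond.half_mul_norm_sq_le_bregman_regRisk ha.differentiable_losses
          ha.differentiable_deriv_losses ha.deriv2_losses hgn va lam x y
        have h2 : 0 < ‖x - y‖ := norm_pos_iff.2 (sub_ne_zero.2 hxy)
        have h3 : 0 < lam / 2 * ‖x - y‖ ^ 2 := by positivity
        exact h3.trans_le h1)
      (fun x hx y hy => by
        rw [hφ, ← one_mul (StatPrecond.bregman (StatPrecond.regRisk ℓt vb (lam + μ)) x y)]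
        refine StatPrecond.bregman_regRisk_le hb.differentiable_losses
          hb.differentiable_deriv_losses hb.deriv2_losses ha.differentiable_losses
          ha.differentiable_deriv_losses ha.deriv2_losses (fun z hz u => ?_) (hDR x hx) (hDR y hy)
        have := (abs_le.1 (hdev z hz u)).1
        linarith)
      (fun x hx y hy => by
        rw [hφ]
        refine StatPrecond.bregman_regRisk_le ha.differentiable_losses
          ha.differentiable_deriv_losses ha.deriv2_losses hb.differentiable_losses
          hb.differentiable_deriv_losses hb.deriv2_losses (fun z hz u => ?_) (hDR x hx) (hDR y hy)
        have h1 := (abs_le.1 (hdev z hz u)).2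
        have h2 : 0 ≤ 2 * μ / lam * StatPrecond.hessForm g va z u :=
          mul_nonneg (by positivity) (StatPrecond.hessForm_nonneg hgn va z u)
        have h3 : 2 * μ / lam * (lam * ‖u‖ ^ 2) = 2 * (μ * ‖u‖ ^ 2) := by field_simp
        linarith)
    refine ⟨hκ.1, hκ.2.trans ?_⟩
    have hfin := StatPrecond.devRate_le_log_sq_mul_max (d := d) hd₁ hd₃ hm1 hδ hδ1
    have hAl : 0 ≤ 40000000 * (A / lam) := by positivity
    have := mul_le_mul_of_nonneg_left hfin hAl
    have e : 2 * μ / lam = 40000000 * (A / lam) * StatPrecond.devRate d d₁ d₃ m δ := by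
      simp only [μ]; ring
    rw [e]
    linarith
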